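/- Let $\varphi(x)=e^{-x^2/2}/\sqrt{2\pi}$, $\overline{\Phi}(x)=\int_x^\infty\varphi(u)\,du$ and $\mathcal{E}(x)=\varphi(x)/\overline{\Phi}(x)$. For $q\in[0,1)$, $\psi\ge 0$ and $\alpha>0$ define $$P(\psi)=\int_{\mathbb{R}}\tanh(\psi^{1/2}z)^2\,\varphi(z)\,dz,\qquad R(q,\alpha)=\alpha\int_{\mathbb{R}}\frac{1}{1-q}\,\mathcal{E}\Big(\frac{-q^{1/2}z}{\sqrt{1-q}}\Big)^2\varphi(z)\,dz,$$ $$\mathscr{G}(\alpha,q,\psi)=-\frac{\psi(1-q)}{2}+\int_{\mathbb{R}}\log\big(2\cosh(\psi^{1/2}z)\big)\varphi(z)\,dz+\alpha\int_{\mathbb{R}}\log\overline{\Phi}\Big(\frac{-q^{1/2}z}{\sqrt{1-q}}\Big)\varphi(z)\,dz$$ (these are the functions of the Ising perceptron at margin $\kappa=0$). Let $\alpha_{\rm lbd}=0.833078599$, $\alpha_{\rm ubd}=0.833078600$, $q_{\rm lbd}=0.56394907949$, $q_{\rm ubd}=0.56394908030$. Then for every $\alpha\in(\alpha_{\rm lbd},\alpha_{\rm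 ubd})$ the map $q\mapsto P(R(q,\alpha))$ is well defined and differentiable on $(q_{\rm lbd},q_{\rm ubd})$, with $$\sup_{q\in(q_{\rm lbd},q_{\rm ubd})}\frac{d\,P(R(q,\alpha))}{dq}<1,$$ and there is a unique $q_\star=q_\star(\alpha)\in(q_{\rm lbd},q_{\rm ubd})$ with $q_\star=P(R(q_\star,\alpha))$. Writing $\psi_\star(\alpha)=R(q_\star(\alpha),\alpha)$, the function $\mathscr{G}_\star(\alpha)=\mathscr{G}(\alpha,q_\star(\alpha),\psi_\star(\alpha))$ is well defined (all the integrals converge) and strictly decreasing on $(\alpha_{\rm lbd},\alpha_{\rm ubd})$, and it has a unique root $\alpha_\star$ in $(\alpha_{\rm lbd},\alpha_{\rm ubd})$. -/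

import Mathlib

open Set MeasureTheory

noncomputable section

namespace IsingPerceptron

/-- The standard gaussian density `φ`. -/
def gaussDensity (x : ℝ) : ℝ := Real.exp (-x ^ 2 / 2) / √(2 * Real.pi)

/-- It is Mathlib's density of the gaussian law with mean `0` and variance `1`. -/
theorem gaussDensity_eq (x : ℝ) :
    gaussDensity x = ProbabilityTheory.gaussianPDFReal 0 1 x := by
  simp [gaussDensity, ProbabilityTheory.gaussianPDFReal, div_eq_inv_mul]

/-- The complementary gaussian distribution function. -/
def gaussTail (x : ℝ) : ℝ := ∫ u in Ioi x, gaussDensity u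

/-- The ratio `𝓔 = φ / gaussTail`. -/
def millsE (x : ℝ) : ℝ := gaussDensity x / gaussTail x

/-- The function `F_q`, for the margin `κ` and `q ∈ [0,1)`. -/
def funF (κ q x : ℝ) : ℝ := millsE ((κ - x) / √(1 - q)) / √(1 - q)

/-- `P(ψ) = ∫ tanh(ψ^{1/2} z)² φ(z) dz`, for `ψ ≥ 0`. -/
def recP (ψ : ℝ) : ℝ := ∫ z : ℝ, Real.tanh (√ψ * z) ^ 2 * gaussDensity z

/-- `R_κ(q,α) = α ∫ F_q(q^{1/2} z)² φ(z) dz`, for `q ∈ [0,1)`. -/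
def recR (κ q α : ℝ) : ℝ := α * ∫ z : ℝ, funF κ q (√q * z) ^ 2 * gaussDensity z

/-- The functional `𝓖_κ(α,q,ψ)`, for `q ∈ [0,1)` and `ψ ≥ 0`. -/
def funG (κ α q ψ : ℝ) : ℝ :=
  -(ψ * (1 - q)) / 2
    + (∫ z : ℝ, Real.log (2 * Real.cosh (√ψ * z)) * gaussDensity z)
    + α * ∫ z : ℝ, Real.log (gaussTail ((κ - √q * z) / √(1 - q))) * gaussDensity z

def alphaLbd : ℝ := 0.833078599

def alphaUbd : ℝ := 0.833078600

def qLbd : ℝ := 0.56394907949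

def qUbd : ℝ := 0.56394908030

end IsingPerceptron

end

open IsingPerceptron

/-!
At margin `0` the integrals are functions of two scalar parameters. With `g = √(q / (1 - q))` and
`s = √ψ`, put `p(s) = ∫ tanh(sz)² φ`, `a(g) = ∫ 𝓔(gz)² φ`, `K(s) = ∫ log(2 cosh(sz)) φ` and
`L(g) = ∫ log Φ̄(gz) φ`. Then `P(ψ) = p(√ψ)`, `R(q, α) = α a(g) / (1 - q)` and
`𝓖 = -ψ(1 - q)/2 + K(√ψ) + α L(g)`. Gaussian integration by parts gives `K' = s (1 - p)` and
`L' = -g a / (1 + g²)`, so that `∂𝓖/∂ψ = (q - P(ψ)) / 2` and `∂𝓖/∂q = (ψ - R(q, α)) / 2`: the fixed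
points of the recursion are the stationary points of `𝓖`.

The windows are tiny, so it is enough to know the four functions with about twelve digits at the end
points. For `q` and `α` in their windows, `g` lies in `[gLow, gHigh]` and `s = √(R(q, α))` in
`[sLow, sHigh]`, and `p` maps `[sLow, sHigh]` strictly inside the window of `q` (`avgTanhSq_mem`).
By the intermediate value theorem there is a fixed point. Difference quotients over the windows,
with crude Lipschitz bounds for `p'` and `a'`, determine these derivatives to two digits
(`deriv_mem_of_slope`); hence `0 ≤ d P(R(q, α)) / dq ≤ 0.8` (`composite'_mem`), which makes the
fixed point unique and Lipschitz in `α`. On the windows `𝓖` is almost stationary in `(q, ψ)`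
(`abs_funG_sub_le`), so its derivative along the curve of fixed points is `L(g) ≈ -1.087` up to
about `10⁻⁸` (`funG_fixedPoint_sub_mem`). Its value at the lower corner is `8·10⁻¹⁰`
(`funG_corner_mem`), which is less than `1.086` times the length `10⁻⁹` of the window of `α`: a sign
change, hence a root.

The digits come from the trapezoidal rule with step `1/16`. For a function holomorphic in the strip
`|Im w| ≤ 2/5` with a quadratic decay there, the error is of order `exp(-2π·16·2/5)`, by Poisson
summation and a shift of contour (`trapezoid_error_le`). The integrands of `K` and `L` are replaced
by logarithm-free ones (`avgLogCosh_eq`, `avgLogTail_eq`), and `1/Φ̄` is holomorphic in the strip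
because the Mills ratio has no zeros there (`cMills_ne_zero_and_norm_inv_le`). The finite sums
are evaluated by the kernel in interval arithmetic on natural numbers with denominator `2¹⁶⁰`
(namespace `FixedPoint`), the gaussian tail by its power series (`gaussTail_series`).
-/

open IsingPerceptron

/-! ### The trapezoidal rule for functions holomorphic in a strip -/

open Filter Topology in
theorem tendsto_inv_one_add_sq_atTop :
    Tendsto (fun T : ℝ => (1 + T ^ 2)⁻¹) atTop (𝓝 0) :=
  tendsto_inv_atTop_zero.comp
    (tendsto_atTop_add_const_left _ _ (tendsto_pow_atTop (by norm_num)))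

theorem continuous_horizontal {f : ℂ → ℂ} {b y : ℝ}
    (hf : ∀ w : ℂ, |w.im| ≤ b → DifferentiableAt ℂ f w) (hy : |y| ≤ b) :
    Continuous fun x : ℝ => f (x + y * Complex.I) := by
  refine continuous_iff_continuousAt.2 fun x => ?_
  have h1 : ContinuousAt f (x + y * Complex.I) := (hf _ (by simpa using hy)).continuousAt
  exact ContinuousAt.comp (f := fun x : ℝ => (x + y * Complex.I : ℂ)) h1 (by fun_prop)

theorem integrable_horizontal {f : ℂ → ℂ} {b C y : ℝ}
    (hf : ∀ w : ℂ, |w.im| ≤ b → DifferentiableAt ℂ f w)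
    (hC : ∀ w : ℂ, |w.im| ≤ b → ‖f w‖ ≤ C * (1 + w.re ^ 2)⁻¹) (hy : |y| ≤ b) :
    Integrable fun x : ℝ => f (x + y * Complex.I) := by
  refine (integrable_inv_one_add_sq.const_mul C).mono'
    (continuous_horizontal hf hy).aestronglyMeasurable (ae_of_all _ fun x => ?_)
  simpa using hC (x + y * Complex.I) (by simpa using hy)

open Filter Topology in
/-- The integral of a function holomorphic in a horizontal strip and decaying quadratically there
does not depend on the horizontal line. -/
theorem integral_horizontal_eq {f : ℂ → ℂ} {b C y : ℝ}
    (hf : ∀ w : ℂ, |w.im| ≤ b → DifferentiableAt ℂ f w)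
    (hC : ∀ w : ℂ, |w.im| ≤ b → ‖f w‖ ≤ C * (1 + w.re ^ 2)⁻¹) (hy : |y| ≤ b) :
    ∫ x : ℝ, f (x + y * Complex.I) = ∫ x : ℝ, f x := by
  have h0 : |(0 : ℝ)| ≤ b := by simpa using (abs_nonneg y).trans hy
  have hI0 : Integrable fun x : ℝ => f x := by
    simpa using integrable_horizontal hf hC h0
  have t0 := intervalIntegral_tendsto_integral hI0 tendsto_neg_atTop_atBot tendsto_id
  have ty := intervalIntegral_tendsto_integral (integrable_horizontal hf hC hy)
    tendsto_neg_atTop_atBot tendsto_id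
  have hmem : ∀ {t : ℝ}, t ∈ Set.uIcc 0 y → |t| ≤ b := fun {t} ht => by
    have := abs_sub_left_of_mem_uIcc ht
    simp only [sub_zero] at this
    exact this.trans hy
  have hv : ∀ T ε : ℝ, ε ^ 2 = 1 →
      ‖∫ t : ℝ in (0 : ℝ)..y, f ((ε * T : ℝ) + t * Complex.I)‖ ≤ C * (1 + T ^ 2)⁻¹ * |y| := by
    intro T ε hε
    have := intervalIntegral.norm_integral_le_of_norm_le_const (a := 0) (b := y)
      (f := fun t : ℝ => f ((ε * T : ℝ) + t * Complex.I)) (C := C * (1 + T ^ 2)⁻¹) (by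
        intro t ht
        have h := hC ((ε * T : ℝ) + t * Complex.I)
          (by simpa using hmem (uIoc_subset_uIcc ht))
        have h2 : ((ε * T : ℝ) + t * Complex.I : ℂ).re ^ 2 = T ^ 2 := by
          simp [mul_pow, hε]
        rwa [h2] at h)
    simpa using this
  have hlim : Tendsto (fun T : ℝ => C * (1 + T ^ 2)⁻¹ * |y|) atTop (𝓝 0) := by
    simpa using (tendsto_inv_one_add_sq_atTop.const_mul C).mul_const |y|
  have hvt : ∀ ε : ℝ, ε ^ 2 = 1 → Tendsto
      (fun T : ℝ => ∫ t : ℝ in (0 : ℝ)..y, f ((ε * T : ℝ) + t * Complex.I)) atTop (𝓝 0) :=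
    fun ε hε => squeeze_zero_norm (fun T => hv T ε hε) hlim
  have key : ∀ T : ℝ, (∫ x in -T..T, f (x + y * Complex.I)) = (∫ x in -T..T, f x)
      + Complex.I * (∫ t : ℝ in (0 : ℝ)..y, f ((1 * T : ℝ) + t * Complex.I))
      - Complex.I * ∫ t : ℝ in (0 : ℝ)..y, f (((-1) * T : ℝ) + t * Complex.I) := by
    intro T
    have := Complex.integral_boundary_rect_eq_zero_of_differentiableOn f (-T : ℂ)
      (T + y * Complex.I) (by
        intro w hw
        have hw2 : w.im ∈ Set.uIcc 0 y := by
          have := hw.2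
          simpa using this
        exact (hf w (hmem hw2)).differentiableWithinAt)
    simp only [Complex.neg_re, Complex.ofReal_re, Complex.add_re, Complex.mul_re, Complex.I_re,
      mul_zero, Complex.ofReal_im, Complex.I_im, mul_one, sub_self, add_zero, Complex.neg_im,
      neg_zero, Complex.ofReal_zero, zero_mul, Complex.add_im, Complex.mul_im, zero_add,
      smul_eq_mul, Complex.ofReal_neg] at this
    simp only [one_mul, neg_mul, Complex.ofReal_neg]
    linear_combination -this
  have h2 := (t0.add ((hvt 1 (by norm_num)).const_mul Complex.I)).sub
    ((hvt (-1) (by norm_num)).const_mul Complex.I)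
  simp only [mul_zero, add_zero, sub_zero] at h2
  refine tendsto_nhds_unique ty (h2.congr fun T => ?_)
  exact (key T).symm

/-- Fourier transforms of functions holomorphic in a strip of half-width `b` decay like
`exp (-2πb|k|)`. -/
theorem norm_fourier_le_of_strip {f : ℂ → ℂ} {b C : ℝ} (hb : 0 ≤ b)
    (hf : ∀ w : ℂ, |w.im| ≤ b → DifferentiableAt ℂ f w)
    (hC : ∀ w : ℂ, |w.im| ≤ b → ‖f w‖ ≤ C * (1 + w.re ^ 2)⁻¹) (k : ℝ) :
    ‖FourierTransform.fourier (fun x : ℝ => f x) k‖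
      ≤ C * Real.pi * Real.exp (-(2 * Real.pi * b * |k|)) := by
  -- the contour is moved to the side on which `exp (-2πikw)` is small
  obtain ⟨y, hy, hky⟩ : ∃ y : ℝ, |y| = b ∧ k * y = -(b * |k|) := by
    rcases le_total 0 k with hk | hk
    · exact ⟨-b, by rw [abs_neg, abs_of_nonneg hb], by rw [abs_of_nonneg hk]; ring⟩
    · exact ⟨b, abs_of_nonneg hb, by rw [abs_of_nonpos hk]; ring⟩
  set F : ℂ → ℂ := fun w => Complex.exp (-2 * Real.pi * w * k * Complex.I) * f w with hF
  have hnorm : ∀ w : ℂ, ‖F w‖ = Real.exp (2 * Real.pi * (k * w.im)) * ‖f w‖ := by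
    intro w
    rw [hF, norm_mul, Complex.norm_exp]
    congr 2
    simp [Complex.mul_re, Complex.mul_im]
    ring
  have hFd : ∀ w : ℂ, |w.im| ≤ b → DifferentiableAt ℂ F w := fun w hw =>
    DifferentiableAt.mul (by fun_prop) (hf w hw)
  have hFC : ∀ w : ℂ, |w.im| ≤ b →
      ‖F w‖ ≤ (Real.exp (2 * Real.pi * (|k| * b)) * C) * (1 + w.re ^ 2)⁻¹ := by
    intro w hw
    rw [hnorm, mul_assoc (Real.exp _)]
    refine mul_le_mul ?_ (hC w hw) (norm_nonneg _) (Real.exp_pos _).le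
    have : k * w.im ≤ |k| * b := (le_abs_self _).trans (by rw [abs_mul]; gcongr)
    gcongr
  have h1 := integral_horizontal_eq hFd hFC hy.le
  have h2 : FourierTransform.fourier (fun x : ℝ => f x) k = ∫ x : ℝ, F x := by
    rw [Real.fourier_real_eq_integral_exp_smul]
    refine integral_congr_ae (ae_of_all _ fun x => ?_)
    simp [hF]
  rw [h2, ← h1]
  refine (norm_integral_le_of_norm_le
    ((integrable_inv_one_add_sq.const_mul (C * Real.exp (-(2 * Real.pi * b * |k|)))))
    (ae_of_all _ fun x => ?_)).trans (le_of_eq ?_)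
  · rw [hnorm]
    have := hC (x + y * Complex.I) (by simpa using hy.le)
    simp only [Complex.add_im, Complex.ofReal_im, Complex.mul_im, Complex.ofReal_re,
      Complex.I_im, mul_one, Complex.I_re, mul_zero, add_zero, zero_add, Complex.add_re,
      Complex.mul_re, sub_self] at this ⊢
    rw [hky, show 2 * Real.pi * -(b * |k|) = -(2 * Real.pi * b * |k|) by ring, mul_comm C,
      mul_assoc (Real.exp _)]
    exact mul_le_mul_of_nonneg_left this (Real.exp_pos _).le
  · rw [integral_const_mul, integral_univ_inv_one_add_sq]
    ring

theorem hasSum_int_pow_natAbs {r : ℝ} (hr0 : 0 ≤ r) (hr : r < 1) :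
    HasSum (fun n : ℤ => r ^ n.natAbs) (1 + 2 * (r / (1 - r))) := by
  have h1 : HasSum (fun n : ℕ => r ^ (n + 1)) (r / (1 - r)) := by
    simpa [pow_succ', div_eq_mul_inv] using (hasSum_geometric_of_lt_one hr0 hr).mul_left r
  have h := HasSum.of_nat_of_neg_add_one (f := fun n : ℤ => r ^ n.natAbs) (m := (1 - r)⁻¹)
    (m' := r / (1 - r)) (by simpa using hasSum_geometric_of_lt_one hr0 hr) (by
      convert h1 using 2 with n
      congr 1)
  have h2 : 1 - r ≠ 0 := by linarith
  convert h using 1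
  field_simp
  ring

open Filter in
/-- By Poisson summation the error of the trapezoidal rule with step `1` is the sum of the Fourier
transform over the nonzero integers. -/
theorem abs_tsum_sub_integral_le_of_strip {f : ℂ → ℂ} {b C : ℝ} (hb : 0 < b)
    (hf : ∀ w : ℂ, |w.im| ≤ b → DifferentiableAt ℂ f w)
    (hC : ∀ w : ℂ, |w.im| ≤ b → ‖f w‖ ≤ C * (1 + w.re ^ 2)⁻¹) :
    ‖∑' n : ℤ, f n - ∫ x : ℝ, f x‖ ≤ C * Real.pi *
      (2 * (Real.exp (-(2 * Real.pi * b)) / (1 - Real.exp (-(2 * Real.pi * b))))) := by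
  set r := Real.exp (-(2 * Real.pi * b)) with hr
  have hr1 : r < 1 := by
    rw [hr, Real.exp_lt_one_iff]
    have := Real.pi_pos
    have : 0 < 2 * Real.pi * b := by positivity
    linarith
  have hr0 : 0 ≤ r := (Real.exp_pos _).le
  have hCpos : 0 ≤ C := by
    have := (norm_nonneg _).trans (hC 0 (by simpa using hb.le))
    simpa using this
  have hbd : ∀ n : ℤ, ‖FourierTransform.fourier (fun x : ℝ => f x) (n : ℝ)‖
      ≤ C * Real.pi * r ^ n.natAbs := by
    intro n
    refine (norm_fourier_le_of_strip hb.le hf hC n).trans (le_of_eq ?_)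
    rw [hr, ← Real.exp_nat_mul]
    congr 2
    rw [Nat.cast_natAbs, Int.cast_abs]
    ring
  have hsum := (hasSum_int_pow_natAbs hr0 hr1).mul_left (C * Real.pi)
  have hcont : Continuous fun x : ℝ => f x := by
    simpa using continuous_horizontal (y := 0) hf (by simpa using hb.le)
  have hO : Asymptotics.IsBigO (cocompact ℝ) (fun x : ℝ => f x) fun x : ℝ => |x| ^ (-2 : ℝ) := by
    refine Asymptotics.IsBigO.of_bound C ?_
    have : ∀ᶠ x : ℝ in cocompact ℝ, x ≠ 0 := by
      have := (Set.finite_singleton (0 : ℝ)).isCompact.compl_mem_cocompact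
      filter_upwards [this] with x hx using hx
    filter_upwards [this] with x hx
    refine (hC x (by simpa using hb.le)).trans ?_
    rw [Real.rpow_neg (abs_nonneg x)]
    simp only [Complex.ofReal_re, Real.rpow_ofNat, sq_abs, norm_inv, norm_pow, Real.norm_eq_abs]
    have : 0 < x ^ 2 := by positivity
    gcongr
    linarith
  have hS : Summable fun n : ℤ => FourierTransform.fourier (fun x : ℝ => f x) (n : ℝ) :=
    Summable.of_norm_bounded hsum.summable hbd
  have hP := Real.tsum_eq_tsum_fourier_of_rpow_decay_of_summable hcont one_lt_two hO hS 0
  simp only [zero_add, QuotientAddGroup.mk_zero, fourier_eval_zero, mul_one] at hP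
  have h0 : FourierTransform.fourier (fun x : ℝ => f x) ((0 : ℤ) : ℝ) = ∫ x : ℝ, f x := by
    rw [Real.fourier_real_eq_integral_exp_smul]
    simp
  have hsplit := hS.tsum_eq_add_tsum_ite 0
  rw [h0] at hsplit
  have e1 : ∑' n : ℤ, f n - ∫ x : ℝ, f x = ∑' n : ℤ, if n = 0 then 0 else
      FourierTransform.fourier (fun x : ℝ => f x) (n : ℝ) := by
    have : ∑' n : ℤ, f n = ∑' n : ℤ, f ((n : ℝ) : ℂ) := by simp
    rw [this, hP, hsplit]
    ring
  rw [e1]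
  have hsum' : HasSum (fun n : ℤ => if n = 0 then 0 else C * Real.pi * r ^ n.natAbs)
      (C * Real.pi * (2 * (r / (1 - r)))) := by
    have := hsum.update 0 0
    have e2 : (fun n : ℤ => if n = 0 then 0 else C * Real.pi * r ^ n.natAbs)
        = Function.update (fun n : ℤ => C * Real.pi * r ^ n.natAbs) 0 0 := by
      ext n
      rw [Function.update_apply]
    rw [e2, show C * Real.pi * (2 * (r / (1 - r))) = 0 - C * Real.pi * r ^ Int.natAbs 0
      + C * Real.pi * (1 + 2 * (r / (1 - r))) by rw [Int.natAbs_zero, pow_zero]; ring]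
    exact this
  refine tsum_of_norm_bounded hsum' fun n => ?_
  split_ifs
  · simp
  · exact hbd n

/-- The trapezoidal rule with step `h` for a function holomorphic in a strip of half-width `a`
is exact up to `O(exp (-2πa/h))`. -/
theorem trapezoid_error_le {f : ℂ → ℂ} {a h C : ℝ} (ha : 0 < a) (hh : 0 < h) (hh1 : h ≤ 1)
    (hf : ∀ w : ℂ, |w.im| ≤ a → DifferentiableAt ℂ f w)
    (hC : ∀ w : ℂ, |w.im| ≤ a → ‖f w‖ ≤ C * (1 + w.re ^ 2)⁻¹) :
    ‖h * ∑' n : ℤ, f (h * n) - ∫ x : ℝ, f x‖ ≤ C / h * Real.pi *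
      (2 * (Real.exp (-(2 * Real.pi * (a / h))) / (1 - Real.exp (-(2 * Real.pi * (a / h)))))) := by
  have hC0 : 0 ≤ C := by
    have := (norm_nonneg _).trans (hC 0 (by simpa using ha.le))
    simpa using this
  have him : ∀ w : ℂ, |w.im| ≤ a / h → |((h : ℂ) * w).im| ≤ a := by
    intro w hw
    simp only [Complex.mul_im, Complex.ofReal_re, Complex.ofReal_im, zero_mul, add_zero, abs_mul,
      abs_of_pos hh]
    rwa [le_div_iff₀' hh] at hw
  have key := abs_tsum_sub_integral_le_of_strip (f := fun w => f (h * w)) (b := a / h)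
    (C := C / h ^ 2) (by positivity)
    (fun w hw => DifferentiableAt.comp w (hf _ (him w hw)) (by fun_prop))
    (fun w hw => by
      refine (hC _ (him w hw)).trans ?_
      simp only [Complex.mul_re, Complex.ofReal_re, Complex.ofReal_im, zero_mul, sub_zero]
      rw [div_eq_mul_inv, mul_assoc, ← mul_inv]
      have : h ^ 2 ≤ 1 := by nlinarith
      gcongr
      nlinarith)
  have hint : ∫ x : ℝ, f x = h * ∫ x : ℝ, f (h * x) := by
    have := Measure.integral_comp_mul_left (fun x : ℝ => f x) h
    simp only [Complex.ofReal_mul] at this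
    rw [this, abs_of_pos (inv_pos.2 hh), Complex.real_smul, ← mul_assoc]
    push_cast
    rw [mul_inv_cancel₀ (by exact_mod_cast hh.ne'), one_mul]
  rw [hint, ← mul_sub, norm_mul, Complex.norm_real, Real.norm_of_nonneg hh.le]
  refine (mul_le_mul_of_nonneg_left key hh.le).trans (le_of_eq ?_)
  field_simp

/-! ### The gaussian density -/

theorem gaussDensity_pos (x : ℝ) : 0 < gaussDensity x := by
  unfold gaussDensity
  positivity

theorem gaussDensity_neg (x : ℝ) : gaussDensity (-x) = gaussDensity x := by
  simp [gaussDensity]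

theorem hasDerivAt_gaussDensity (x : ℝ) : HasDerivAt gaussDensity (-x * gaussDensity x) x := by
  have h : HasDerivAt (fun x : ℝ => -x ^ 2 / 2) (-x) x := by
    refine ((hasDerivAt_pow 2 x).neg.div_const 2).congr_deriv ?_
    push_cast
    ring
  refine (h.exp.div_const (√(2 * Real.pi))).congr_deriv ?_
  unfold gaussDensity
  ring

theorem continuous_gaussDensity : Continuous gaussDensity :=
  continuous_iff_continuousAt.2 fun x => (hasDerivAt_gaussDensity x).continuousAt

theorem integrable_gaussDensity : Integrable gaussDensity := by
  have : gaussDensity = ProbabilityTheory.gaussianPDFReal 0 1 := funext gaussDensity_eq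
  rw [this]
  exact ProbabilityTheory.integrable_gaussianPDFReal 0 1

theorem integral_gaussDensity : ∫ x, gaussDensity x = 1 := by
  have : gaussDensity = ProbabilityTheory.gaussianPDFReal 0 1 := funext gaussDensity_eq
  rw [this]
  exact ProbabilityTheory.integral_gaussianPDFReal_eq_one 0 one_ne_zero

open Filter Topology in
theorem tendsto_gaussDensity_atTop : Tendsto gaussDensity atTop (𝓝 0) := by
  have h : Tendsto (fun x : ℝ => x ^ 2 / 2) atTop atTop :=
    (tendsto_pow_atTop (by norm_num)).atTop_div_const (by norm_num)
  have := ((Real.tendsto_exp_neg_atTop_nhds_zero.comp h).div_const (√(2 * Real.pi)))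
  rw [zero_div] at this
  refine this.congr fun x => ?_
  simp [gaussDensity, neg_div]

theorem gaussDensity_le_half (x : ℝ) : gaussDensity x ≤ 1 / 2 := by
  unfold gaussDensity
  have h1 : Real.exp (-x ^ 2 / 2) ≤ 1 := Real.exp_le_one_iff.2 (by nlinarith [sq_nonneg x])
  have h2 : 2 ≤ √(2 * Real.pi) := Real.le_sqrt_of_sq_le (by nlinarith [Real.pi_gt_three])
  rw [div_le_div_iff₀ (by positivity) (by norm_num)]
  linarith

/-! ### The gaussian tail and the inverse Mills ratio -/

theorem gaussTail_eq_sub (x : ℝ) :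
    gaussTail x = gaussTail 0 - ∫ u in (0 : ℝ)..x, gaussDensity u := by
  have := intervalIntegral.integral_Ioi_sub_Ioi' (f := gaussDensity) (a := 0) (b := x)
    (μ := volume) integrable_gaussDensity.integrableOn integrable_gaussDensity.integrableOn
  unfold gaussTail
  linarith

theorem hasDerivAt_gaussTail (x : ℝ) : HasDerivAt gaussTail (-gaussDensity x) x := by
  have h : HasDerivAt (fun x => ∫ u in (0 : ℝ)..x, gaussDensity u) (gaussDensity x) x :=
    intervalIntegral.integral_hasDerivAt_right
      (continuous_gaussDensity.intervalIntegrable _ _)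
      (continuous_gaussDensity.stronglyMeasurableAtFilter _ _)
      continuous_gaussDensity.continuousAt
  rw [show gaussTail = fun x => gaussTail 0 - ∫ u in (0 : ℝ)..x, gaussDensity u from
    funext gaussTail_eq_sub]
  exact h.const_sub _

theorem continuous_gaussTail : Continuous gaussTail :=
  continuous_iff_continuousAt.2 fun x => (hasDerivAt_gaussTail x).continuousAt

theorem gaussTail_pos (x : ℝ) : 0 < gaussTail x := by
  unfold gaussTail
  rw [setIntegral_pos_iff_support_of_nonneg_ae (ae_of_all _ fun u => (gaussDensity_pos u).le)
    integrable_gaussDensity.integrableOn]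
  have : Function.support gaussDensity = univ := by
    ext u
    simp [(gaussDensity_pos u).ne']
  simp [this]

theorem gaussTail_neg (x : ℝ) : gaussTail (-x) = 1 - gaussTail x := by
  have h1 : gaussTail (-x) = ∫ u in Iic x, gaussDensity u := by
    unfold gaussTail
    rw [← integral_comp_neg_Iic]
    simp [gaussDensity_neg]
  have h2 := intervalIntegral.integral_Iic_add_Ioi (f := gaussDensity) (b := x) (μ := volume)
    integrable_gaussDensity.integrableOn integrable_gaussDensity.integrableOn
  rw [integral_gaussDensity] at h2
  rw [h1]
  unfold gaussTail
  linarith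

theorem gaussTail_zero : gaussTail 0 = 1 / 2 := by
  have := gaussTail_neg 0
  rw [neg_zero] at this
  linarith

theorem gaussTail_lt_one (x : ℝ) : gaussTail x < 1 := by
  have := gaussTail_pos (-x)
  rw [gaussTail_neg] at this
  linarith

theorem antitone_gaussTail : Antitone gaussTail :=
  antitone_of_hasDerivAt_nonpos (fun x => hasDerivAt_gaussTail x)
    fun x => by simpa using (gaussDensity_pos x).le

theorem gaussTail_le_half {x : ℝ} (hx : 0 ≤ x) : gaussTail x ≤ 1 / 2 :=
  gaussTail_zero ▸ antitone_gaussTail hx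

theorem half_le_gaussTail {x : ℝ} (hx : x ≤ 0) : 1 / 2 ≤ gaussTail x :=
  gaussTail_zero ▸ antitone_gaussTail hx

open Filter Topology in
theorem tendsto_gaussTail_atTop : Tendsto gaussTail atTop (𝓝 0) := by
  have h := intervalIntegral_tendsto_integral_Ioi (μ := volume) (f := gaussDensity) 0
    integrable_gaussDensity.integrableOn tendsto_id
  have h2 := h.const_sub (gaussTail 0)
  rw [show gaussTail 0 - ∫ x in Ioi 0, gaussDensity x = 0 from sub_self _] at h2
  refine h2.congr fun x => (gaussTail_eq_sub x).symm

open Filter Topology in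
theorem nonneg_of_deriv_nonpos_of_tendsto_zero {f f' : ℝ → ℝ} {a : ℝ}
    (hf : ∀ x ∈ Ioi a, HasDerivAt f (f' x) x) (hf' : ∀ x ∈ Ioi a, f' x ≤ 0)
    (hlim : Tendsto f atTop (𝓝 0)) {x : ℝ} (hx : a < x) : 0 ≤ f x := by
  have hanti : AntitoneOn f (Ioi a) := by
    refine antitoneOn_of_deriv_nonpos (convex_Ioi a)
      (fun y hy => (hf y hy).continuousAt.continuousWithinAt)
      (fun y hy => ?_) (fun y hy => ?_)
    · rw [interior_Ioi] at hy
      exact (hf y hy).differentiableAt.differentiableWithinAt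
    · rw [interior_Ioi] at hy
      rw [(hf y hy).deriv]
      exact hf' y hy
  refine le_of_tendsto hlim ?_
  filter_upwards [eventually_ge_atTop x] with y hy
  exact hanti hx (lt_of_lt_of_le hx hy : a < y) hy

open Filter Topology in
theorem mul_gaussTail_le (x : ℝ) : x * gaussTail x ≤ gaussDensity x := by
  rcases le_or_gt x 0 with hx | hx
  · exact (mul_nonpos_of_nonpos_of_nonneg hx (gaussTail_pos x).le).trans (gaussDensity_pos x).le
  · have h := nonneg_of_deriv_nonpos_of_tendsto_zero (a := 0)
      (f := fun y => gaussDensity y * y⁻¹ - gaussTail y)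
      (f' := fun y => -gaussDensity y * (y⁻¹) ^ 2)
      (fun y hy => by
        have hy0 : y ≠ 0 := ne_of_gt hy
        refine (((hasDerivAt_gaussDensity y).mul (hasDerivAt_inv hy0)).sub
          (hasDerivAt_gaussTail y)).congr_deriv ?_
        field_simp
        ring)
      (fun y hy => by
        have := gaussDensity_pos y
        have : 0 ≤ gaussDensity y * (y⁻¹) ^ 2 := by positivity
        linarith)
      (by simpa using (tendsto_gaussDensity_atTop.mul tendsto_inv_atTop_zero).sub
            tendsto_gaussTail_atTop) hx
    have h2 : gaussTail x ≤ gaussDensity x / x := by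
      rw [div_eq_mul_inv]
      linarith
    rw [le_div_iff₀ hx] at h2
    linarith

open Filter Topology in
/-- The difference `Φ̄(x) - φ(x) / (1 + x)` has derivative `-φ(x) x / (1 + x)²` and tends to `0`. -/
theorem gaussDensity_le_mul_gaussTail {x : ℝ} (hx : 0 ≤ x) :
    gaussDensity x ≤ (1 + x) * gaussTail x := by
  rcases hx.eq_or_lt with rfl | hx
  · rw [gaussTail_zero]
    linarith [gaussDensity_le_half 0]
  have h := nonneg_of_deriv_nonpos_of_tendsto_zero (a := 0)
    (f := fun y => gaussTail y - gaussDensity y * (1 + y)⁻¹)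
    (f' := fun y => -gaussDensity y * (y * ((1 + y)⁻¹) ^ 2))
    (fun y hy => by
      have hy0 : 1 + y ≠ 0 := by
        have : 0 < y := hy
        linarith
      have h1 : HasDerivAt (fun y : ℝ => (1 + y)⁻¹) (-1 / (1 + y) ^ 2) y :=
        ((hasDerivAt_id y).const_add 1).inv hy0
      refine ((hasDerivAt_gaussTail y).sub ((hasDerivAt_gaussDensity y).mul h1)).congr_deriv ?_
      field_simp
      ring)
    (fun y hy => by
      have h1 := gaussDensity_pos y
      have h2 : 0 < y := hy
      have : 0 ≤ gaussDensity y * (y * ((1 + y)⁻¹) ^ 2) := by positivity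
      linarith)
    (by simpa using tendsto_gaussTail_atTop.sub (tendsto_gaussDensity_atTop.mul
        (tendsto_inv_atTop_zero.comp (tendsto_atTop_add_const_left _ 1 tendsto_id)))) hx
  have h2 : gaussDensity x / (1 + x) ≤ gaussTail x := by
    rw [div_eq_mul_inv]
    linarith
  rwa [div_le_iff₀' (by linarith)] at h2

theorem millsE_pos (x : ℝ) : 0 < millsE x := div_pos (gaussDensity_pos x) (gaussTail_pos x)

theorem millsE_mul_gaussTail (x : ℝ) : millsE x * gaussTail x = gaussDensity x :=
  div_mul_cancel₀ _ (gaussTail_pos x).ne'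

theorem le_millsE (x : ℝ) : x ≤ millsE x := by
  unfold millsE
  rw [le_div_iff₀ (gaussTail_pos x)]
  exact mul_gaussTail_le x

theorem millsE_le (x : ℝ) : millsE x ≤ 1 + |x| := by
  unfold millsE
  rw [div_le_iff₀ (gaussTail_pos x)]
  rcases le_total 0 x with hx | hx
  · rw [abs_of_nonneg hx]
    exact gaussDensity_le_mul_gaussTail hx
  · have h1 := half_le_gaussTail hx
    have h2 := gaussDensity_le_half x
    nlinarith [abs_nonneg x]

theorem hasDerivAt_millsE (x : ℝ) : HasDerivAt millsE (millsE x * (millsE x - x)) x := by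
  have h := (hasDerivAt_gaussDensity x).div (hasDerivAt_gaussTail x) (gaussTail_pos x).ne'
  refine h.congr_deriv ?_
  unfold millsE
  have := (gaussTail_pos x).ne'
  field_simp
  ring

theorem continuous_millsE : Continuous millsE :=
  continuous_iff_continuousAt.2 fun x => (hasDerivAt_millsE x).continuousAt

theorem hasDerivAt_log_gaussTail (x : ℝ) :
    HasDerivAt (fun y => Real.log (gaussTail y)) (-millsE x) x := by
  refine ((hasDerivAt_gaussTail x).log (gaussTail_pos x).ne').congr_deriv ?_
  unfold millsE
  ring

theorem abs_log_gaussTail_le (x : ℝ) : |Real.log (gaussTail x)| ≤ 1 + |x| + x ^ 2 := by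
  rw [abs_of_nonpos (Real.log_nonpos (gaussTail_pos x).le (gaussTail_lt_one x).le)]
  rcases le_total x 0 with hx | hx
  · have h1 : Real.log (1 / 2) ≤ Real.log (gaussTail x) :=
      Real.log_le_log (by norm_num) (half_le_gaussTail hx)
    rw [one_div, Real.log_inv] at h1
    have := Real.log_two_lt_d9
    nlinarith [abs_nonneg x, sq_nonneg x]
  · have h1 : gaussDensity x / (1 + x) ≤ gaussTail x := by
      rw [div_le_iff₀' (by linarith)]
      exact gaussDensity_le_mul_gaussTail hx
    have h2 := Real.log_le_log (div_pos (gaussDensity_pos x) (by linarith)) h1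
    rw [Real.log_div (gaussDensity_pos x).ne' (by linarith)] at h2
    have h3 : Real.log (gaussDensity x) = -x ^ 2 / 2 - Real.log (√(2 * Real.pi)) := by
      unfold gaussDensity
      rw [Real.log_div (Real.exp_pos _).ne' (by positivity), Real.log_exp]
    have h4 : Real.log (√(2 * Real.pi)) ≤ 1 := by
      rw [Real.log_le_iff_le_exp (by positivity)]
      refine Real.sqrt_le_iff.2 ⟨(Real.exp_pos 1).le, ?_⟩
      nlinarith [Real.exp_one_gt_d9, Real.pi_lt_d2]
    have h5 : Real.log (1 + x) ≤ x := by
      have := Real.log_le_sub_one_of_pos (show 0 < 1 + x by linarith)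
      linarith
    rw [abs_of_nonneg hx]
    nlinarith [sq_nonneg x]

/-! ### The Mills ratio in the complex plane -/

/-- The Mills ratio `∫_0^∞ exp (-t²/2 - t w) dt` of a complex argument, an entire function. -/
noncomputable def cMills (w : ℂ) : ℂ := ∫ t in Ioi (0 : ℝ), Complex.exp (-(t : ℂ) ^ 2 / 2 - t * w)

/-- The gaussian density at a complex argument. -/
noncomputable def cGauss (w : ℂ) : ℂ := Complex.exp (-w ^ 2 / 2) / √(2 * Real.pi)

/-- The entire continuation of the gaussian tail. -/
noncomputable def cTail (w : ℂ) : ℂ := cGauss w * cMills w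

theorem integrable_exp_quadratic (c : ℝ) :
    Integrable fun t : ℝ => Real.exp (-t ^ 2 / 2 + c * t) := by
  have h := (integrable_cexp_quadratic (b := 1 / 2) (by norm_num) (c : ℂ) 0).norm
  refine h.congr (ae_of_all _ fun t => ?_)
  simp only [Complex.norm_exp]
  congr 1
  have : (-(1 / 2 : ℂ) * (t : ℂ) ^ 2 + c * t + 0) = ((-t ^ 2 / 2 + c * t : ℝ) : ℂ) := by
    push_cast
    ring
  rw [this, Complex.ofReal_re]

theorem cMills_exponent_eq (w : ℂ) (t : ℝ) : -(t : ℂ) ^ 2 / 2 - t * w =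
    ((-t ^ 2 / 2 + -w.re * t : ℝ) : ℂ) + ((-(t * w.im) : ℝ) : ℂ) * Complex.I := by
  nth_rw 1 [← Complex.re_add_im w]
  push_cast
  ring

theorem norm_cMills_integrand (w : ℂ) (t : ℝ) :
    ‖Complex.exp (-(t : ℂ) ^ 2 / 2 - t * w)‖ = Real.exp (-t ^ 2 / 2 + -w.re * t) := by
  rw [cMills_exponent_eq, Complex.exp_add, norm_mul, Complex.norm_exp_ofReal_mul_I, mul_one,
    Complex.norm_exp_ofReal]

theorem integrable_cMills_integrand (w : ℂ) :
    Integrable fun t : ℝ => Complex.exp (-(t : ℂ) ^ 2 / 2 - t * w) :=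
  (integrable_exp_quadratic (-w.re)).mono' (by fun_prop)
    (ae_of_all _ fun t => (norm_cMills_integrand w t).le)

theorem differentiable_cMills : Differentiable ℂ cMills := by
  intro w
  have h := hasDerivAt_integral_of_dominated_loc_of_deriv_le (μ := volume.restrict (Ioi (0 : ℝ)))
    (F := fun (w : ℂ) (t : ℝ) => Complex.exp (-(t : ℂ) ^ 2 / 2 - t * w))
    (F' := fun (w : ℂ) (t : ℝ) => -t * Complex.exp (-(t : ℂ) ^ 2 / 2 - t * w))
    (x₀ := w) (s := Metric.ball w 1)
    (bound := fun t => Real.exp (-t ^ 2 / 2 + (‖w‖ + 2) * t))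
    (Metric.ball_mem_nhds w one_pos)
    (Filter.Eventually.of_forall fun w => (integrable_cMills_integrand w).1.restrict)
    (integrable_cMills_integrand w).integrableOn
    (by fun_prop)
    (by
      refine (ae_restrict_iff' measurableSet_Ioi).2 (ae_of_all _ fun t ht v hv => ?_)
      have ht0 : 0 < t := ht
      rw [norm_mul, norm_cMills_integrand, norm_neg, Complex.norm_real, Real.norm_of_nonneg ht0.le,
        show -t ^ 2 / 2 + (‖w‖ + 2) * t = t + (-t ^ 2 / 2 + (‖w‖ + 1) * t) by ring,
        Real.exp_add t]
      have h1 : t ≤ Real.exp t := by linarith [Real.add_one_le_exp t]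
      have h2 : -v.re ≤ ‖w‖ + 1 := by
        have h3 := Complex.abs_re_le_norm v
        have h4 : ‖v‖ ≤ ‖w‖ + 1 := by
          have := norm_sub_norm_le v w
          rw [Metric.mem_ball, dist_eq_norm] at hv
          linarith
        linarith [neg_abs_le v.re]
      gcongr)
    (integrable_exp_quadratic (‖w‖ + 2)).integrableOn
    (ae_of_all _ fun t v _ => by
      have h1 : HasDerivAt (fun v : ℂ => (t : ℂ) * v) t v := by
        simpa using (hasDerivAt_id v).const_mul (t : ℂ)
      refine (h1.const_sub (-(t : ℂ) ^ 2 / 2)).cexp.congr_deriv ?_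
      ring)
  exact h.2.differentiableAt

theorem differentiable_cGauss : Differentiable ℂ cGauss := by
  unfold cGauss
  fun_prop

theorem differentiable_cTail : Differentiable ℂ cTail :=
  differentiable_cGauss.mul differentiable_cMills

theorem cGauss_ofReal (x : ℝ) : cGauss x = gaussDensity x := by
  unfold cGauss gaussDensity
  push_cast
  rfl

theorem gaussDensity_add (x t : ℝ) :
    gaussDensity (t + x) = gaussDensity x * Real.exp (-t ^ 2 / 2 + -x * t) := by
  unfold gaussDensity
  rw [div_mul_eq_mul_div, ← Real.exp_add]
  congr 2
  ring

theorem gaussDensity_mul_integral (x : ℝ) :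
    gaussDensity x * ∫ t in Ioi (0 : ℝ), Real.exp (-t ^ 2 / 2 + -x * t) = gaussTail x := by
  unfold gaussTail
  rw [← integral_const_mul]
  simp_rw [← gaussDensity_add]
  have := (measurePreserving_add_right volume x).setIntegral_preimage_emb
    (measurableEmbedding_addRight x) gaussDensity (Ioi x)
  rwa [preimage_add_const_Ioi, sub_self] at this

theorem integral_exp_quadratic_Ioi (x : ℝ) :
    ∫ t in Ioi (0 : ℝ), Real.exp (-t ^ 2 / 2 + -x * t) = (millsE x)⁻¹ := by
  rw [millsE, inv_div, eq_div_iff (gaussDensity_pos x).ne', mul_comm, gaussDensity_mul_integral]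

theorem cMills_ofReal (x : ℝ) : cMills x = (millsE x)⁻¹ := by
  rw [← integral_exp_quadratic_Ioi, cMills, ← integral_complex_ofReal]
  refine integral_congr_ae (ae_of_all _ fun t => ?_)
  push_cast
  congr 1
  ring

theorem norm_cMills_le (w : ℂ) : ‖cMills w‖ ≤ (millsE w.re)⁻¹ := by
  rw [← integral_exp_quadratic_Ioi]
  exact norm_integral_le_of_norm_le (integrable_exp_quadratic _).integrableOn
    (ae_of_all _ fun t => (norm_cMills_integrand w t).le)

theorem cTail_ofReal (x : ℝ) : cTail x = gaussTail x := by
  rw [cTail, cGauss_ofReal, cMills_ofReal, ← millsE_mul_gaussTail x]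
  have : (millsE x : ℂ) ≠ 0 := by exact_mod_cast (millsE_pos x).ne'
  push_cast
  field_simp

theorem norm_cGauss (w : ℂ) : ‖cGauss w‖ = Real.exp (w.im ^ 2 / 2) * gaussDensity w.re := by
  rw [cGauss, norm_div, Complex.norm_exp, Complex.norm_real, Real.norm_of_nonneg (by positivity),
    gaussDensity, ← mul_div_assoc, ← Real.exp_add]
  congr 2
  have : (-w ^ 2 / 2).re = (-w ^ 2).re / 2 := by
    rw [show (-w ^ 2 / 2) = (-w ^ 2) / ((2 : ℝ) : ℂ) by norm_num, Complex.div_ofReal_re]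
  rw [this]
  simp [pow_two]
  ring

theorem norm_cTail_le (w : ℂ) : ‖cTail w‖ ≤ Real.exp (w.im ^ 2 / 2) * gaussTail w.re := by
  rw [cTail, norm_mul, norm_cGauss, mul_assoc]
  have h : gaussTail w.re = gaussDensity w.re * (millsE w.re)⁻¹ := by
    rw [← millsE_mul_gaussTail w.re]
    have := (millsE_pos w.re).ne'
    field_simp
  rw [h]
  have := gaussDensity_pos w.re
  gcongr
  exact norm_cMills_le w

theorem cTail_add_cTail_neg (w : ℂ) : cTail w + cTail (-w) = 1 := by
  have h1 : cMills w + cMills (-w) = ∫ t : ℝ, Complex.exp (-(t : ℂ) ^ 2 / 2 - t * w) := by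
    have hI := integrable_cMills_integrand w
    rw [← intervalIntegral.integral_Iic_add_Ioi (b := 0) hI.integrableOn hI.integrableOn,
      add_comm]
    congr 1
    rw [cMills, ← neg_zero, ← integral_comp_neg_Iic, neg_zero]
    refine integral_congr_ae (ae_of_all _ fun t => ?_)
    push_cast
    congr 1
    ring
  have h2 := integral_cexp_quadratic (b := -1 / 2) (by norm_num) (-w) 0
  have h3 : ((Real.pi : ℂ) / -(-1 / 2)) ^ (1 / 2 : ℂ) = (√(2 * Real.pi) : ℝ) := by
    rw [Real.sqrt_eq_rpow, Complex.ofReal_cpow (by positivity)]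
    push_cast
    congr 1
    ring
  have h4 : cGauss (-w) = cGauss w := by simp [cGauss]
  rw [cTail, cTail, h4, ← mul_add, h1]
  have h5 : ∫ t : ℝ, Complex.exp (-(t : ℂ) ^ 2 / 2 - t * w)
      = (√(2 * Real.pi) : ℝ) * Complex.exp (w ^ 2 / 2) := by
    rw [← h3]
    convert h2 using 4
    · ring
    · ring
  have h6 : ((√(2 * Real.pi) : ℝ) : ℂ) ≠ 0 := by
    have : 0 < √(2 * Real.pi) := by positivity
    exact_mod_cast this.ne'
  rw [h5, cGauss, div_mul_eq_mul_div, div_eq_one_iff_eq h6, mul_left_comm, ← Complex.exp_add]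
  ring_nf
  simp

open Filter Topology in
/-- For `x ≥ 0`, `∫_0^∞ t² exp (-t²/2 - xt) dt ≤ ∫_0^∞ exp (-t²/2 - xt) dt`: the difference is
`-x ∫_0^∞ t exp (-t²/2 - xt) dt`. -/
theorem integral_sq_mul_exp_quadratic_le {x : ℝ} (hx : 0 ≤ x) :
    IntegrableOn (fun t : ℝ => t ^ 2 * Real.exp (-t ^ 2 / 2 + -x * t)) (Ioi 0) ∧
    ∫ t in Ioi (0 : ℝ), t ^ 2 * Real.exp (-t ^ 2 / 2 + -x * t)
      ≤ ∫ t in Ioi (0 : ℝ), Real.exp (-t ^ 2 / 2 + -x * t) := by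
  have hE : ∀ t : ℝ, HasDerivAt (fun t : ℝ => Real.exp (-t ^ 2 / 2 + -x * t))
      (Real.exp (-t ^ 2 / 2 + -x * t) * (-t + -x)) t := by
    intro t
    refine HasDerivAt.exp (HasDerivAt.add ?_ ?_)
    · refine ((hasDerivAt_pow 2 t).neg.div_const 2).congr_deriv ?_
      push_cast
      ring
    · exact ((hasDerivAt_id t).const_mul (-x)).congr_deriv (mul_one _)
  have hI1 : Integrable (fun t : ℝ => Real.exp (-t ^ 2 / 2 + -x * t)) :=
    integrable_exp_quadratic (-x)
  have hI2 : IntegrableOn (fun t : ℝ => t ^ 2 * Real.exp (-t ^ 2 / 2 + -x * t)) (Ioi 0) := by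
    refine ((integrable_exp_quadratic (2 - x)).integrableOn).mono' (by fun_prop)
      ((ae_restrict_iff' measurableSet_Ioi).2 (ae_of_all _ fun t ht => ?_))
    have ht0 : 0 < t := ht
    rw [norm_mul, Real.norm_of_nonneg (Real.exp_pos _).le, Real.norm_of_nonneg (by positivity),
      show -t ^ 2 / 2 + (2 - x) * t = 2 * t + (-t ^ 2 / 2 + -x * t) by ring, Real.exp_add (2 * t)]
    gcongr
    have := Real.quadratic_le_exp_of_nonneg (show 0 ≤ 2 * t by linarith)
    nlinarith
  have hI3 : IntegrableOn (fun t : ℝ => t * Real.exp (-t ^ 2 / 2 + -x * t)) (Ioi 0) := by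
    refine ((integrable_exp_quadratic (1 - x)).integrableOn).mono' (by fun_prop)
      ((ae_restrict_iff' measurableSet_Ioi).2 (ae_of_all _ fun t ht => ?_))
    have ht0 : 0 < t := ht
    rw [norm_mul, Real.norm_of_nonneg (Real.exp_pos _).le, Real.norm_of_nonneg (by positivity),
      show -t ^ 2 / 2 + (1 - x) * t = t + (-t ^ 2 / 2 + -x * t) by ring, Real.exp_add t]
    gcongr
    linarith [Real.add_one_le_exp t]
  refine ⟨hI2, ?_⟩
  have hlim : Tendsto (fun t : ℝ => t * Real.exp (-t ^ 2 / 2 + -x * t)) atTop (𝓝 0) := by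
    have hb := Real.tendsto_pow_mul_exp_neg_atTop_nhds_zero 1
    refine squeeze_zero' ?_ ?_ hb
    · filter_upwards [eventually_ge_atTop 0] with t ht
      positivity
    · filter_upwards [eventually_ge_atTop 2] with t ht
      have ht0 : 0 ≤ t := by linarith
      rw [pow_one]
      gcongr
      nlinarith [mul_nonneg hx ht0]
  have h := integral_Ioi_of_hasDerivAt_of_tendsto' (a := 0)
    (f := fun t : ℝ => t * Real.exp (-t ^ 2 / 2 + -x * t))
    (f' := fun t : ℝ => Real.exp (-t ^ 2 / 2 + -x * t)
      - t ^ 2 * Real.exp (-t ^ 2 / 2 + -x * t) - x * (t * Real.exp (-t ^ 2 / 2 + -x * t)))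
    (fun t _ => by
      refine ((hasDerivAt_id t).mul (hE t)).congr_deriv ?_
      simp only [id]
      ring)
    ((hI1.integrableOn.sub hI2).sub (hI3.const_mul x)) hlim
  have e1 := integral_sub (hI1.integrableOn.sub hI2) (hI3.const_mul x)
  have e2 := integral_sub hI1.integrableOn hI2
  simp only [Pi.sub_apply] at e1
  rw [e1, e2, integral_const_mul] at h
  have h3 : 0 ≤ ∫ t in Ioi (0 : ℝ), t * Real.exp (-t ^ 2 / 2 + -x * t) :=
    setIntegral_nonneg measurableSet_Ioi fun t ht => by
      have : 0 < t := ht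
      positivity
  simp only [zero_mul, sub_zero] at h
  nlinarith [mul_nonneg hx h3]

/-- The bound `1 - u²/2 ≤ cos u` under the integral sign. -/
theorem le_re_cMills {w : ℂ} (hw : 0 ≤ w.re) :
    (1 - w.im ^ 2 / 2) * (millsE w.re)⁻¹ ≤ (cMills w).re := by
  obtain ⟨hI, hle⟩ := integral_sq_mul_exp_quadratic_le hw
  have hI1 := (integrable_exp_quadratic (-w.re)).integrableOn (s := Ioi (0 : ℝ))
  have h1 : (cMills w).re = ∫ t in Ioi (0 : ℝ),
      Real.exp (-t ^ 2 / 2 + -w.re * t) * Real.cos (t * w.im) := by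
    rw [cMills, ← Complex.reCLM_apply, ← ContinuousLinearMap.integral_comp_comm _
      (integrable_cMills_integrand w).integrableOn]
    refine integral_congr_ae (ae_of_all _ fun t => ?_)
    simp only [Complex.reCLM_apply]
    rw [cMills_exponent_eq, Complex.exp_add, ← Complex.ofReal_exp, Complex.re_ofReal_mul,
      Complex.exp_ofReal_mul_I_re, Real.cos_neg]
  have h2 : ∫ t in Ioi (0 : ℝ), (Real.exp (-t ^ 2 / 2 + -w.re * t)
      - w.im ^ 2 / 2 * (t ^ 2 * Real.exp (-t ^ 2 / 2 + -w.re * t))) ≤ (cMills w).re := by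
    rw [h1]
    refine integral_mono (hI1.sub (hI.const_mul _)) ?_ fun t => ?_
    · refine hI1.mono' (by fun_prop) (ae_of_all _ fun t => ?_)
      rw [norm_mul, Real.norm_of_nonneg (Real.exp_pos _).le]
      exact mul_le_of_le_one_right (Real.exp_pos _).le (Real.abs_cos_le_one _)
    · have := Real.one_sub_sq_div_two_le_cos (x := t * w.im)
      have := mul_le_mul_of_nonneg_left this (Real.exp_pos (-t ^ 2 / 2 + -w.re * t)).le
      simp only
      nlinarith
  rw [integral_sub hI1 (hI.const_mul _), integral_const_mul] at h2
  rw [← integral_exp_quadratic_Ioi]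
  nlinarith [mul_le_mul_of_nonneg_left hle (show 0 ≤ w.im ^ 2 / 2 by positivity)]

theorem exp_half_sq_le {y : ℝ} (hy : |y| ≤ 1 / 2) : Real.exp (y ^ 2 / 2) ≤ 8 / 7 := by
  have h : y ^ 2 / 2 ≤ 1 / 8 := by nlinarith [abs_le.1 hy]
  have h1 := Real.one_sub_le_exp_neg (y ^ 2 / 2)
  rw [Real.exp_neg] at h1
  have h2 : 7 / 8 ≤ (Real.exp (y ^ 2 / 2))⁻¹ := by linarith
  rw [← inv_inv (Real.exp (y ^ 2 / 2))]
  calc _ ≤ (7 / 8 : ℝ)⁻¹ := by gcongr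
    _ = 8 / 7 := by norm_num

/-- In the strip of half-width `1/2` the Mills ratio has no zero: to the right its real part is
positive, to the left `cTail w = 1 - cTail (-w)` stays away from zero. -/
theorem cMills_ne_zero_and_norm_inv_le {w : ℂ} (hw : |w.im| ≤ 1 / 2) :
    cMills w ≠ 0 ∧ (0 ≤ w.re → ‖(cMills w)⁻¹‖ ≤ 8 / 7 * (1 + w.re)) ∧
      (w.re ≤ 0 → ‖(cMills w)⁻¹‖ ≤ 8 / 3 * gaussDensity w.re) := by
  have key1 : 0 ≤ w.re → cMills w ≠ 0 ∧ ‖(cMills w)⁻¹‖ ≤ 8 / 7 * (1 + w.re) := by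
    intro hx
    have h1 := le_re_cMills hx
    have h2 := (Complex.re_le_norm (cMills w))
    have h3 := millsE_pos w.re
    have h4 := millsE_le w.re
    rw [abs_of_nonneg hx] at h4
    have h5 : 7 / 8 * (millsE w.re)⁻¹ ≤ ‖cMills w‖ := by
      refine le_trans ?_ (h1.trans h2)
      gcongr
      nlinarith [abs_le.1 hw]
    have h6 : 0 < 7 / 8 * (millsE w.re)⁻¹ := by positivity
    refine ⟨norm_pos_iff.1 (h6.trans_le h5), ?_⟩
    rw [norm_inv]
    calc ‖cMills w‖⁻¹ ≤ (7 / 8 * (millsE w.re)⁻¹)⁻¹ := by gcongr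
      _ = 8 / 7 * millsE w.re := by rw [mul_inv, inv_inv]; norm_num
      _ ≤ _ := by gcongr
  have key2 : w.re ≤ 0 → cMills w ≠ 0 ∧ ‖(cMills w)⁻¹‖ ≤ 8 / 3 * gaussDensity w.re := by
    intro hx
    have h1 := norm_cTail_le (-w)
    have h2 := cTail_add_cTail_neg w
    have h3 : gaussTail (-w).re ≤ 1 / 2 := gaussTail_le_half (by simpa using hx)
    have h4 := exp_half_sq_le (y := (-w).im) (by simpa using hw)
    have h5 : ‖cTail (-w)‖ ≤ 4 / 7 := by
      refine h1.trans ?_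
      have := gaussTail_pos (-w).re
      nlinarith [Real.exp_pos ((-w).im ^ 2 / 2)]
    have h6 : 3 / 7 ≤ ‖cTail w‖ := by
      have h7 : cTail w = 1 - cTail (-w) := by linear_combination h2
      have h8 := norm_sub_norm_le 1 (cTail (-w))
      rw [← h7, norm_one] at h8
      linarith
    have h7 : cTail w ≠ 0 := norm_pos_iff.1 (by linarith)
    have h8 : cMills w ≠ 0 := by
      intro h
      rw [cTail, h, mul_zero] at h7
      exact h7 rfl
    refine ⟨h8, ?_⟩
    have h9 : (cMills w)⁻¹ = cGauss w / cTail w := by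
      have : cGauss w ≠ 0 := by
        intro h
        rw [cTail, h, zero_mul] at h7
        exact h7 rfl
      rw [cTail]
      field_simp
    rw [h9, norm_div, div_le_iff₀ (by linarith), norm_cGauss]
    have h10 := exp_half_sq_le hw
    have h11 := gaussDensity_pos w.re
    calc Real.exp (w.im ^ 2 / 2) * gaussDensity w.re ≤ 8 / 7 * gaussDensity w.re := by gcongr
      _ = 8 / 3 * gaussDensity w.re * (3 / 7) := by ring
      _ ≤ _ := by gcongr
  refine ⟨?_, fun h => (key1 h).2, fun h => (key2 h).2⟩
  rcases le_total 0 w.re with h | h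
  exacts [(key1 h).1, (key2 h).1]

/-! ### Strip bounds for the four integrands -/

/-- The logistic function `1 / (1 + exp (-2w))`, for which `tanh w = 2 σ(w) - 1`. -/
noncomputable def cSigma (w : ℂ) : ℂ := (1 + Complex.exp (-(2 * w)))⁻¹

theorem re_exp_nonneg {w : ℂ} (hw : |w.im| ≤ Real.pi / 2) : 0 ≤ (Complex.exp w).re := by
  rw [Complex.exp_re]
  exact mul_nonneg (Real.exp_pos _).le (Real.cos_nonneg_of_mem_Icc (abs_le.1 hw))

/-- For `|Im w| ≤ π/4` the number `exp (-2w)` has nonnegative real part, so `1 + exp (-2w)` is at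
least as large as `1` and as `exp (-2w)`. -/
theorem one_add_exp_ne_zero_and_norm_le {w : ℂ} (hw : |w.im| ≤ 3 / 4) :
    1 + Complex.exp (-(2 * w)) ≠ 0 ∧ ‖cSigma w‖ ≤ 1 ∧ ‖cSigma w‖ ≤ Real.exp (2 * w.re) := by
  have h1 : 0 ≤ (Complex.exp (-(2 * w))).re := re_exp_nonneg (by
    have := Real.pi_gt_three
    simp only [Complex.neg_im, Complex.mul_im, Complex.re_ofNat, Complex.im_ofNat, zero_mul,
      add_zero, abs_neg, abs_mul, Nat.abs_ofNat]
    linarith)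
  set u := Complex.exp (-(2 * w)) with hu
  have h2 : 1 ≤ ‖1 + u‖ := by
    refine le_trans ?_ (Complex.re_le_norm _)
    simpa using h1
  have h3 : ‖u‖ ≤ ‖1 + u‖ := by
    rw [← sq_le_sq₀ (norm_nonneg _) (norm_nonneg _), ← Complex.normSq_eq_norm_sq,
      ← Complex.normSq_eq_norm_sq, Complex.normSq_apply, Complex.normSq_apply]
    simp only [Complex.add_re, Complex.one_re, Complex.add_im, Complex.one_im, zero_add]
    nlinarith
  have h4 : ‖u‖ = Real.exp (-(2 * w.re)) := by
    rw [hu, Complex.norm_exp]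
    simp
  refine ⟨norm_pos_iff.1 (by linarith), ?_, ?_⟩
  · rw [cSigma, norm_inv]
    exact inv_le_one_of_one_le₀ h2
  · rw [cSigma, norm_inv, ← neg_neg (2 * w.re), Real.exp_neg, ← h4]
    gcongr
    rw [h4]
    positivity

theorem differentiableAt_cSigma {w : ℂ} (hw : |w.im| ≤ 3 / 4) : DifferentiableAt ℂ cSigma w := by
  unfold cSigma
  exact DifferentiableAt.inv (by fun_prop) (one_add_exp_ne_zero_and_norm_le hw).1

theorem differentiableAt_inv_cMills {w : ℂ} (hw : |w.im| ≤ 1 / 2) :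
    DifferentiableAt ℂ (fun w => (cMills w)⁻¹) w :=
  (differentiable_cMills w).inv (cMills_ne_zero_and_norm_inv_le hw).1

theorem one_add_sq_mul_exp_le (x : ℝ) : (1 + x ^ 2) ^ 2 * Real.exp (-x ^ 2 / 2) ≤ 16 := by
  have h := Real.add_one_le_exp (x ^ 2 / 4)
  have h2 : (1 + x ^ 2) ≤ 4 * Real.exp (x ^ 2 / 4) := by nlinarith [sq_nonneg x]
  have h3 : Real.exp (-x ^ 2 / 2) = (Real.exp (x ^ 2 / 4) ^ 2)⁻¹ := by
    rw [← Real.exp_nat_mul, ← Real.exp_neg]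
    congr 1
    push_cast
    ring
  rw [h3, ← div_eq_mul_inv, div_le_iff₀ (by positivity)]
  nlinarith [sq_nonneg x]

theorem one_add_sq_sq_mul_gaussDensity_le (x : ℝ) :
    (1 + x ^ 2) ^ 2 * gaussDensity x ≤ 8 := by
  unfold gaussDensity
  have h2 : 2 ≤ √(2 * Real.pi) := Real.le_sqrt_of_sq_le (by nlinarith [Real.pi_gt_three])
  rw [← mul_div_assoc, div_le_iff₀ (by positivity)]
  nlinarith [one_add_sq_mul_exp_le x]

theorem gaussDensity_le_of_sq_le {x y : ℝ} (h : x ^ 2 ≤ y ^ 2) :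
    gaussDensity y ≤ gaussDensity x := by
  unfold gaussDensity
  gcongr

theorem le_mul_inv_one_add_sq {a C x : ℝ} (h : a * (1 + x ^ 2) ≤ C) : a ≤ C * (1 + x ^ 2)⁻¹ := by
  rw [← div_eq_mul_inv, le_div_iff₀ (by positivity)]
  exact h

/-- The integrand `tanh(sz)² φ(z)`. -/
noncomputable def cIntP (s : ℝ) (w : ℂ) : ℂ := (2 * cSigma (s * w) - 1) ^ 2 * cGauss w

/-- The integrand `2s Φ̄(z) / (1 + exp(-2sz))`. -/
noncomputable def cIntK (s : ℝ) (w : ℂ) : ℂ := 2 * s * (cSigma (s * w) * cTail w)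

/-- The integrand `𝓔(gz)² φ(z)`. -/
noncomputable def cIntA (g : ℝ) (w : ℂ) : ℂ := (cMills (g * w))⁻¹ ^ 2 * cGauss w

/-- The integrand `g 𝓔(gz) Φ̄(z)`. -/
noncomputable def cIntL (g : ℝ) (w : ℂ) : ℂ := g * ((cMills (g * w))⁻¹ * cTail w)

theorem abs_im_mul_le {s a b : ℝ} (hs0 : 0 ≤ s) (hs : s * a ≤ b) {w : ℂ} (hw : |w.im| ≤ a) :
    |((s : ℂ) * w).im| ≤ b := by
  rw [Complex.im_ofReal_mul, abs_mul, abs_of_nonneg hs0]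
  exact (mul_le_mul_of_nonneg_left hw hs0).trans hs

section

variable {s g : ℝ} {w : ℂ}

theorem differentiableAt_cIntP (hs : 0 ≤ s) (hs2 : s ≤ 7 / 4) (hw : |w.im| ≤ 2 / 5) :
    DifferentiableAt ℂ (cIntP s) w := by
  have h := differentiableAt_cSigma (abs_im_mul_le (b := 3 / 4) hs (by linarith) hw)
  have h1 : DifferentiableAt ℂ (fun w => cSigma (s * w)) w :=
    DifferentiableAt.comp (g := cSigma) w h (by fun_prop)
  exact (((h1.const_mul 2).sub_const 1).pow 2).mul (differentiable_cGauss w)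

theorem differentiableAt_cIntK (hs : 0 ≤ s) (hs2 : s ≤ 7 / 4) (hw : |w.im| ≤ 2 / 5) :
    DifferentiableAt ℂ (cIntK s) w := by
  have h := differentiableAt_cSigma (abs_im_mul_le (b := 3 / 4) hs (by linarith) hw)
  have h1 : DifferentiableAt ℂ (fun w => cSigma (s * w)) w :=
    DifferentiableAt.comp (g := cSigma) w h (by fun_prop)
  exact (h1.mul (differentiable_cTail w)).const_mul _

theorem differentiableAt_cIntA (hg : 0 ≤ g) (hg2 : g ≤ 5 / 4) (hw : |w.im| ≤ 2 / 5) :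
    DifferentiableAt ℂ (cIntA g) w := by
  have h := differentiableAt_inv_cMills (abs_im_mul_le (b := 1 / 2) hg (by linarith) hw)
  have h1 : DifferentiableAt ℂ (fun w => (cMills (g * w))⁻¹) w :=
    DifferentiableAt.comp (g := fun w => (cMills w)⁻¹) w h (by fun_prop)
  exact (h1.pow 2).mul (differentiable_cGauss w)

theorem differentiableAt_cIntL (hg : 0 ≤ g) (hg2 : g ≤ 5 / 4) (hw : |w.im| ≤ 2 / 5) :
    DifferentiableAt ℂ (cIntL g) w := by
  have h := differentiableAt_inv_cMills (abs_im_mul_le (b := 1 / 2) hg (by linarith) hw)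
  have h1 : DifferentiableAt ℂ (fun w => (cMills (g * w))⁻¹) w :=
    DifferentiableAt.comp (g := fun w => (cMills w)⁻¹) w h (by fun_prop)
  exact (h1.mul (differentiable_cTail w)).const_mul _

theorem norm_cGauss_le (hw : |w.im| ≤ 2 / 5) : ‖cGauss w‖ ≤ 8 / 7 * gaussDensity w.re := by
  rw [norm_cGauss]
  have := gaussDensity_pos w.re
  have := exp_half_sq_le (y := w.im) (by linarith)
  gcongr

theorem norm_cTail_le_gaussTail (hw : |w.im| ≤ 2 / 5) : ‖cTail w‖ ≤ 8 / 7 * gaussTail w.re := by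
  refine (norm_cTail_le w).trans ?_
  have := gaussTail_pos w.re
  have := exp_half_sq_le (y := w.im) (by linarith)
  gcongr

theorem gaussTail_le_two_mul_gaussDensity {x : ℝ} (hx : 0 ≤ x) :
    gaussTail x ≤ 2 * gaussDensity x := by
  rcases le_total x (1 / 2) with h | h
  · have h1 : gaussDensity (1 / 2) ≤ gaussDensity x := gaussDensity_le_of_sq_le (by nlinarith)
    have h2 : 1 / 4 ≤ gaussDensity (1 / 2) := by
      unfold gaussDensity
      have h3 := Real.add_one_le_exp (-(1 / 2 : ℝ) ^ 2 / 2)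
      have h4 : √(2 * Real.pi) ≤ 3 :=
        Real.sqrt_le_iff.2 ⟨by norm_num, by nlinarith [Real.pi_lt_d2]⟩
      rw [le_div_iff₀ (by positivity)]
      linarith
    linarith [gaussTail_le_half hx]
  · have := mul_gaussTail_le x
    nlinarith [gaussTail_pos x]

theorem norm_cIntP_le (hs : 0 ≤ s) (hs2 : s ≤ 7 / 4) (hw : |w.im| ≤ 2 / 5) :
    ‖cIntP s w‖ ≤ 100 * (1 + w.re ^ 2)⁻¹ := by
  apply le_mul_inv_one_add_sq
  have h1 := (one_add_exp_ne_zero_and_norm_le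
    (abs_im_mul_le (b := 3 / 4) hs (by linarith) hw)).2.1
  have h2 : ‖2 * cSigma (s * w) - 1‖ ≤ 3 := by
    refine (norm_sub_le _ _).trans ?_
    rw [norm_mul, norm_one, Complex.norm_ofNat]
    linarith
  have h3 := norm_cGauss_le hw
  have h4 := one_add_sq_sq_mul_gaussDensity_le w.re
  have h5 := gaussDensity_pos w.re
  rw [cIntP, norm_mul, norm_pow]
  calc _ ≤ 3 ^ 2 * (8 / 7 * gaussDensity w.re) * (1 + w.re ^ 2) := by gcongr
    _ ≤ 3 ^ 2 * (8 / 7 * gaussDensity w.re) * (1 + w.re ^ 2) ^ 2 := by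
        gcongr
        nlinarith [sq_nonneg w.re]
    _ = 9 * (8 / 7) * ((1 + w.re ^ 2) ^ 2 * gaussDensity w.re) := by ring
    _ ≤ 9 * (8 / 7) * 8 := by gcongr
    _ ≤ 100 := by norm_num

theorem norm_cIntK_le (hs : 1 ≤ s) (hs2 : s ≤ 7 / 4) (hw : |w.im| ≤ 2 / 5) :
    ‖cIntK s w‖ ≤ 100 * (1 + w.re ^ 2)⁻¹ := by
  apply le_mul_inv_one_add_sq
  obtain ⟨-, h1, h2⟩ := one_add_exp_ne_zero_and_norm_le
    (abs_im_mul_le (b := 3 / 4) (zero_le_one.trans hs) (by linarith) hw)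
  have h3 := norm_cTail_le_gaussTail hw
  rw [Complex.re_ofReal_mul] at h2
  rw [cIntK, norm_mul, norm_mul, norm_mul, Complex.norm_ofNat, Complex.norm_real,
    Real.norm_of_nonneg (by linarith)]
  have key : ‖cSigma (s * w)‖ * ‖cTail w‖ * (1 + w.re ^ 2) ≤ 28 := by
    rcases le_total 0 w.re with hx | hx
    · have h4 := gaussTail_le_two_mul_gaussDensity hx
      have h5 := one_add_sq_sq_mul_gaussDensity_le w.re
      have h6 := gaussDensity_pos w.re
      calc _ ≤ 1 * (8 / 7 * (2 * gaussDensity w.re)) * (1 + w.re ^ 2) := by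
            gcongr
            exact h3.trans (by gcongr)
        _ ≤ 1 * (8 / 7 * (2 * gaussDensity w.re)) * (1 + w.re ^ 2) ^ 2 := by
            gcongr
            nlinarith [sq_nonneg w.re]
        _ = (16 / 7) * ((1 + w.re ^ 2) ^ 2 * gaussDensity w.re) := by ring
        _ ≤ (16 / 7) * 8 := by gcongr
        _ ≤ 28 := by norm_num
    · have h4 := gaussTail_lt_one w.re
      have h5 : Real.exp (2 * (s * w.re)) * (1 + w.re ^ 2) ≤ 1 := by
        have e : Real.exp (2 * (s * w.re)) = (Real.exp (2 * (s * -w.re)))⁻¹ := by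
          rw [← Real.exp_neg]
          congr 1
          ring
        rw [e, inv_mul_le_iff₀ (Real.exp_pos _), mul_one]
        have h6 : 0 ≤ s * -w.re := mul_nonneg (by linarith) (by linarith)
        have h7 := Real.quadratic_le_exp_of_nonneg (show 0 ≤ 2 * (s * -w.re) by linarith)
        nlinarith [mul_nonneg (show 0 ≤ s - 1 by linarith) (sq_nonneg w.re),
          mul_nonneg (show 0 ≤ (s - 1) * s by nlinarith) (sq_nonneg w.re)]
      calc _ = (‖cSigma (s * w)‖ * (1 + w.re ^ 2)) * ‖cTail w‖ := by ring
        _ ≤ 1 * (8 / 7 * 1) := by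
            gcongr
            · exact le_trans (by gcongr) h5
            · exact h3.trans (by gcongr)
        _ ≤ 28 := by norm_num
  nlinarith [norm_nonneg (cSigma (s * w)), norm_nonneg (cTail w)]

/-- Linear growth of `𝓔(gw)` to the right and gaussian decay to the left. -/
theorem norm_inv_cMills_mul_le (hg : 1 ≤ g) (hg2 : g ≤ 5 / 4) (hw : |w.im| ≤ 2 / 5) :
    (0 ≤ w.re → ‖(cMills (g * w))⁻¹‖ ^ 2 ≤ 5 * (1 + w.re ^ 2)) ∧
    (w.re ≤ 0 → ‖(cMills (g * w))⁻¹‖ ≤ 8 / 3 * gaussDensity w.re) := by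
  obtain ⟨-, h1, h2⟩ := cMills_ne_zero_and_norm_inv_le
    (abs_im_mul_le (b := 1 / 2) (zero_le_one.trans hg) (by linarith) hw)
  rw [Complex.re_ofReal_mul] at h1 h2
  constructor
  · intro hx
    have h3 := h1 (mul_nonneg (by linarith) hx)
    have h4 : ‖(cMills (g * w))⁻¹‖ ≤ 10 / 7 * (1 + w.re) := h3.trans (by nlinarith)
    have h5 := pow_le_pow_left₀ (norm_nonneg _) h4 2
    nlinarith [sq_nonneg (w.re - 1)]
  · intro hx
    refine (h2 (mul_nonpos_of_nonneg_of_nonpos (by linarith) hx)).trans ?_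
    gcongr
    apply gaussDensity_le_of_sq_le
    rw [mul_pow]
    exact le_mul_of_one_le_left (sq_nonneg _) (one_le_pow₀ hg)

theorem norm_cIntA_le (hg : 1 ≤ g) (hg2 : g ≤ 5 / 4) (hw : |w.im| ≤ 2 / 5) :
    ‖cIntA g w‖ ≤ 100 * (1 + w.re ^ 2)⁻¹ := by
  apply le_mul_inv_one_add_sq
  obtain ⟨h1, h2⟩ := norm_inv_cMills_mul_le hg hg2 hw
  have h3 := norm_cGauss_le hw
  have h4 := one_add_sq_sq_mul_gaussDensity_le w.re
  have h5 := gaussDensity_pos w.re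
  have h6 := gaussDensity_le_half w.re
  rw [cIntA, norm_mul, norm_pow]
  have h7 : ‖(cMills (g * w))⁻¹‖ ^ 2 ≤ 5 * (1 + w.re ^ 2) := by
    rcases le_total 0 w.re with hx | hx
    · exact h1 hx
    · have h8 := pow_le_pow_left₀ (norm_nonneg _) (h2 hx) 2
      nlinarith [sq_nonneg w.re]
  calc _ ≤ 5 * (1 + w.re ^ 2) * (8 / 7 * gaussDensity w.re) * (1 + w.re ^ 2) := by gcongr
    _ = 5 * (8 / 7) * ((1 + w.re ^ 2) ^ 2 * gaussDensity w.re) := by ring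
    _ ≤ 5 * (8 / 7) * 8 := by gcongr
    _ ≤ 100 := by norm_num

theorem norm_cIntL_le (hg : 1 ≤ g) (hg2 : g ≤ 5 / 4) (hw : |w.im| ≤ 2 / 5) :
    ‖cIntL g w‖ ≤ 100 * (1 + w.re ^ 2)⁻¹ := by
  apply le_mul_inv_one_add_sq
  obtain ⟨h1, h2⟩ := norm_inv_cMills_mul_le hg hg2 hw
  have h3 := norm_cTail_le_gaussTail hw
  have h4 := one_add_sq_sq_mul_gaussDensity_le w.re
  have h5 := gaussDensity_pos w.re
  have h6 : 1 ≤ 1 + w.re ^ 2 := by nlinarith [sq_nonneg w.re]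
  rw [cIntL, norm_mul, norm_mul, Complex.norm_real, Real.norm_of_nonneg (by linarith)]
  have key : ‖(cMills (g * w))⁻¹‖ * ‖cTail w‖ * (1 + w.re ^ 2) ≤ 60 := by
    rcases le_total 0 w.re with hx | hx
    · have h7 : ‖(cMills (g * w))⁻¹‖ ≤ 3 * (1 + w.re ^ 2) := by
        nlinarith [h1 hx, norm_nonneg (cMills (g * w))⁻¹]
      have h8 := gaussTail_le_two_mul_gaussDensity hx
      calc _ ≤ 3 * (1 + w.re ^ 2) * (8 / 7 * (2 * gaussDensity w.re)) * (1 + w.re ^ 2) := by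
            gcongr
            exact h3.trans (by gcongr)
        _ = 3 * (16 / 7) * ((1 + w.re ^ 2) ^ 2 * gaussDensity w.re) := by ring
        _ ≤ 3 * (16 / 7) * 8 := by gcongr
        _ ≤ 60 := by norm_num
    · have h7 := gaussTail_lt_one w.re
      calc _ ≤ 8 / 3 * gaussDensity w.re * (8 / 7 * 1) * (1 + w.re ^ 2) := by
            gcongr
            · exact h2 hx
            · exact h3.trans (by gcongr)
        _ ≤ 8 / 3 * gaussDensity w.re * (8 / 7 * 1) * (1 + w.re ^ 2) ^ 2 := by
            gcongr
            nlinarith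
        _ = 8 / 3 * (8 / 7) * ((1 + w.re ^ 2) ^ 2 * gaussDensity w.re) := by ring
        _ ≤ 8 / 3 * (8 / 7) * 8 := by gcongr
        _ ≤ 60 := by norm_num
  nlinarith [norm_nonneg (cMills (g * w))⁻¹, norm_nonneg (cTail w)]

/-- The trapezoidal rule with step `1/16` for a function holomorphic in the strip of half-width
`2/5`. -/
theorem trapezoid_sixteenth {f : ℂ → ℂ}
    (hf : ∀ w : ℂ, |w.im| ≤ 2 / 5 → DifferentiableAt ℂ f w)
    (hC : ∀ w : ℂ, |w.im| ≤ 2 / 5 → ‖f w‖ ≤ 100 * (1 + w.re ^ 2)⁻¹) :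
    ‖(1 / 16 : ℝ) * ∑' n : ℤ, f ((1 / 16 : ℝ) * n) - ∫ x : ℝ, f x‖ ≤ 1.2e-13 := by
  refine (trapezoid_error_le (by norm_num) (h := 1 / 16) (by norm_num) (by norm_num)
    hf hC).trans ?_
  have h1 : Real.exp (-(2 * Real.pi * (2 / 5 / (1 / 16)))) ≤ 1e-17 := by
    have h2 : -(2 * Real.pi * (2 / 5 / (1 / 16))) ≤ -((40 : ℕ) * 1 : ℝ) := by
      have := Real.pi_gt_d2
      push_cast
      norm_num
      linarith
    refine (Real.exp_le_exp.2 h2).trans ?_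
    rw [Real.exp_neg, Real.exp_nat_mul]
    have h3 : (27 / 10 : ℝ) ^ 40 ≤ Real.exp 1 ^ 40 := by
      have := Real.exp_one_gt_d9
      gcongr
      linarith
    refine inv_le_of_inv_le₀ (by norm_num) (le_trans ?_ h3)
    norm_num
  set r := Real.exp (-(2 * Real.pi * (2 / 5 / (1 / 16))))
  have h0 : 0 < r := Real.exp_pos _
  have h2 : r / (1 - r) ≤ 1.1e-17 := by
    rw [div_le_iff₀ (by linarith)]
    linarith
  have := Real.pi_lt_d2
  have := Real.pi_pos
  have h3 : 0 ≤ r / (1 - r) := div_nonneg h0.le (by linarith)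
  calc (100 / (1 / 16) * Real.pi * (2 * (r / (1 - r))) : ℝ)
      ≤ 100 / (1 / 16) * 3.15 * (2 * 1.1e-17) := by gcongr
    _ ≤ 1.2e-13 := by norm_num

end

/-! ### Gaussian averages of functions of polynomial growth -/

theorem integrable_exp_sq_div_four_mul_gaussDensity :
    Integrable fun z : ℝ => Real.exp (z ^ 2 / 4) * gaussDensity z := by
  refine ((integrable_exp_neg_mul_sq (b := 1 / 4) (by norm_num)).div_const
    (√(2 * Real.pi))).congr (ae_of_all _ fun z => ?_)
  unfold gaussDensity
  simp only
  rw [← mul_div_assoc, ← Real.exp_add]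
  congr 2
  ring

theorem integral_exp_sq_div_four_mul_gaussDensity :
    ∫ z : ℝ, Real.exp (z ^ 2 / 4) * gaussDensity z = √2 := by
  have h : ∀ z : ℝ, Real.exp (z ^ 2 / 4) * gaussDensity z
      = Real.exp (-(1 / 4) * z ^ 2) * (√(2 * Real.pi))⁻¹ := by
    intro z
    unfold gaussDensity
    rw [← mul_div_assoc, ← Real.exp_add, div_eq_mul_inv]
    congr 2
    ring
  simp_rw [h]
  rw [integral_mul_const, integral_gaussian, ← div_eq_mul_inv, ← Real.sqrt_div (by positivity)]
  congr 1
  have := Real.pi_pos.ne'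
  field_simp
  norm_num

theorem one_add_abs_pow_six_le (z : ℝ) : (1 + |z|) ^ 6 ≤ 13824 * Real.exp (z ^ 2 / 4) := by
  have h := Real.add_one_le_exp (z ^ 2 / 12)
  have h1 : (1 + |z|) ^ 2 ≤ 24 * Real.exp (z ^ 2 / 12) := by
    nlinarith [sq_nonneg (|z| - 1), sq_abs z]
  have h2 : Real.exp (z ^ 2 / 4) = Real.exp (z ^ 2 / 12) ^ 3 := by
    rw [← Real.exp_nat_mul]
    congr 1
    push_cast
    ring
  calc (1 + |z|) ^ 6 = ((1 + |z|) ^ 2) ^ 3 := by ring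
    _ ≤ (24 * Real.exp (z ^ 2 / 12)) ^ 3 := by gcongr
    _ = _ := by rw [h2]; ring

theorem integrable_one_add_abs_pow_six :
    Integrable fun z : ℝ => (1 + |z|) ^ 6 * gaussDensity z := by
  refine (integrable_exp_sq_div_four_mul_gaussDensity.const_mul 13824).mono'
    (by have := continuous_gaussDensity; fun_prop) (ae_of_all _ fun z => ?_)
  have := gaussDensity_pos z
  rw [Real.norm_of_nonneg (by positivity), ← mul_assoc]
  gcongr
  exact one_add_abs_pow_six_le z

theorem integral_one_add_abs_pow_six_le :
    ∫ z : ℝ, (1 + |z|) ^ 6 * gaussDensity z ≤ 20000 := by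
  have h : ∫ z : ℝ, (1 + |z|) ^ 6 * gaussDensity z ≤ 13824 * √2 := by
    rw [← integral_exp_sq_div_four_mul_gaussDensity, ← integral_const_mul]
    refine integral_mono integrable_one_add_abs_pow_six
      (integrable_exp_sq_div_four_mul_gaussDensity.const_mul 13824) fun z => ?_
    have := gaussDensity_pos z
    simp only
    rw [← mul_assoc]
    gcongr
    exact one_add_abs_pow_six_le z
  have h2 : √2 ≤ 1.44 := Real.sqrt_le_iff.2 ⟨by norm_num, by norm_num⟩
  linarith

theorem integrable_mul_gaussDensity {f : ℝ → ℝ} {C : ℝ} (hf : Continuous f)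
    (hC : ∀ z, |f z| ≤ C * (1 + |z|) ^ 6) : Integrable fun z => f z * gaussDensity z := by
  refine (integrable_one_add_abs_pow_six.const_mul C).mono'
    (by have := continuous_gaussDensity; fun_prop) (ae_of_all _ fun z => ?_)
  have := gaussDensity_pos z
  rw [norm_mul, Real.norm_eq_abs, Real.norm_of_nonneg this.le, ← mul_assoc]
  gcongr
  exact hC z

theorem nonneg_of_growth {f : ℝ → ℝ} {C : ℝ} (hC : ∀ x, |f x| ≤ C * (1 + |x|) ^ 4) : 0 ≤ C := by
  simpa using (abs_nonneg _).trans (hC 0)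

theorem growth_comp_mul {f : ℝ → ℝ} {C B : ℝ} (hC : ∀ x, |f x| ≤ C * (1 + |x|) ^ 4)
    (hB : 1 ≤ B) {s : ℝ} (hs : |s| ≤ B) (z : ℝ) :
    |f (s * z)| ≤ C * B ^ 4 * (1 + |z|) ^ 4 := by
  have h0 := nonneg_of_growth hC
  refine (hC _).trans ?_
  rw [mul_assoc, ← mul_pow, abs_mul]
  gcongr
  nlinarith [abs_nonneg z, abs_nonneg s]

theorem integrable_comp_mul_gaussDensity {f : ℝ → ℝ} {C : ℝ} (hf : Continuous f)
    (hC : ∀ x, |f x| ≤ C * (1 + |x|) ^ 4) (s : ℝ) :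
    Integrable fun z => f (s * z) * gaussDensity z := by
  have h0 := nonneg_of_growth hC
  refine integrable_mul_gaussDensity (C := C * (1 + |s|) ^ 4) (by fun_prop) fun z => ?_
  refine (growth_comp_mul hC (B := 1 + |s|) (by linarith [abs_nonneg s]) (by linarith) z).trans ?_
  have : 1 ≤ 1 + |z| := by linarith [abs_nonneg z]
  gcongr
  norm_num

theorem integrable_id_mul_comp_mul_gaussDensity {f : ℝ → ℝ} {C : ℝ} (hf : Continuous f)
    (hC : ∀ x, |f x| ≤ C * (1 + |x|) ^ 4) (s : ℝ) :
    Integrable fun z => z * f (s * z) * gaussDensity z := by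
  have h0 := nonneg_of_growth hC
  refine integrable_mul_gaussDensity (C := C * (1 + |s|) ^ 4) (by fun_prop) fun z => ?_
  have h1 := growth_comp_mul hC (B := 1 + |s|) (by linarith [abs_nonneg s]) (by linarith) z
  have h2 : 1 ≤ 1 + |z| := by linarith [abs_nonneg z]
  rw [abs_mul]
  calc |z| * |f (s * z)| ≤ (1 + |z|) * (C * (1 + |s|) ^ 4 * (1 + |z|) ^ 4) := by
        gcongr
        linarith
    _ = C * (1 + |s|) ^ 4 * (1 + |z|) ^ 5 := by ring
    _ ≤ _ := by
        gcongr
        norm_num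

/-- Differentiation under the integral sign with respect to the scale of the argument. -/
theorem hasDerivAt_integral_comp_mul_gaussDensity {f f' : ℝ → ℝ} {C C' : ℝ}
    (hf : ∀ x, HasDerivAt f (f' x) x) (hf' : Continuous f')
    (hC : ∀ x, |f x| ≤ C * (1 + |x|) ^ 4) (hC' : ∀ x, |f' x| ≤ C' * (1 + |x|) ^ 4) (s : ℝ) :
    HasDerivAt (fun s => ∫ z, f (s * z) * gaussDensity z)
      (∫ z, z * f' (s * z) * gaussDensity z) s := by
  have hfc : Continuous f := continuous_iff_continuousAt.2 fun x => (hf x).continuousAt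
  have hφ := continuous_gaussDensity
  have h0 := nonneg_of_growth hC'
  refine (hasDerivAt_integral_of_dominated_loc_of_deriv_le (Metric.ball_mem_nhds s one_pos)
    (F := fun s z => f (s * z) * gaussDensity z)
    (F' := fun s z => z * f' (s * z) * gaussDensity z)
    (bound := fun z => C' * (|s| + 1) ^ 4 * ((1 + |z|) ^ 6 * gaussDensity z))
    (Filter.Eventually.of_forall fun t => by fun_prop)
    (integrable_comp_mul_gaussDensity hfc hC s) (by fun_prop)
    (ae_of_all _ fun z t ht => ?_) (integrable_one_add_abs_pow_six.const_mul _)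
    (ae_of_all _ fun z t _ => ?_)).2
  · have ht' : |t| ≤ |s| + 1 := by
      rw [Metric.mem_ball, Real.dist_eq] at ht
      have := abs_sub_abs_le_abs_sub t s
      linarith
    have h1 := growth_comp_mul hC' (B := |s| + 1) (by linarith [abs_nonneg s]) ht' z
    have h2 := gaussDensity_pos z
    have h3 : 1 ≤ 1 + |z| := by linarith [abs_nonneg z]
    rw [norm_mul, norm_mul, Real.norm_eq_abs, Real.norm_eq_abs, Real.norm_of_nonneg h2.le,
      ← mul_assoc]
    refine mul_le_mul_of_nonneg_right ?_ h2.le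
    calc |z| * |f' (t * z)| ≤ (1 + |z|) * (C' * (|s| + 1) ^ 4 * (1 + |z|) ^ 4) := by
          gcongr
          linarith
      _ = C' * (|s| + 1) ^ 4 * (1 + |z|) ^ 5 := by ring
      _ ≤ _ := by
          gcongr
          norm_num
  · have h1 : HasDerivAt (fun t : ℝ => t * z) z t := by
      simpa using (hasDerivAt_id t).mul_const z
    refine (((hf (t * z)).comp t h1).mul_const (gaussDensity z)).congr_deriv ?_
    ring

/-- A Lipschitz bound for `s ↦ ∫ z f(sz) φ(z) dz`, the form of the derivatives of
gaussian averages. -/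
theorem abs_integral_id_mul_comp_sub_le {f f' : ℝ → ℝ} {C C' B : ℝ}
    (hf : ∀ x, HasDerivAt f (f' x) x)
    (hC : ∀ x, |f x| ≤ C * (1 + |x|) ^ 4) (hC' : ∀ x, |f' x| ≤ C' * (1 + |x|) ^ 4) (hB : 1 ≤ B)
    {s t : ℝ} (hs : |s| ≤ B) (ht : |t| ≤ B) :
    |(∫ z, z * f (s * z) * gaussDensity z) - ∫ z, z * f (t * z) * gaussDensity z|
      ≤ 20000 * (C' * B ^ 4) * |s - t| := by
  have hfc : Continuous f := continuous_iff_continuousAt.2 fun x => (hf x).continuousAt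
  have h0 := nonneg_of_growth hC'
  have hpt : ∀ z, |f (s * z) - f (t * z)| ≤ C' * B ^ 4 * (1 + |z|) ^ 4 * (|s - t| * |z|) := by
    intro z
    have hm := Convex.norm_image_sub_le_of_norm_hasDerivWithin_le (f := f) (f' := f')
      (s := Icc (-(B * |z|)) (B * |z|)) (C := C' * B ^ 4 * (1 + |z|) ^ 4)
      (x := t * z) (y := s * z)
      (fun x _ => (hf x).hasDerivWithinAt)
      (fun x hx => by
        have hx2 : |x| ≤ B * |z| := abs_le.2 hx
        rw [Real.norm_eq_abs]
        refine (hC' x).trans ?_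
        rw [mul_assoc, ← mul_pow]
        gcongr
        nlinarith [abs_nonneg z])
      (convex_Icc _ _)
      (abs_le.1 (by rw [abs_mul]; gcongr)) (abs_le.1 (by rw [abs_mul]; gcongr))
    rwa [← sub_mul, Real.norm_eq_abs, Real.norm_eq_abs, abs_mul] at hm
  rw [← integral_sub (integrable_id_mul_comp_mul_gaussDensity hfc hC s)
    (integrable_id_mul_comp_mul_gaussDensity hfc hC t), ← Real.norm_eq_abs]
  refine (norm_integral_le_of_norm_le
    (integrable_one_add_abs_pow_six.const_mul (C' * B ^ 4 * |s - t|))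
    (ae_of_all _ fun z => ?_)).trans ?_
  · have h2 := gaussDensity_pos z
    rw [← sub_mul, ← mul_sub, norm_mul, norm_mul, Real.norm_eq_abs, Real.norm_eq_abs,
      Real.norm_of_nonneg h2.le, ← mul_assoc]
    refine mul_le_mul_of_nonneg_right ?_ h2.le
    calc |z| * |f (s * z) - f (t * z)|
        ≤ (1 + |z|) * (C' * B ^ 4 * (1 + |z|) ^ 4 * (|s - t| * (1 + |z|))) := by
          gcongr
          · linarith
          · exact (hpt z).trans (by gcongr; linarith)
      _ = _ := by ring
  · rw [integral_const_mul]
    have := integral_one_add_abs_pow_six_le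
    calc _ ≤ C' * B ^ 4 * |s - t| * 20000 := by gcongr
      _ = _ := by ring

/-- Gaussian integration by parts. -/
theorem integral_id_mul_gaussDensity {g g' : ℝ → ℝ} {C C' : ℝ}
    (hg : ∀ x, HasDerivAt g (g' x) x) (hg' : Continuous g')
    (hC : ∀ x, |g x| ≤ C * (1 + |x|) ^ 4) (hC' : ∀ x, |g' x| ≤ C' * (1 + |x|) ^ 4) :
    ∫ z, z * g z * gaussDensity z = ∫ z, g' z * gaussDensity z := by
  have hgc : Continuous g := continuous_iff_continuousAt.2 fun x => (hg x).continuousAt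
  have h1 := integrable_id_mul_comp_mul_gaussDensity hgc hC 1
  have h2 := integrable_comp_mul_gaussDensity hg' hC' 1
  have h3 := integrable_comp_mul_gaussDensity hgc hC 1
  simp only [one_mul] at h1 h2 h3
  have h := integral_mul_deriv_eq_deriv_mul_of_integrable (u := g) (u' := g') (v := gaussDensity)
    (v' := fun x => -x * gaussDensity x) (fun x _ => hg x) (fun x _ => hasDerivAt_gaussDensity x)
    (h1.neg.congr (ae_of_all _ fun z => by simp; ring)) h2 h3
  have e : ∫ z, z * g z * gaussDensity z = -∫ z, g z * (-z * gaussDensity z) := by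
    rw [← integral_neg]
    congr 1
    ext z
    ring
  rw [e, h, neg_neg]

/-! ### The four gaussian averages -/

/-- `∫ tanh(sz)² φ(z) dz`, so that `recP ψ = avgTanhSq √ψ`. -/
noncomputable def avgTanhSq (s : ℝ) : ℝ := ∫ z, Real.tanh (s * z) ^ 2 * gaussDensity z

/-- `∫ log(2 cosh(sz)) φ(z) dz`. -/
noncomputable def avgLogCosh (s : ℝ) : ℝ :=
  ∫ z, Real.log (2 * Real.cosh (s * z)) * gaussDensity z

/-- `∫ 𝓔(gz)² φ(z) dz`. -/
noncomputable def avgMillsSq (g : ℝ) : ℝ := ∫ z, millsE (g * z) ^ 2 * gaussDensity z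

/-- `∫ log Φ̄(gz) φ(z) dz`. -/
noncomputable def avgLogTail (g : ℝ) : ℝ :=
  ∫ z, Real.log (gaussTail (g * z)) * gaussDensity z

/-- The derivative of `avgTanhSq`. -/
noncomputable def avgTanhSq' (s : ℝ) : ℝ :=
  ∫ z, z * (2 * Real.tanh (s * z) * (1 - Real.tanh (s * z) ^ 2)) * gaussDensity z

/-- The derivative of `avgMillsSq`. -/
noncomputable def avgMillsSq' (g : ℝ) : ℝ :=
  ∫ z, z * (2 * millsE (g * z) ^ 2 * (millsE (g * z) - g * z)) * gaussDensity z

theorem hasDerivAt_tanh' (x : ℝ) : HasDerivAt Real.tanh (1 - Real.tanh x ^ 2) x := by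
  have h := (Real.hasDerivAt_sinh x).div (Real.hasDerivAt_cosh x) (Real.cosh_pos x).ne'
  have e : Real.tanh = Real.sinh / Real.cosh := funext Real.tanh_eq_sinh_div_cosh
  rw [e]
  refine h.congr_deriv ?_
  have := (Real.cosh_pos x).ne'
  rw [Pi.div_apply]
  field_simp

theorem continuous_tanh' : Continuous Real.tanh :=
  continuous_iff_continuousAt.2 fun x => (hasDerivAt_tanh' x).continuousAt

theorem tanh_sq_le_one (x : ℝ) : Real.tanh x ^ 2 ≤ 1 := by
  rw [Real.tanh_eq_sinh_div_cosh, div_pow, div_le_one (by have := Real.cosh_pos x; positivity)]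
  linarith [Real.cosh_sq x]

theorem abs_tanh_le_one (x : ℝ) : |Real.tanh x| ≤ 1 := by
  rw [← sq_le_one_iff_abs_le_one]
  exact tanh_sq_le_one x

theorem one_le_one_add_abs_pow (x : ℝ) (n : ℕ) : 1 ≤ (1 + |x|) ^ n :=
  one_le_pow₀ (by linarith [abs_nonneg x])

theorem growth_of_le_const {f : ℝ → ℝ} {C : ℝ} (h : ∀ x, |f x| ≤ C) (x : ℝ) :
    |f x| ≤ C * (1 + |x|) ^ 4 :=
  (h x).trans (le_mul_of_one_le_right ((abs_nonneg _).trans (h x)) (one_le_one_add_abs_pow x 4))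

theorem hasDerivAt_tanh_sq (x : ℝ) : HasDerivAt (fun x => Real.tanh x ^ 2)
    (2 * Real.tanh x * (1 - Real.tanh x ^ 2)) x := by
  refine ((hasDerivAt_tanh' x).pow 2).congr_deriv ?_
  push_cast
  ring

theorem abs_tanh_sq_le (x : ℝ) : |Real.tanh x ^ 2| ≤ 1 * (1 + |x|) ^ 4 :=
  growth_of_le_const (f := fun x => Real.tanh x ^ 2)
    (fun x => by rw [abs_of_nonneg (sq_nonneg _)]; exact tanh_sq_le_one x) x

theorem abs_tanh_sq_deriv_le (x : ℝ) :
    |2 * Real.tanh x * (1 - Real.tanh x ^ 2)| ≤ 2 * (1 + |x|) ^ 4 :=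
  growth_of_le_const (f := fun x => 2 * Real.tanh x * (1 - Real.tanh x ^ 2)) (fun x => by
    have h1 := tanh_sq_le_one x
    rw [abs_mul, abs_mul, abs_of_nonneg (show 0 ≤ 1 - Real.tanh x ^ 2 by linarith), abs_two]
    nlinarith [abs_tanh_le_one x, sq_nonneg (Real.tanh x), abs_nonneg (Real.tanh x)]) x

theorem hasDerivAt_avgTanhSq (s : ℝ) : HasDerivAt avgTanhSq (avgTanhSq' s) s :=
  hasDerivAt_integral_comp_mul_gaussDensity hasDerivAt_tanh_sq
    (by have := continuous_tanh'; fun_prop) abs_tanh_sq_le abs_tanh_sq_deriv_le s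

theorem integrable_tanh_sq (s : ℝ) :
    Integrable fun z => Real.tanh (s * z) ^ 2 * gaussDensity z :=
  integrable_comp_mul_gaussDensity (continuous_tanh'.pow 2) abs_tanh_sq_le s

theorem abs_avgTanhSq'_sub_le {s t : ℝ} (hs : |s| ≤ 7 / 4) (ht : |t| ≤ 7 / 4) :
    |avgTanhSq' s - avgTanhSq' t| ≤ 1e6 * |s - t| := by
  have h := abs_integral_id_mul_comp_sub_le (B := 7 / 4) (C' := 4)
    (f := fun x => 2 * Real.tanh x * (1 - Real.tanh x ^ 2))
    (f' := fun x => 2 * (1 - Real.tanh x ^ 2) * (1 - 3 * Real.tanh x ^ 2))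
    (fun x => by
      refine (((hasDerivAt_tanh' x).const_mul 2).mul
        ((hasDerivAt_tanh_sq x).const_sub 1)).congr_deriv ?_
      ring)
    abs_tanh_sq_deriv_le
    (growth_of_le_const fun x => by
      have h1 := tanh_sq_le_one x
      have h2 := sq_nonneg (Real.tanh x)
      rw [abs_le]
      constructor <;> nlinarith)
    (by norm_num) hs ht
  refine h.trans ?_
  gcongr
  norm_num

theorem hasDerivAt_log_cosh (x : ℝ) :
    HasDerivAt (fun x => Real.log (2 * Real.cosh x)) (Real.tanh x) x := by
  have h := ((Real.hasDerivAt_cosh x).const_mul 2).log (by have := Real.cosh_pos x; positivity)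
  refine h.congr_deriv ?_
  rw [Real.tanh_eq_sinh_div_cosh]
  have := (Real.cosh_pos x).ne'
  field_simp

theorem abs_log_cosh_le (x : ℝ) : |Real.log (2 * Real.cosh x)| ≤ 1 * (1 + |x|) ^ 4 := by
  have h1 := Real.one_le_cosh x
  rw [abs_of_nonneg (Real.log_nonneg (by linarith)), one_mul]
  have h2 : Real.cosh x ≤ Real.exp |x| := by
    rw [Real.cosh_eq]
    have := Real.exp_le_exp.2 (le_abs_self x)
    have := Real.exp_le_exp.2 (neg_le_abs x)
    linarith
  rw [Real.log_mul (by norm_num) (by linarith)]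
  have h3 := Real.log_le_log (by linarith) h2
  rw [Real.log_exp] at h3
  have h4 := Real.log_two_lt_d9
  have h5 : 1 + |x| ≤ (1 + |x|) ^ 4 := le_self_pow₀ (by linarith [abs_nonneg x]) (by norm_num)
  linarith

theorem continuous_log_cosh : Continuous fun x => Real.log (2 * Real.cosh x) :=
  continuous_iff_continuousAt.2 fun x => (hasDerivAt_log_cosh x).continuousAt

theorem integrable_log_cosh (s : ℝ) :
    Integrable fun z => Real.log (2 * Real.cosh (s * z)) * gaussDensity z :=
  integrable_comp_mul_gaussDensity continuous_log_cosh abs_log_cosh_le s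

/-- Integration by parts turns `∫ z tanh(sz) φ(z) dz` into `s (1 - ∫ tanh(sz)² φ(z) dz)`. -/
theorem hasDerivAt_avgLogCosh (s : ℝ) : HasDerivAt avgLogCosh (s * (1 - avgTanhSq s)) s := by
  have ht := continuous_tanh'
  refine (hasDerivAt_integral_comp_mul_gaussDensity hasDerivAt_log_cosh ht abs_log_cosh_le
    (growth_of_le_const abs_tanh_le_one) s).congr_deriv ?_
  rw [integral_id_mul_gaussDensity (g := fun z => Real.tanh (s * z)) (C := 1) (C' := |s| * 1)
    (g' := fun z => s * (1 - Real.tanh (s * z) ^ 2))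
    (fun x => by
      refine ((hasDerivAt_tanh' (s * x)).comp x ((hasDerivAt_id x).const_mul s)).congr_deriv ?_
      simp only [mul_one]
      ring) (by fun_prop)
    (growth_of_le_const fun x => abs_tanh_le_one _)
    (growth_of_le_const fun x => by
      have h1 := tanh_sq_le_one (s * x)
      rw [abs_mul, abs_of_nonneg (show 0 ≤ 1 - Real.tanh (s * x) ^ 2 by linarith)]
      gcongr
      linarith [sq_nonneg (Real.tanh (s * x))])]
  rw [avgTanhSq]
  conv_rhs => rw [← integral_gaussDensity]
  rw [← integral_sub integrable_gaussDensity (integrable_tanh_sq s), ← integral_const_mul]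
  congr 1
  ext z
  ring

theorem millsE_sub_nonneg (x : ℝ) : 0 ≤ millsE x - x := by linarith [le_millsE x]

theorem millsE_sub_le (x : ℝ) : millsE x - x ≤ 2 * (1 + |x|) := by
  linarith [millsE_le x, neg_abs_le x, abs_nonneg x]

theorem hasDerivAt_millsE_sq (x : ℝ) : HasDerivAt (fun x => millsE x ^ 2)
    (2 * millsE x ^ 2 * (millsE x - x)) x := by
  refine ((hasDerivAt_millsE x).pow 2).congr_deriv ?_
  push_cast
  ring

theorem abs_millsE_le (x : ℝ) : |millsE x| ≤ 1 * (1 + |x|) ^ 4 := by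
  rw [abs_of_pos (millsE_pos x), one_mul]
  exact (millsE_le x).trans (le_self_pow₀ (by linarith [abs_nonneg x]) (by norm_num))

theorem abs_millsE_sq_le (x : ℝ) : |millsE x ^ 2| ≤ 1 * (1 + |x|) ^ 4 := by
  have h := millsE_pos x
  rw [abs_of_nonneg (by positivity), one_mul]
  calc millsE x ^ 2 ≤ (1 + |x|) ^ 2 := by
        gcongr
        exact millsE_le x
    _ ≤ _ := pow_le_pow_right₀ (by linarith [abs_nonneg x]) (by norm_num)

theorem abs_millsE_sq_deriv_le (x : ℝ) :
    |2 * millsE x ^ 2 * (millsE x - x)| ≤ 4 * (1 + |x|) ^ 4 := by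
  have h := millsE_pos x
  have h1 := millsE_sub_nonneg x
  rw [abs_of_nonneg (by positivity)]
  calc 2 * millsE x ^ 2 * (millsE x - x) ≤ 2 * (1 + |x|) ^ 2 * (2 * (1 + |x|)) := by
        gcongr
        · exact millsE_le x
        · exact millsE_sub_le x
    _ = 4 * (1 + |x|) ^ 3 := by ring
    _ ≤ _ := by
        gcongr
        · linarith [abs_nonneg x]
        · norm_num

theorem hasDerivAt_avgMillsSq (g : ℝ) : HasDerivAt avgMillsSq (avgMillsSq' g) g :=
  hasDerivAt_integral_comp_mul_gaussDensity hasDerivAt_millsE_sq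
    (by have := continuous_millsE; fun_prop) abs_millsE_sq_le abs_millsE_sq_deriv_le g

theorem integrable_millsE_sq (g : ℝ) :
    Integrable fun z => millsE (g * z) ^ 2 * gaussDensity z :=
  integrable_comp_mul_gaussDensity (continuous_millsE.pow 2) abs_millsE_sq_le g

theorem abs_avgMillsSq'_sub_le {s t : ℝ} (hs : |s| ≤ 5 / 4) (ht : |t| ≤ 5 / 4) :
    |avgMillsSq' s - avgMillsSq' t| ≤ 2e6 * |s - t| := by
  have h := abs_integral_id_mul_comp_sub_le (B := 5 / 4) (C' := 26)
    (f := fun x => 2 * millsE x ^ 2 * (millsE x - x))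
    (f' := fun x => 4 * millsE x ^ 2 * (millsE x - x) ^ 2
      + 2 * millsE x ^ 2 * (millsE x * (millsE x - x) - 1))
    (fun x => by
      have h1 : HasDerivAt (fun x => millsE x - x) (millsE x * (millsE x - x) - 1) x :=
        (hasDerivAt_millsE x).sub (hasDerivAt_id x)
      refine (((hasDerivAt_millsE_sq x).const_mul 2).mul h1).congr_deriv ?_
      ring)
    abs_millsE_sq_deriv_le
    (fun x => by
      have h := millsE_pos x
      have h1 := millsE_sub_nonneg x
      have h2 := millsE_le x
      have h3 := millsE_sub_le x
      set u := 1 + |x| with hu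
      have hu1 : 1 ≤ u := by linarith [abs_nonneg x]
      have a1 : millsE x ^ 2 ≤ u ^ 2 := by gcongr
      have a2 : (millsE x - x) ^ 2 ≤ 4 * u ^ 2 := by
        calc _ ≤ (2 * u) ^ 2 := by gcongr
          _ = _ := by ring
      have a3 : millsE x * (millsE x - x) ≤ 2 * u ^ 2 := by
        calc _ ≤ u * (2 * u) := by gcongr
          _ = _ := by ring
      have a4 : 1 ≤ u ^ 2 := one_le_pow₀ hu1
      have a5 : |millsE x * (millsE x - x) - 1| ≤ 3 * u ^ 2 := by
        rw [abs_le]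
        constructor
        · have := mul_nonneg h.le h1
          linarith
        · linarith
      refine (abs_add_le _ _).trans ?_
      rw [abs_of_nonneg (show 0 ≤ 4 * millsE x ^ 2 * (millsE x - x) ^ 2 by positivity), abs_mul,
        abs_of_nonneg (show 0 ≤ 2 * millsE x ^ 2 by positivity)]
      calc _ ≤ 4 * u ^ 2 * (4 * u ^ 2) + 2 * u ^ 2 * (3 * u ^ 2) := by gcongr
        _ = 22 * u ^ 4 := by ring
        _ ≤ 26 * u ^ 4 := by gcongr; norm_num)
    (by norm_num) hs ht
  refine h.trans ?_
  gcongr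
  norm_num

theorem continuous_log_gaussTail : Continuous fun x => Real.log (gaussTail x) :=
  continuous_iff_continuousAt.2 fun x => (hasDerivAt_log_gaussTail x).continuousAt

theorem abs_log_gaussTail_le_pow (x : ℝ) : |Real.log (gaussTail x)| ≤ 1 * (1 + |x|) ^ 4 := by
  have h := abs_log_gaussTail_le x
  have h1 : (1 + |x|) ^ 2 ≤ (1 + |x|) ^ 4 :=
    pow_le_pow_right₀ (by linarith [abs_nonneg x]) (by norm_num)
  nlinarith [sq_abs x, abs_nonneg x]

theorem integrable_log_gaussTail (g : ℝ) :
    Integrable fun z => Real.log (gaussTail (g * z)) * gaussDensity z :=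
  integrable_comp_mul_gaussDensity continuous_log_gaussTail abs_log_gaussTail_le_pow g

/-- Integration by parts and `𝓔' = 𝓔 (𝓔 - x)` give
`(1 + g²) ∫ z 𝓔(gz) φ(z) dz = g ∫ 𝓔(gz)² φ(z) dz`. -/
theorem hasDerivAt_avgLogTail (g : ℝ) :
    HasDerivAt avgLogTail (-(g / (1 + g ^ 2) * avgMillsSq g)) g := by
  have hc := continuous_millsE
  have hneg : ∀ x, |-millsE x| ≤ 1 * (1 + |x|) ^ 4 := fun x => by
    rw [abs_neg]
    exact abs_millsE_le x
  refine (hasDerivAt_integral_comp_mul_gaussDensity hasDerivAt_log_gaussTail hc.neg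
    abs_log_gaussTail_le_pow hneg g).congr_deriv ?_
  have e1 : ∫ z, z * -millsE (g * z) * gaussDensity z
      = -∫ z, z * millsE (g * z) * gaussDensity z := by
    rw [← integral_neg]
    congr 1
    ext z
    ring
  have hgrowth : ∀ x, |millsE x * (millsE x - x)| ≤ 2 * (1 + |x|) ^ 4 := fun x => by
    have h := millsE_pos x
    have h1 := millsE_sub_nonneg x
    rw [abs_of_nonneg (by positivity)]
    calc millsE x * (millsE x - x) ≤ (1 + |x|) * (2 * (1 + |x|)) := by
          gcongr
          · exact millsE_le x
          · exact millsE_sub_le x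
      _ = 2 * (1 + |x|) ^ 2 := by ring
      _ ≤ _ := by
          gcongr
          · linarith [abs_nonneg x]
          · norm_num
  have e2 : ∫ z, z * millsE (g * z) * gaussDensity z
      = g * (avgMillsSq g - g * ∫ z, z * millsE (g * z) * gaussDensity z) := by
    conv_lhs => rw [integral_id_mul_gaussDensity (g := fun z => millsE (g * z))
      (g' := fun z => g * (millsE (g * z) * (millsE (g * z) - g * z)))
      (C := 1 * (1 + |g|) ^ 4) (C' := |g| * (2 * (1 + |g|) ^ 4))
      (fun x => by
        refine ((hasDerivAt_millsE (g * x)).comp x ((hasDerivAt_id x).const_mul g)).congr_deriv ?_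
        simp only [mul_one]
        ring) (by fun_prop)
      (growth_comp_mul abs_millsE_le (by linarith [abs_nonneg g]) (by linarith))
      (fun x => by
        rw [abs_mul, mul_assoc]
        gcongr
        exact growth_comp_mul hgrowth (by linarith [abs_nonneg g]) (by linarith) x)]
    rw [avgMillsSq, ← integral_const_mul, ← integral_sub (integrable_millsE_sq g)
      ((integrable_id_mul_comp_mul_gaussDensity hc abs_millsE_le g).const_mul g),
      ← integral_const_mul]
    congr 1
    ext z
    ring
  rw [e1]
  generalize ∫ z, z * millsE (g * z) * gaussDensity z = m at e2 ⊢
  have : (1 + g ^ 2) ≠ 0 := by positivity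
  field_simp
  linear_combination -e2

/-! ### Logarithm-free forms of the two entropy integrals -/

theorem integrable_mul_gaussTail {f : ℝ → ℝ} {C : ℝ} (hf : Continuous f)
    (h1 : ∀ z, 0 ≤ z → |f z| ≤ C * (1 + |z|) ^ 6)
    (h2 : ∀ z, z ≤ 0 → |f z| ≤ C * (1 + z ^ 2)⁻¹) : Integrable fun z => f z * gaussTail z := by
  have h0 : 0 ≤ C := by simpa using (abs_nonneg _).trans (h1 0 le_rfl)
  refine (((integrable_one_add_abs_pow_six.const_mul (2 * C)).add
    (integrable_inv_one_add_sq.const_mul C))).mono'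
    (by have := continuous_gaussTail; fun_prop) (ae_of_all _ fun z => ?_)
  have hφ := gaussDensity_pos z
  have hT := gaussTail_pos z
  rw [norm_mul, Real.norm_eq_abs, Real.norm_of_nonneg hT.le, Pi.add_apply]
  have a1 : 0 ≤ 2 * C * ((1 + |z|) ^ 6 * gaussDensity z) := by positivity
  have a2 : 0 ≤ C * (1 + z ^ 2)⁻¹ := by positivity
  rcases le_total 0 z with hz | hz
  · calc |f z| * gaussTail z ≤ C * (1 + |z|) ^ 6 * (2 * gaussDensity z) := by
          gcongr
          · exact h1 z hz
          · exact gaussTail_le_two_mul_gaussDensity hz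
      _ = 2 * C * ((1 + |z|) ^ 6 * gaussDensity z) := by ring
      _ ≤ _ := by linarith
  · calc |f z| * gaussTail z ≤ C * (1 + z ^ 2)⁻¹ * 1 := by
          gcongr
          · exact h2 z hz
          · exact (gaussTail_lt_one z).le
      _ ≤ _ := by linarith

/-- Integration by parts with `φ = -Φ̄'`. -/
theorem integral_mul_gaussDensity_eq {u u' : ℝ → ℝ} (hu : ∀ x, HasDerivAt u (u' x) x)
    (h1 : Integrable fun z => u z * gaussDensity z) (h2 : Integrable fun z => u' z * gaussTail z)
    (h3 : Integrable fun z => u z * gaussTail z) :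
    ∫ z, u z * gaussDensity z = ∫ z, u' z * gaussTail z := by
  have h := integral_mul_deriv_eq_deriv_mul_of_integrable (u := u) (u' := u')
    (v := gaussTail) (v' := fun x => -gaussDensity x) (fun x _ => hu x)
    (fun x _ => hasDerivAt_gaussTail x)
    (h1.neg.congr (ae_of_all _ fun z => by simp)) h2 h3
  rw [← neg_neg (∫ z, u' z * gaussTail z), ← h, ← integral_neg]
  congr 1
  ext z
  ring

/-- The logistic function `1 / (1 + exp (-2x))`. -/
noncomputable def logistic (x : ℝ) : ℝ := (1 + Real.exp (-(2 * x)))⁻¹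

theorem logistic_pos (x : ℝ) : 0 < logistic x := by
  unfold logistic
  positivity

theorem logistic_le_one (x : ℝ) : logistic x ≤ 1 :=
  inv_le_one_of_one_le₀ (by linarith [Real.exp_pos (-(2 * x))])

theorem logistic_le_exp (x : ℝ) : logistic x ≤ Real.exp (2 * x) := by
  unfold logistic
  rw [← neg_neg (2 * x), Real.exp_neg (-(2 * x)), neg_neg]
  gcongr
  linarith

theorem continuous_logistic : Continuous logistic := by
  unfold logistic
  exact Continuous.inv₀ (by fun_prop) fun x => by positivity

theorem exp_two_mul_le_inv {s z : ℝ} (hs : 1 ≤ s) (hz : z ≤ 0) :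
    Real.exp (2 * (s * z)) ≤ (1 + z ^ 2)⁻¹ := by
  rw [← neg_neg (2 * (s * z)), Real.exp_neg]
  gcongr
  have h6 : -z ≤ s * -z := le_mul_of_one_le_left (by linarith) hs
  have h7 := Real.quadratic_le_exp_of_nonneg (show 0 ≤ -(2 * (s * z)) by nlinarith)
  nlinarith

theorem hasDerivAt_log_one_add_exp (s z : ℝ) :
    HasDerivAt (fun z => Real.log (1 + Real.exp (2 * (s * z)))) (2 * s * logistic (s * z)) z := by
  have h1 : HasDerivAt (fun z : ℝ => 2 * (s * z)) (2 * s) z :=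
    (((hasDerivAt_id z).const_mul s).const_mul 2).congr_deriv (by ring)
  refine ((h1.exp.const_add 1).log (by positivity)).congr_deriv ?_
  unfold logistic
  rw [Real.exp_neg]
  have := Real.exp_pos (2 * (s * z))
  field_simp
  ring

theorem log_two_cosh_eq (x : ℝ) :
    Real.log (2 * Real.cosh x) = Real.log (1 + Real.exp (2 * x)) - x := by
  have h : 2 * Real.cosh x = (1 + Real.exp (2 * x)) * Real.exp (-x) := by
    rw [Real.cosh_eq, add_mul, ← Real.exp_add, show 2 * x + -x = x by ring]
    ring
  rw [h, Real.log_mul (by positivity) (Real.exp_pos _).ne', Real.log_exp]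
  ring

theorem abs_log_one_add_exp_le (x : ℝ) :
    |Real.log (1 + Real.exp (2 * x))| ≤ 2 * (1 + |x|) ^ 4 := by
  have h1 := abs_log_cosh_le x
  have h2 : Real.log (1 + Real.exp (2 * x)) = Real.log (2 * Real.cosh x) + x := by
    rw [log_two_cosh_eq]
    ring
  have h3 : 1 + |x| ≤ (1 + |x|) ^ 4 := le_self_pow₀ (by linarith [abs_nonneg x]) (by norm_num)
  rw [h2]
  refine (abs_add_le _ _).trans ?_
  linarith

theorem integral_id_mul_gaussDensity_eq_zero : ∫ z, z * gaussDensity z = 0 := by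
  have h := integral_id_mul_gaussDensity (g := fun _ => 1) (g' := fun _ => 0) (C := 1) (C' := 0)
    (fun x => hasDerivAt_const x 1) continuous_const
    (growth_of_le_const fun _ => by simp) (fun _ => by simp)
  simpa using h

theorem integrable_id_mul_gaussDensity : Integrable fun z => z * gaussDensity z := by
  simpa using integrable_id_mul_comp_mul_gaussDensity (f := fun _ => 1) (C := 1) continuous_const
    (growth_of_le_const fun _ => by simp) 1

/-- Since `log(2 cosh x) = log(1 + exp(2x)) - x` and the second term is odd, integration by parts
removes the logarithm. -/
theorem avgLogCosh_eq {s : ℝ} (hs : 1 ≤ s) :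
    avgLogCosh s = ∫ z, 2 * s * (logistic (s * z) * gaussTail z) := by
  have hcs := continuous_logistic
  have hcl : Continuous fun x : ℝ => Real.log (1 + Real.exp (2 * x)) :=
    Continuous.log (by fun_prop) fun x =>
      (add_pos one_pos (Real.exp_pos (2 * x))).ne'
  have hI1 := integrable_comp_mul_gaussDensity hcl abs_log_one_add_exp_le s
  have e1 : avgLogCosh s = ∫ z, Real.log (1 + Real.exp (2 * (s * z))) * gaussDensity z := by
    unfold avgLogCosh
    have h := integral_sub hI1 (integrable_id_mul_gaussDensity.const_mul s)
    rw [integral_const_mul, integral_id_mul_gaussDensity_eq_zero, mul_zero, sub_zero] at h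
    rw [← h]
    congr 1
    ext z
    rw [log_two_cosh_eq]
    ring
  rw [e1, integral_mul_gaussDensity_eq (hasDerivAt_log_one_add_exp s) hI1]
  · simp_rw [mul_assoc]
  · refine integrable_mul_gaussTail (C := 2 * s) (by fun_prop) (fun z _ => ?_) (fun z hz => ?_)
    · rw [abs_of_nonneg (mul_nonneg (by linarith) (logistic_pos _).le)]
      gcongr
      exact (logistic_le_one _).trans (one_le_one_add_abs_pow z 6)
    · rw [abs_of_nonneg (mul_nonneg (by linarith) (logistic_pos _).le)]
      gcongr
      exact (logistic_le_exp _).trans (exp_two_mul_le_inv hs hz)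
  · refine integrable_mul_gaussTail (C := 2 * (1 + |s|) ^ 4)
      (hcl.comp (continuous_const.mul continuous_id)) (fun z _ => ?_) (fun z hz => ?_)
    · refine (growth_comp_mul (B := 1 + |s|) abs_log_one_add_exp_le
        (by linarith [abs_nonneg s]) (by linarith) z).trans ?_
      gcongr
      · linarith [abs_nonneg z]
      · norm_num
    · rw [abs_of_nonneg (Real.log_nonneg (by linarith [Real.exp_pos (2 * (s * z))]))]
      have h1 := Real.log_le_sub_one_of_pos
        (show 0 < 1 + Real.exp (2 * (s * z)) by positivity)
      have h2 := exp_two_mul_le_inv hs hz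
      have h3 : (1 : ℝ) ≤ 2 * (1 + |s|) ^ 4 := by linarith [one_le_one_add_abs_pow s 4]
      have h4 : 0 < (1 + z ^ 2)⁻¹ := by positivity
      nlinarith

theorem millsE_mul_le {g z : ℝ} (hg : 1 ≤ g) (hz : z ≤ 0) :
    millsE (g * z) ≤ 2 * gaussDensity z := by
  have h1 := half_le_gaussTail (mul_nonpos_of_nonneg_of_nonpos (by linarith : 0 ≤ g) hz)
  have h2 : gaussDensity (g * z) ≤ gaussDensity z := by
    apply gaussDensity_le_of_sq_le
    rw [mul_pow]
    exact le_mul_of_one_le_left (sq_nonneg _) (one_le_pow₀ hg)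
  have h3 := gaussDensity_pos z
  unfold millsE
  rw [div_le_iff₀ (gaussTail_pos _)]
  nlinarith

theorem gaussDensity_le_inv (z : ℝ) : gaussDensity z ≤ 8 * (1 + z ^ 2)⁻¹ := by
  apply le_mul_inv_one_add_sq
  have h := one_add_sq_sq_mul_gaussDensity_le z
  have h2 := gaussDensity_pos z
  nlinarith [sq_nonneg z, mul_nonneg h2.le (sq_nonneg z), mul_nonneg h2.le (sq_nonneg (z ^ 2))]

theorem abs_log_gaussTail_mul_le {g z : ℝ} (hg : 1 ≤ g) (hz : z ≤ 0) :
    |Real.log (gaussTail (g * z))| ≤ 4 * gaussDensity z := by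
  have h0 : g * z ≤ 0 := mul_nonpos_of_nonneg_of_nonpos (by linarith) hz
  have h1 := half_le_gaussTail h0
  have h2 := gaussTail_neg (g * z)
  have h3 := gaussTail_le_two_mul_gaussDensity (neg_nonneg.2 h0)
  have h4 : gaussDensity (-(g * z)) ≤ gaussDensity z := by
    apply gaussDensity_le_of_sq_le
    rw [neg_sq, mul_pow]
    exact le_mul_of_one_le_left (sq_nonneg _) (one_le_pow₀ hg)
  rw [abs_of_nonpos (Real.log_nonpos (gaussTail_pos _).le (gaussTail_lt_one _).le)]
  have h5 := Real.one_sub_inv_le_log_of_pos (gaussTail_pos (g * z))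
  have h6 : (gaussTail (g * z))⁻¹ ≤ 1 + 2 * (1 - gaussTail (g * z)) := by
    rw [inv_le_iff_one_le_mul₀ (gaussTail_pos _)]
    nlinarith [gaussTail_lt_one (g * z)]
  linarith

/-- Integration by parts removes the logarithm because `(log Φ̄)' = -𝓔`. -/
theorem avgLogTail_eq {g : ℝ} (hg : 1 ≤ g) :
    avgLogTail g = -∫ z, g * (millsE (g * z) * gaussTail z) := by
  have hcm := continuous_millsE
  have hcl := continuous_log_gaussTail
  have hd : ∀ z, HasDerivAt (fun z => Real.log (gaussTail (g * z))) (-(g * millsE (g * z))) z := by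
    intro z
    refine ((hasDerivAt_log_gaussTail (g * z)).comp z
      ((hasDerivAt_id z).const_mul g)).congr_deriv ?_
    ring
  have h6 : ∀ z : ℝ, 1 + |z| ≤ (1 + |z|) ^ 6 := fun z =>
    le_self_pow₀ (by linarith [abs_nonneg z]) (by norm_num)
  unfold avgLogTail
  rw [integral_mul_gaussDensity_eq hd (integrable_log_gaussTail g), ← integral_neg]
  · congr 1
    ext z
    ring
  · refine integrable_mul_gaussTail (C := 16 * g ^ 2) (by fun_prop) (fun z hz => ?_)
      (fun z hz => ?_)
    · rw [abs_neg, abs_mul, abs_of_pos (millsE_pos _), abs_of_nonneg (by linarith)]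
      have h1 := millsE_le (g * z)
      rw [abs_mul, abs_of_nonneg (show 0 ≤ g by linarith)] at h1
      have h2 : millsE (g * z) ≤ g * (1 + |z|) ^ 6 := by
        nlinarith [h6 z, abs_nonneg z]
      have h3 : 0 ≤ g ^ 2 * (1 + |z|) ^ 6 := by positivity
      calc g * millsE (g * z) ≤ g * (g * (1 + |z|) ^ 6) := by gcongr
        _ ≤ _ := by linarith
    · rw [abs_neg, abs_mul, abs_of_pos (millsE_pos _), abs_of_nonneg (by linarith)]
      have h1 := (millsE_mul_le hg hz).trans
        (mul_le_mul_of_nonneg_left (gaussDensity_le_inv z) zero_le_two)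
      have h3 : 0 < (1 + z ^ 2)⁻¹ := by positivity
      calc g * millsE (g * z) ≤ g * (2 * (8 * (1 + z ^ 2)⁻¹)) := by gcongr
        _ = 16 * g * (1 + z ^ 2)⁻¹ := by ring
        _ ≤ _ := by gcongr; nlinarith
  · refine integrable_mul_gaussTail (C := 32 * (1 + |g|) ^ 4)
      (hcl.comp (continuous_const.mul continuous_id)) (fun z _ => ?_)
      (fun z hz => ?_)
    · refine (growth_comp_mul (B := 1 + |g|) abs_log_gaussTail_le_pow
        (by linarith [abs_nonneg g]) (by linarith) z).trans ?_
      gcongr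
      · norm_num
      · linarith [abs_nonneg z]
      · norm_num
    · have h1 := (abs_log_gaussTail_mul_le hg hz).trans
        (mul_le_mul_of_nonneg_left (gaussDensity_le_inv z) zero_le_four)
      refine h1.trans ?_
      have h3 : 0 < (1 + z ^ 2)⁻¹ := by positivity
      nlinarith [one_le_one_add_abs_pow g 4]

/-! ### Truncated trapezoidal sums -/

/-- The trapezoidal sum of `F` with step `1/16` over `[-8, 8]`, folded at the origin. -/
noncomputable def trapSum (F : ℝ → ℝ) : ℝ :=
  F 0 + ∑ n ∈ Finset.range 128, (F ((n + 1 : ℕ) / 16) + F (-((n + 1 : ℕ) / 16)))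

/-- The error of the truncated trapezoidal sum: `1.2e-13` for the infinite sum and `T / 3` for the
terms outside `[-8, 8]`, which are dominated by a geometric series. -/
theorem abs_integral_sub_trapSum_le {F : ℝ → ℝ} {f : ℂ → ℂ} {T : ℝ}
    (hfF : ∀ x : ℝ, f x = F x)
    (hf : ∀ w : ℂ, |w.im| ≤ 2 / 5 → DifferentiableAt ℂ f w)
    (hC : ∀ w : ℂ, |w.im| ≤ 2 / 5 → ‖f w‖ ≤ 100 * (1 + w.re ^ 2)⁻¹)
    (hF0 : ∀ x, 0 ≤ F x)
    (hT : ∀ x, 8 ≤ x → F x + F (-x) ≤ T * Real.exp (-(3 * (x - 8)))) :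
    |(∫ x, F x) - 1 / 16 * trapSum F| ≤ 1.2e-13 + T / 3 := by
  have h1 := trapezoid_sixteenth hf hC
  have hFC : ∀ x : ℝ, F x ≤ 100 * (1 + x ^ 2)⁻¹ := by
    intro x
    have := hC x (by norm_num)
    rw [hfF, Complex.norm_real, Real.norm_of_nonneg (hF0 x)] at this
    simpa using this
  have e1 : ∑' n : ℤ, f ((1 / 16 : ℝ) * n) = ((∑' n : ℤ, F (n / 16) : ℝ) : ℂ) := by
    rw [Complex.ofReal_tsum]
    congr 1
    ext n
    rw [← hfF]
    congr 1
    push_cast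
    ring
  have e2 : ∫ x : ℝ, f x = ((∫ x, F x : ℝ) : ℂ) := by
    simp_rw [hfF]
    exact integral_complex_ofReal
  rw [e1, e2, ← Complex.ofReal_mul, ← Complex.ofReal_sub, Complex.norm_real,
    Real.norm_eq_abs] at h1
  set G : ℕ → ℝ := fun n => F ((n + 1 : ℕ) / 16) + F (-((n + 1 : ℕ) / 16)) with hG
  have hG0 : ∀ n, 0 ≤ G n := fun n => add_nonneg (hF0 _) (hF0 _)
  have hsq : Summable fun n : ℕ => (1 : ℝ) / ((n : ℝ) + 1) ^ 2 := by
    have := (summable_nat_add_iff 1).2 (Real.summable_one_div_nat_pow.2 one_lt_two)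
    simpa using this
  have hFn : ∀ n : ℕ, ∀ ε : ℝ, ε ^ 2 = 1 →
      F (ε * ((n + 1 : ℕ) / 16)) ≤ 25600 * (1 / ((n : ℝ) + 1) ^ 2) := by
    intro n ε hε
    refine (hFC _).trans ?_
    rw [mul_pow, hε, one_mul, ← div_eq_mul_inv, mul_one_div]
    rw [div_le_div_iff₀ (by positivity) (by positivity)]
    push_cast
    nlinarith [sq_nonneg ((n : ℝ) + 1)]
  have s1 : Summable fun n : ℕ => F ((n + 1 : ℕ) / 16) :=
    Summable.of_nonneg_of_le (fun n => hF0 _)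
      (fun n => by simpa using hFn n 1 (by norm_num)) (hsq.mul_left 25600)
  have s2 : Summable fun n : ℕ => F (-((n + 1 : ℕ) / 16)) :=
    Summable.of_nonneg_of_le (fun n => hF0 _)
      (fun n => by simpa using hFn n (-1) (by norm_num)) (hsq.mul_left 25600)
  have s0 : Summable fun n : ℕ => F ((n : ℕ) / 16) := (summable_nat_add_iff 1).1 s1
  have sG : Summable G := s1.add s2
  have e3 : ∑' n : ℤ, F (n / 16) = F 0 + ∑' n, G n := by
    have h := HasSum.of_nat_of_neg_add_one (f := fun n : ℤ => F (n / 16))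
      (m := ∑' n : ℕ, F ((n : ℕ) / 16)) (m' := ∑' n : ℕ, F (-((n + 1 : ℕ) / 16)))
      (by simpa using s0.hasSum)
      (by
        have := s2.hasSum
        convert this using 3 with n
        push_cast
        ring)
    rw [h.tsum_eq, s0.tsum_eq_zero_add, s1.tsum_add s2]
    simp only [Nat.cast_zero, zero_div]
    ring
  have e4 : ∑' n, G n = ∑ n ∈ Finset.range 128, G n + ∑' n, G (n + 128) :=
    (sG.sum_add_tsum_nat_add 128).symm
  set r := Real.exp (-(3 / 16)) with hr
  have hr1 : r < 1 := by
    rw [hr, Real.exp_lt_one_iff]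
    norm_num
  have hr0 : 0 < r := Real.exp_pos _
  have hT0 : 0 ≤ T := by
    have := (add_nonneg (hF0 8) (hF0 (-8))).trans (hT 8 le_rfl)
    simpa using this
  have hgeo : HasSum (fun n : ℕ => T * (r * r ^ n)) (T * (r * (1 - r)⁻¹)) :=
    ((hasSum_geometric_of_lt_one hr0.le hr1).mul_left r).mul_left T
  have hle : ∀ n, G (n + 128) ≤ T * (r * r ^ n) := by
    intro n
    have h8 : (8 : ℝ) ≤ ((n + 128 + 1 : ℕ) : ℝ) / 16 := by
      push_cast
      linarith [(Nat.cast_nonneg n : (0 : ℝ) ≤ n)]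
    refine (hT _ h8).trans (le_of_eq ?_)
    rw [hr, ← Real.exp_nat_mul, ← Real.exp_add]
    congr 2
    push_cast
    ring
  have t1 : 0 ≤ ∑' n, G (n + 128) := tsum_nonneg fun n => hG0 _
  have t2 : ∑' n, G (n + 128) ≤ T * (16 / 3) := by
    have h2 : ∑' n, G (n + 128) ≤ T * (r * (1 - r)⁻¹) := by
      rw [← hgeo.tsum_eq]
      exact ((summable_nat_add_iff 128).2 sG).tsum_le_tsum hle hgeo.summable
    refine h2.trans ?_
    gcongr
    rw [← div_eq_mul_inv, div_le_iff₀ (by linarith)]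
    -- `exp u - 1 ≥ u` at `u = 3/16`
    have h3 := Real.add_one_le_exp (3 / 16 : ℝ)
    have h4 : r * Real.exp (3 / 16) = 1 := by
      rw [hr, ← Real.exp_add]
      norm_num
    nlinarith
  have e5 : trapSum F = F 0 + ∑ n ∈ Finset.range 128, G n := rfl
  rw [e3, e4] at h1
  rw [e5]
  rw [abs_le] at h1 ⊢
  constructor <;> linarith [h1.1, h1.2]

theorem exp_neg_thirtytwo_le : Real.exp (-32) ≤ 1.3e-14 := by
  rw [show (-32 : ℝ) = -((32 : ℕ) * 1 : ℝ) by norm_num, Real.exp_neg, Real.exp_nat_mul]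
  have h3 : (2.718 : ℝ) ^ 32 ≤ Real.exp 1 ^ 32 := by
    have := Real.exp_one_gt_d9
    gcongr
    linarith
  refine inv_le_of_inv_le₀ (by norm_num) (le_trans ?_ h3)
  norm_num

/-- Convexity: `x² / 2` lies above its tangent line at `x = 8`. -/
theorem gaussDensity_le_exp {x : ℝ} :
    gaussDensity x ≤ 6.5e-15 * Real.exp (-(8 * (x - 8))) := by
  have h1 : Real.exp (-x ^ 2 / 2) ≤ Real.exp (-32) * Real.exp (-(8 * (x - 8))) := by
    rw [← Real.exp_add]
    gcongr
    nlinarith [sq_nonneg (x - 8)]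
  have h2 : 2 ≤ √(2 * Real.pi) := Real.le_sqrt_of_sq_le (by nlinarith [Real.pi_gt_three])
  have h3 := exp_neg_thirtytwo_le
  have h4 := Real.exp_pos (-(8 * (x - 8)))
  unfold gaussDensity
  rw [div_le_iff₀ (by positivity)]
  nlinarith

theorem tanh_eq_logistic (x : ℝ) : Real.tanh x = 2 * logistic x - 1 := by
  rw [Real.tanh_eq, logistic, show -(2 * x) = -x + -x by ring, Real.exp_add]
  have h : Real.exp x * Real.exp (-x) = 1 := by rw [← Real.exp_add]; simp
  have h1 := Real.exp_pos x
  have h2 := Real.exp_pos (-x)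
  field_simp
  have h3 : Real.exp x * Real.exp (-x) ^ 2 = Real.exp (-x) := by
    rw [pow_two, ← mul_assoc, h, one_mul]
  nlinarith

theorem cSigma_ofReal (x : ℝ) : cSigma x = logistic x := by
  unfold cSigma logistic
  push_cast
  rfl

section

variable {s g : ℝ}

theorem abs_avgTanhSq_sub_trapSum_le (hs : 1 ≤ s) (hs2 : s ≤ 7 / 4) :
    |avgTanhSq s - 1 / 16 * trapSum fun z => Real.tanh (s * z) ^ 2 * gaussDensity z|
      ≤ 1.3e-13 := by
  refine (abs_integral_sub_trapSum_le (f := cIntP s) (T := 1.3e-14) (fun x => ?_)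
    (fun w hw => differentiableAt_cIntP (by linarith) hs2 hw)
    (fun w hw => norm_cIntP_le (by linarith) hs2 hw)
    (fun x => ?_) (fun x hx => ?_)).trans (by norm_num)
  · rw [cIntP, ← Complex.ofReal_mul, cSigma_ofReal, cGauss_ofReal, tanh_eq_logistic]
    push_cast
    rfl
  · have := gaussDensity_pos x
    positivity
  · have h1 := gaussDensity_le_exp (x := x)
    have h2 := gaussDensity_pos x
    have h3 : Real.exp (-(8 * (x - 8))) ≤ Real.exp (-(3 * (x - 8))) := by
      gcongr
      linarith
    rw [gaussDensity_neg]
    nlinarith [tanh_sq_le_one (s * x), tanh_sq_le_one (s * -x)]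

theorem abs_avgLogCosh_sub_trapSum_le (hs : 1.605 ≤ s) (hs2 : s ≤ 7 / 4) :
    |avgLogCosh s - 1 / 16 * trapSum fun z => 2 * s * (logistic (s * z) * gaussTail z)|
      ≤ 1e-11 := by
  rw [avgLogCosh_eq (by linarith)]
  refine (abs_integral_sub_trapSum_le (f := cIntK s) (T := 2.9e-11) (fun x => ?_)
    (fun w hw => differentiableAt_cIntK (by linarith) hs2 hw)
    (fun w hw => norm_cIntK_le (by linarith) hs2 hw)
    (fun x => ?_) (fun x hx => ?_)).trans (by norm_num)
  · rw [cIntK, ← Complex.ofReal_mul, cSigma_ofReal, cTail_ofReal]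
    push_cast
    rfl
  · have := gaussTail_pos x
    have := logistic_pos (s * x)
    positivity
  · have h1 := gaussDensity_le_exp (x := x)
    have h2 := gaussTail_pos x
    have h3 : Real.exp (-(8 * (x - 8))) ≤ Real.exp (-(3 * (x - 8))) := by
      gcongr
      linarith
    have h4 := gaussTail_le_two_mul_gaussDensity (show 0 ≤ x by linarith)
    have h5 := gaussTail_lt_one (-x)
    have h6 := logistic_pos (s * -x)
    have h6' := logistic_pos (s * x)
    have h5' := gaussTail_pos (-x)
    have h7 : logistic (s * -x) ≤ 7.3e-12 * Real.exp (-(3 * (x - 8))) := by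
      refine (logistic_le_exp _).trans ?_
      -- `25.68 = 2 * 1.605 * 8`
      have h8 : Real.exp (-25.68) ≤ 7.3e-12 := by
        have h9 : Real.exp (-25.68) = Real.exp (-32) * Real.exp 6.32 := by
          rw [← Real.exp_add]
          norm_num
        have h10 : Real.exp 6.32 ≤ 556 := by
          have h11 : Real.exp 6.32 = Real.exp 1 ^ 6 * Real.exp 0.32 := by
            rw [← Real.exp_nat_mul, ← Real.exp_add]
            norm_num
          have h12 : Real.exp 1 ^ 6 ≤ 2.71829 ^ 6 := by
            have := Real.exp_one_lt_d9
            gcongr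
            linarith
          have h13 : Real.exp 0.32 ≤ 1.378 := by
            have := Real.exp_bound' (x := 0.32) (by norm_num) (by norm_num) (n := 5) (by norm_num)
            refine this.trans ?_
            norm_num [Finset.sum_range_succ, Nat.factorial]
          rw [h11]
          calc _ ≤ (2.71829 : ℝ) ^ 6 * 1.378 := by gcongr
            _ ≤ 556 := by norm_num
        rw [h9]
        calc _ ≤ 1.3e-14 * (556 : ℝ) := by
              gcongr
              exact exp_neg_thirtytwo_le
          _ ≤ _ := by norm_num
      calc Real.exp (2 * (s * -x)) ≤ Real.exp (-25.68 + -(3 * (x - 8))) := by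
            gcongr
            nlinarith
        _ = Real.exp (-25.68) * Real.exp (-(3 * (x - 8))) := Real.exp_add _ _
        _ ≤ _ := by gcongr
    set e := Real.exp (-(3 * (x - 8))) with he
    have he0 : 0 < e := Real.exp_pos _
    have k1 : logistic (s * x) * gaussTail x ≤ 1 * (1.3e-14 * e) := by
      gcongr
      · exact logistic_le_one _
      · nlinarith
    have k2 : logistic (s * -x) * gaussTail (-x) ≤ 7.3e-12 * e * 1 := by gcongr
    calc _ = 2 * s * (logistic (s * x) * gaussTail x + logistic (s * -x) * gaussTail (-x)) := by
          ring
      _ ≤ 2 * (7 / 4) * (1 * (1.3e-14 * e) + 7.3e-12 * e * 1) := by gcongr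
      _ ≤ _ := by nlinarith

theorem abs_avgMillsSq_sub_trapSum_le (hg : 1 ≤ g) (hg2 : g ≤ 5 / 4) :
    |avgMillsSq g - 1 / 16 * trapSum fun z => millsE (g * z) ^ 2 * gaussDensity z|
      ≤ 5e-13 := by
  refine (abs_integral_sub_trapSum_le (f := cIntA g) (T := 1e-12) (fun x => ?_)
    (fun w hw => differentiableAt_cIntA (by linarith) hg2 hw)
    (fun w hw => norm_cIntA_le hg hg2 hw)
    (fun x => ?_) (fun x hx => ?_)).trans (by norm_num)
  · rw [cIntA, ← Complex.ofReal_mul, cMills_ofReal, cGauss_ofReal]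
    push_cast
    rw [inv_inv]
  · have := gaussDensity_pos x
    positivity
  · have h1 := gaussDensity_le_exp (x := x)
    have h2 := gaussDensity_pos x
    have h3 := millsE_le (g * x)
    have h4 := millsE_mul_le hg (show -x ≤ 0 by linarith)
    have h5 := gaussDensity_le_half (-x)
    have h6 := millsE_pos (g * x)
    have h7 := millsE_pos (g * -x)
    rw [abs_of_nonneg (mul_nonneg (by linarith) (by linarith))] at h3
    have h8 : millsE (g * x) ≤ 11 * (1 + (x - 8) / 2) := by nlinarith
    have h9 : millsE (g * x) ^ 2 + millsE (g * -x) ^ 2 ≤ 122 * Real.exp (5 * (x - 8)) := by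
      have k1 := Real.add_one_le_exp (5 / 2 * (x - 8))
      have k2 : Real.exp (5 * (x - 8)) = Real.exp (5 / 2 * (x - 8)) ^ 2 := by
        rw [← Real.exp_nat_mul]
        congr 1
        push_cast
        ring
      have k3 : millsE (g * x) ^ 2 ≤ (11 * Real.exp (5 / 2 * (x - 8))) ^ 2 := by
        gcongr
        linarith
      have k4 : millsE (g * -x) ^ 2 ≤ 1 := by nlinarith
      have k5 : 1 ≤ Real.exp (5 * (x - 8)) := Real.one_le_exp (by linarith)
      rw [k2] at k5 ⊢
      nlinarith
    rw [gaussDensity_neg, ← add_mul]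
    calc _ ≤ 122 * Real.exp (5 * (x - 8)) * (6.5e-15 * Real.exp (-(8 * (x - 8)))) := by gcongr
      _ = 122 * 6.5e-15 * Real.exp (-(3 * (x - 8))) := by
          rw [show -(3 * (x - 8)) = 5 * (x - 8) + -(8 * (x - 8)) by ring, Real.exp_add]
          ring
      _ ≤ _ := by gcongr; norm_num

theorem abs_avgLogTail_sub_trapSum_le (hg : 1 ≤ g) (hg2 : g ≤ 5 / 4) :
    |avgLogTail g + 1 / 16 * trapSum fun z => g * (millsE (g * z) * gaussTail z)|
      ≤ 5e-13 := by
  rw [avgLogTail_eq hg, neg_add_eq_sub, abs_sub_comm]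
  refine (abs_integral_sub_trapSum_le (f := cIntL g) (T := 1e-12) (fun x => ?_)
    (fun w hw => differentiableAt_cIntL (by linarith) hg2 hw)
    (fun w hw => norm_cIntL_le hg hg2 hw)
    (fun x => ?_) (fun x hx => ?_)).trans (by norm_num)
  · rw [cIntL, ← Complex.ofReal_mul, cMills_ofReal, cTail_ofReal]
    push_cast
    rw [inv_inv]
  · have := gaussTail_pos x
    have := millsE_pos (g * x)
    positivity
  · have h1 := gaussDensity_le_exp (x := x)
    have h2 := gaussTail_pos x
    have h3 := millsE_le (g * x)
    have h4 := millsE_mul_le hg (show -x ≤ 0 by linarith)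
    rw [gaussDensity_neg] at h4
    have h5 := gaussTail_lt_one (-x)
    have h6 := millsE_pos (g * x)
    have h7 := millsE_pos (g * -x)
    have h5' := gaussTail_pos (-x)
    have h8 := gaussTail_le_two_mul_gaussDensity (show 0 ≤ x by linarith)
    rw [abs_of_nonneg (mul_nonneg (by linarith) (by linarith))] at h3
    have h9 : millsE (g * x) ≤ 11 * Real.exp (5 * (x - 8)) := by
      have := Real.add_one_le_exp (5 * (x - 8))
      nlinarith
    have h10 := gaussDensity_pos x
    have e1 : Real.exp (-(3 * (x - 8))) = Real.exp (5 * (x - 8)) * Real.exp (-(8 * (x - 8))) := by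
      rw [← Real.exp_add]
      congr 1
      ring
    have h11 : Real.exp (-(8 * (x - 8))) ≤ Real.exp (-(3 * (x - 8))) := by
      gcongr
      linarith
    have k1 : millsE (g * x) * gaussTail x ≤ 22 * 6.5e-15 * Real.exp (-(3 * (x - 8))) := by
      calc _ ≤ 11 * Real.exp (5 * (x - 8)) * (2 * (6.5e-15 * Real.exp (-(8 * (x - 8))))) := by
            gcongr
            exact h8.trans (by gcongr)
        _ = _ := by rw [e1]; ring
    have k2 : millsE (g * -x) * gaussTail (-x) ≤ 2 * 6.5e-15 * Real.exp (-(3 * (x - 8))) := by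
      calc _ ≤ (2 * gaussDensity x) * 1 := by gcongr
        _ ≤ _ := by linarith
    have h12 := Real.exp_pos (-(3 * (x - 8)))
    calc _ = g * (millsE (g * x) * gaussTail x + millsE (g * -x) * gaussTail (-x)) := by ring
      _ ≤ 5 / 4 * (22 * 6.5e-15 * Real.exp (-(3 * (x - 8)))
          + 2 * 6.5e-15 * Real.exp (-(3 * (x - 8)))) := by gcongr
      _ ≤ _ := by nlinarith

end

/-! ### Interval arithmetic on natural numbers -/

namespace FixedPoint

/-- The scale: the natural number `m` stands for the real number `m / scale`. -/
def scale : ℕ := 1461501637330902918203684832716283019655932542976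

/-- An interval of nonnegative reals, with end points in units of `1 / scale`. -/
structure Ival where
  /-- lower end point -/
  lo : ℕ
  /-- upper end point -/
  hi : ℕ

/-- `I.Has x`: the real number `x` lies in the interval `I`. -/
def Ival.Has (I : Ival) (x : ℝ) : Prop := (I.lo : ℝ) ≤ x * scale ∧ x * scale ≤ I.hi

/-- Call-by-value: `force n k = k n`, but the recursor makes the kernel evaluate `n` to a literal
before `k` is applied. -/
noncomputable def force (n : ℕ) (k : ℕ → Bool) : Bool :=
  Nat.rec (k 0) (fun m _ => k (Nat.succ m)) n

theorem force_eq (n : ℕ) (k : ℕ → Bool) : force n k = k n := by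
  cases n <;> rfl

noncomputable section

/-- Pass the evaluated interval `[l, h]` to the continuation `k`. -/
def ret (l h : ℕ) (k : Ival → Bool) : Bool := force l fun l => force h fun h => k ⟨l, h⟩

/-- Sum of two intervals. -/
def addK (a b : Ival) (k : Ival → Bool) : Bool :=
  ret (Nat.add a.lo b.lo) (Nat.add a.hi b.hi) k

/-- Difference of two intervals; the difference is known to be nonnegative. -/
def subK (a b : Ival) (k : Ival → Bool) : Bool :=
  ret (Nat.sub a.lo b.hi) (Nat.sub a.hi b.lo) k

/-- Product of two intervals. -/
def mulK (a b : Ival) (k : Ival → Bool) : Bool :=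
  ret (Nat.div (Nat.mul a.lo b.lo) scale) (Nat.succ (Nat.div (Nat.mul a.hi b.hi) scale)) k

/-- Quotient of two intervals; the computation fails unless the denominator is positive. -/
def divK (a b : Ival) (k : Ival → Bool) : Bool :=
  and (Nat.ble 1 b.lo)
    (ret (Nat.div (Nat.mul a.lo scale) b.hi) (Nat.succ (Nat.div (Nat.mul a.hi scale) b.lo)) k)

/-- An interval times a natural number. -/
def smulK (n : ℕ) (a : Ival) (k : Ival → Bool) : Bool :=
  ret (Nat.mul n a.lo) (Nat.mul n a.hi) k

/-- The interval `{1}`. -/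
def one : Ival := ⟨scale, scale⟩

/-- The Horner scheme for `1 + y/3 + y²/(3·5) + ⋯ + y^N/(3·5⋯(2N+1))`. -/
def hornerK (y : Ival) (N : ℕ) : Ival → (Ival → Bool) → Bool :=
  Nat.rec (fun acc k => k acc)
    (fun m ih acc k =>
      ret (Nat.add scale (Nat.div (Nat.mul y.lo acc.lo) (Nat.mul scale (Nat.add (Nat.mul 2 m) 3))))
        (Nat.succ (Nat.add scale
          (Nat.div (Nat.mul y.hi acc.hi) (Nat.mul scale (Nat.add (Nat.mul 2 m) 3)))))
        fun acc => ih acc k) N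

/-- The number of terms of the series of the normal distribution function. -/
def hornerLen : ℕ := 170

/-- An interval for the gaussian tail at `x`, from intervals for `φ(x)`, `x` and `x²`: it is
`1/2 - φ(x) (x + x³/3 + x⁵/(3·5) + ⋯)`, up to `10⁻²⁴`. -/
def tailK (φ x y : Ival) (k : Ival → Bool) : Bool :=
  hornerK y hornerLen one fun R => mulK x R fun S => mulK φ S fun P =>
    ret (Nat.sub (Nat.div scale 2) (Nat.add P.hi (Nat.div scale (Nat.pow 10 24))))
      (Nat.sub (Nat.div scale 2) P.lo) k

/-- Accumulate `∑ term n` for `m` consecutive values of `n`. The state consists of `n`, of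
intervals for `r^(n²)`, `r^(2n+1)`, `ρ^(n²)`, `ρ^(2n+1)`, `t^n` and of the partial sum. -/
def sumLoop (r2 ρ2 t1 : Ival) (term : ℕ → Ival → Ival → Ival → (Ival → Bool) → Bool)
    (k : Ival → Bool) (m : ℕ) :
    ℕ → Ival → Ival → Ival → Ival → Ival → Ival → Bool :=
  Nat.rec (fun _ _ _ _ _ _ acc => k acc)
    (fun _ ih n w d v e t acc =>
      term n w v t fun I => addK acc I fun acc => mulK w d fun w => mulK d r2 fun d =>
        mulK v e fun v => mulK e ρ2 fun e => mulK t t1 fun t =>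
          force (Nat.succ n) fun n => ih n w d v e t acc) m

/-- Run `sumLoop` over `n = 1, …, 128`. -/
def sumAll (r ρ t1 : Ival) (term : ℕ → Ival → Ival → Ival → (Ival → Bool) → Bool)
    (k : Ival → Bool) : Bool :=
  mulK r r fun r2 => mulK ρ ρ fun ρ2 => mulK r r2 fun r3 => mulK ρ ρ2 fun ρ3 =>
    sumLoop r2 ρ2 t1 term k 128 1 r r3 ρ ρ3 t1 ⟨0, 0⟩

/-- The final comparison with prescribed bounds. -/
def within (l h : ℕ) (I : Ival) : Bool := and (Nat.ble l I.lo) (Nat.ble I.hi h)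

/-- `tanh(sz)² φ(z)`, at `z` and `-z` together. -/
def termP (c : Ival) (_ : ℕ) (w _ t : Ival) (k : Ival → Bool) : Bool :=
  subK one t fun a => addK one t fun b => divK a b fun q => mulK q q fun q2 =>
    mulK c w fun φ => mulK q2 φ fun u => addK u u k

/-- `𝓔(gz)² φ(z)`, at `z` and `-z` together. -/
def termA (c g g2 : Ival) (n : ℕ) (w v _ : Ival) (k : Ival → Bool) : Bool :=
  mulK c w fun φ => mulK c v fun ψ => smulK n g fun x => smulK (Nat.mul n n) g2 fun y =>
    tailK ψ x y fun T => subK one T fun U => divK ψ T fun a => divK ψ U fun b =>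
      mulK a a fun a2 => mulK b b fun b2 => addK a2 b2 fun u => mulK u φ k

/-- `𝓔(gz) Φ̄(z)`, at `z` and `-z` together. -/
def termL (c g g2 z z2 : Ival) (n : ℕ) (w v _ : Ival) (k : Ival → Bool) : Bool :=
  mulK c w fun φ => mulK c v fun ψ => smulK n g fun x => smulK (Nat.mul n n) g2 fun y =>
    tailK ψ x y fun T => subK one T fun U => divK ψ T fun a => divK ψ U fun b =>
      smulK n z fun x1 => smulK (Nat.mul n n) z2 fun y1 => tailK φ x1 y1 fun T1 =>
        subK one T1 fun U1 => mulK a T1 fun aT => mulK b U1 fun bU => addK aT bU k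

/-- `Φ̄(z) / (1 + exp(-2sz))`, at `z` and `-z` together. -/
def termK (c z z2 : Ival) (n : ℕ) (w _ t : Ival) (k : Ival → Bool) : Bool :=
  mulK c w fun φ => smulK n z fun x1 => smulK (Nat.mul n n) z2 fun y1 => tailK φ x1 y1 fun T1 =>
    subK one T1 fun U1 => addK one t fun b => mulK U1 t fun Ut => addK T1 Ut fun a => divK a b k

end

end FixedPoint

/-! ### Soundness of the interval arithmetic -/

/-- The Horner scheme mirrored by `hornerK`. -/
noncomputable def hornerSum (y : ℝ) : ℕ → ℝ → ℝ
  | 0, a => a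
  | m + 1, a => hornerSum y m (1 + y * a / (2 * m + 3))

/-- The odd double factorial `3 · 5 ⋯ (2k+1)`. -/
def oddProd (k : ℕ) : ℕ := ∏ j ∈ Finset.range k, (2 * j + 3)

theorem oddProd_succ (k : ℕ) : (oddProd (k + 1) : ℝ) = oddProd k * (2 * k + 3) := by
  rw [oddProd, Finset.prod_range_succ]
  push_cast [oddProd]
  rfl

theorem oddProd_pos (k : ℕ) : (0 : ℝ) < oddProd k :=
  Nat.cast_pos.2 (Finset.prod_pos fun j _ => by omega)

theorem hornerSum_eq (y : ℝ) (N : ℕ) (a : ℝ) :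
    hornerSum y N a = ∑ k ∈ Finset.range N, y ^ k / oddProd k + a * y ^ N / oddProd N := by
  induction N generalizing a with
  | zero => simp [hornerSum, oddProd]
  | succ m ih =>
    rw [hornerSum, ih, Finset.sum_range_succ, oddProd_succ]
    have h1 := (oddProd_pos m).ne'
    have h2 : (2 * m + 3 : ℝ) ≠ 0 := by positivity
    field_simp
    ring

theorem hasDerivAt_gaussDensity_mul_hornerSum (N : ℕ) (x : ℝ) :
    HasDerivAt (fun x => gaussDensity x * (x * hornerSum (x ^ 2) N 1))
      (gaussDensity x * (1 - x ^ (2 * N + 2) / oddProd N)) x := by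
  induction N with
  | zero =>
    simp only [hornerSum, mul_one]
    refine ((hasDerivAt_gaussDensity x).mul (hasDerivAt_id x)).congr_deriv ?_
    simp [oddProd]
    ring
  | succ m ih =>
    have e : (fun x => gaussDensity x * (x * hornerSum (x ^ 2) (m + 1) 1)) = fun x =>
        gaussDensity x * (x * hornerSum (x ^ 2) m 1)
          + gaussDensity x * (x ^ (2 * m + 3) / oddProd (m + 1)) := by
      ext z
      rw [hornerSum_eq, hornerSum_eq, Finset.sum_range_succ]
      ring
    rw [e]
    refine (ih.add ((hasDerivAt_gaussDensity x).mul
      ((hasDerivAt_pow (2 * m + 3) x).div_const _))).congr_deriv ?_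
    rw [oddProd_succ]
    have h1 := (oddProd_pos m).ne'
    have h2 : (2 * m + 3 : ℝ) ≠ 0 := by positivity
    simp only [show 2 * m + 3 - 1 = 2 * m + 2 by omega,
      show 2 * (m + 1) + 2 = 2 * m + 4 by omega]
    push_cast
    field_simp
    ring

/-- `Φ̄(x) = 1/2 - φ(x) (x + x³/3 + x⁵/(3·5) + ⋯)`: the derivative of the truncation error is the
first omitted term. -/
theorem gaussTail_series_of_le {N : ℕ}
    (hN : 92 ^ (2 * N + 2) * 10 ^ 26 ≤ oddProd N * 10 ^ (2 * N + 2))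
    {x : ℝ} (hx0 : 0 ≤ x) (hx : x ≤ 9.2) :
    gaussTail x ≤ 1 / 2 - gaussDensity x * (x * hornerSum (x ^ 2) N 1) ∧
    1 / 2 - gaussDensity x * (x * hornerSum (x ^ 2) N 1) - 0.5e-24 ≤ gaussTail x := by
  set D : ℝ → ℝ := fun x => 1 / 2 - gaussDensity x * (x * hornerSum (x ^ 2) N 1) - gaussTail x
    with hD
  have hd : ∀ z, HasDerivAt D (gaussDensity z * (z ^ (2 * N + 2) / oddProd N)) z := by
    intro z
    refine (((hasDerivAt_gaussDensity_mul_hornerSum N z).const_sub (1 / 2)).sub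
      (hasDerivAt_gaussTail z)).congr_deriv ?_
    ring
  have hD0 : D 0 = 0 := by simp [hD, gaussTail_zero]
  have hnum : (9.2 : ℝ) ^ (2 * N + 2) / oddProd N ≤ 1e-26 := by
    rw [div_le_iff₀ (oddProd_pos N)]
    have h2 : (92 : ℝ) ^ (2 * N + 2) * 10 ^ 26 ≤ oddProd N * 10 ^ (2 * N + 2) := by
      exact_mod_cast hN
    rw [show (9.2 : ℝ) = 92 / 10 by norm_num, div_pow, div_le_iff₀ (by positivity)]
    linarith
  have hbd : ∀ z ∈ Icc (0 : ℝ) x, 0 ≤ gaussDensity z * (z ^ (2 * N + 2) / oddProd N) ∧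
      gaussDensity z * (z ^ (2 * N + 2) / oddProd N) ≤ 1e-26 := by
    intro z hz
    have h1 := gaussDensity_pos z
    have h2 := oddProd_pos N
    have h3 : 0 ≤ z ^ (2 * N + 2) := pow_nonneg hz.1 _
    have h6 : 0 ≤ z ^ (2 * N + 2) / oddProd N := by positivity
    refine ⟨by positivity, ?_⟩
    have h4 : z ^ (2 * N + 2) / oddProd N ≤ 1e-26 := by
      refine le_trans ?_ hnum
      gcongr
      · exact hz.1
      · exact hz.2.trans hx
    have h5 := gaussDensity_le_half z
    nlinarith
  have h1 : 0 ≤ D x := by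
    have hmono : MonotoneOn D (Icc 0 x) := by
      refine monotoneOn_of_deriv_nonneg (convex_Icc _ _)
        (fun z _ => (hd z).continuousAt.continuousWithinAt)
        (fun z _ => (hd z).differentiableAt.differentiableWithinAt) fun z hz => ?_
      rw [(hd z).deriv]
      exact (hbd z (interior_subset hz)).1
    simpa [hD0] using hmono ⟨le_rfl, hx0⟩ ⟨hx0, le_rfl⟩ hx0
  have h2 : D x ≤ 1e-26 * x := by
    have h := Convex.norm_image_sub_le_of_norm_hasDerivWithin_le (f := D)
      (s := Icc 0 x) (C := 1e-26) (x := 0) (y := x) (fun z _ => (hd z).hasDerivWithinAt)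
      (fun z hz => by rw [Real.norm_of_nonneg (hbd z hz).1]; exact (hbd z hz).2)
      (convex_Icc _ _) ⟨le_rfl, hx0⟩ ⟨hx0, le_rfl⟩
    rw [hD0, sub_zero, sub_zero, Real.norm_of_nonneg hx0] at h
    exact (le_abs_self _).trans h
  simp only [hD] at h1 h2
  constructor <;> linarith

/-- With `hornerLen` terms the series is accurate up to `x = 9.2`, which covers the arguments `g z`
of the trapezoidal sums. -/
theorem gaussTail_series {x : ℝ} (hx0 : 0 ≤ x) (hx : x ≤ 9.2) :
    gaussTail x ≤ 1 / 2 - gaussDensity x * (x * hornerSum (x ^ 2) FixedPoint.hornerLen 1) ∧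
    1 / 2 - gaussDensity x * (x * hornerSum (x ^ 2) FixedPoint.hornerLen 1) - 0.5e-24
      ≤ gaussTail x :=
  gaussTail_series_of_le (by decide +kernel) hx0 hx

namespace FixedPoint

theorem scale_pos : (0 : ℝ) < scale := by
  unfold scale
  norm_num

theorem ret_eq (l h : ℕ) (k : Ival → Bool) : ret l h k = k ⟨l, h⟩ := by
  rw [ret, force_eq, force_eq]

theorem div_lt_succ_div (m n : ℕ) : (m : ℝ) / n < ((m / n).succ : ℕ) := by
  rw [← Nat.floor_div_eq_div (K := ℝ), Nat.cast_succ]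
  exact Nat.lt_floor_add_one _

variable {a b : Ival} {x y : ℝ} {k : Ival → Bool}

theorem Ival.Has.nonneg (h : a.Has x) : 0 ≤ x := by
  have h1 : 0 ≤ x * scale := (Nat.cast_nonneg _).trans h.1
  exact nonneg_of_mul_nonneg_left h1 scale_pos

theorem has_one : one.Has 1 := by
  constructor <;> simp [one]

/-- Soundness in continuation form: a computation that succeeds was continued with an interval that
contains the exact result. The other soundness lemmas have the same form. -/
theorem addK_sound (ha : a.Has x) (hb : b.Has y) (hk : addK a b k = true) :
    ∃ I : Ival, I.Has (x + y) ∧ k I = true := by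
  rw [addK, ret_eq] at hk
  refine ⟨_, ⟨?_, ?_⟩, hk⟩
  · have := add_le_add ha.1 hb.1
    simp only [Nat.add_eq, Nat.cast_add]
    linarith
  · have := add_le_add ha.2 hb.2
    simp only [Nat.add_eq, Nat.cast_add]
    linarith

theorem cast_sub_le_of_le {m n : ℕ} {z : ℝ} (hz : 0 ≤ z) (h : (m : ℝ) - n ≤ z) :
    ((m - n : ℕ) : ℝ) ≤ z := by
  rcases le_total n m with hmn | hmn
  · rwa [Nat.cast_sub hmn]
  · rw [Nat.sub_eq_zero_of_le hmn]
    simpa using hz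

theorem le_cast_sub {m n : ℕ} {z : ℝ} (h : z ≤ (m : ℝ) - n) : z ≤ ((m - n : ℕ) : ℝ) := by
  refine h.trans ?_
  rw [sub_le_iff_le_add]
  exact_mod_cast Nat.le_add_of_sub_le le_rfl

theorem subK_sound (ha : a.Has x) (hb : b.Has y) (hxy : y ≤ x) (hk : subK a b k = true) :
    ∃ I : Ival, I.Has (x - y) ∧ k I = true := by
  rw [subK, ret_eq] at hk
  refine ⟨_, ⟨?_, ?_⟩, hk⟩
  · refine cast_sub_le_of_le (mul_nonneg (sub_nonneg.2 hxy) scale_pos.le) ?_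
    linarith [ha.1, hb.2]
  · refine le_cast_sub ?_
    linarith [ha.2, hb.1]

theorem mulK_sound (ha : a.Has x) (hb : b.Has y) (hk : mulK a b k = true) :
    ∃ I : Ival, I.Has (x * y) ∧ k I = true := by
  rw [mulK, ret_eq] at hk
  have hS := scale_pos
  have hx := ha.nonneg
  have hy := hb.nonneg
  have e : x * y * scale = (x * scale) * (y * scale) / scale := by
    field_simp
  refine ⟨_, ⟨?_, ?_⟩, hk⟩
  · refine Nat.cast_div_le.trans ?_
    rw [e]
    simp only [Nat.mul_eq, Nat.cast_mul]
    gcongr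
    exacts [ha.1, hb.1]
  · refine le_trans ?_ (div_lt_succ_div _ _).le
    rw [e]
    simp only [Nat.mul_eq, Nat.cast_mul]
    gcongr
    exacts [ha.2, hb.2]

theorem divK_sound (ha : a.Has x) (hb : b.Has y) (hk : divK a b k = true) :
    ∃ I : Ival, I.Has (x / y) ∧ k I = true := by
  rw [divK, ret_eq, Bool.and_eq_true] at hk
  obtain ⟨h1, hk⟩ := hk
  have h1 : 1 ≤ b.lo := Nat.le_of_ble_eq_true h1
  have hlo : (0 : ℝ) < b.lo := by exact_mod_cast h1
  have hS := scale_pos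
  have hx := ha.nonneg
  have hyS : 0 < y * scale := hlo.trans_le hb.1
  have hy : 0 < y := (mul_pos_iff_of_pos_right hS).1 hyS
  have hhi : (0 : ℝ) < b.hi := hyS.trans_le hb.2
  have e : x / y * scale = (x * scale) * scale / (y * scale) := by
    field_simp
  refine ⟨_, ⟨?_, ?_⟩, hk⟩
  · refine Nat.cast_div_le.trans ?_
    rw [e]
    simp only [Nat.mul_eq, Nat.cast_mul]
    gcongr
    exacts [ha.1, hb.2]
  · refine le_trans ?_ (div_lt_succ_div _ _).le
    rw [e]
    simp only [Nat.mul_eq, Nat.cast_mul]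
    gcongr
    exacts [ha.2, hb.1]

theorem smulK_sound (n : ℕ) (ha : a.Has x) (hk : smulK n a k = true) :
    ∃ I : Ival, I.Has (n * x) ∧ k I = true := by
  rw [smulK, ret_eq] at hk
  have hn : (0 : ℝ) ≤ n := Nat.cast_nonneg n
  refine ⟨_, ⟨?_, ?_⟩, hk⟩
  · simp only [Nat.mul_eq, Nat.cast_mul, mul_assoc]
    exact mul_le_mul_of_nonneg_left ha.1 hn
  · simp only [Nat.mul_eq, Nat.cast_mul, mul_assoc]
    exact mul_le_mul_of_nonneg_left ha.2 hn

theorem hornerK_sound (ha : a.Has y) (N : ℕ) {I : Ival} {z : ℝ} (hI : I.Has z)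
    (hk : hornerK a N I k = true) : ∃ J : Ival, J.Has (hornerSum y N z) ∧ k J = true := by
  induction N generalizing I z with
  | zero => exact ⟨I, hI, hk⟩
  | succ m ih =>
    have hk' : ret (scale + a.lo * I.lo / (scale * (2 * m + 3)))
        (scale + a.hi * I.hi / (scale * (2 * m + 3))).succ
        (fun acc => hornerK a m acc k) = true := hk
    rw [ret_eq] at hk'
    refine ih ?_ hk'
    have hS := scale_pos
    have hy := ha.nonneg
    have hz := hI.nonneg
    have e : (1 + y * z / (2 * m + 3)) * scale
        = scale + (y * scale) * (z * scale) / ((scale * (2 * m + 3) : ℕ) : ℝ) := by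
      push_cast
      field_simp
    refine ⟨?_, ?_⟩
    · rw [e, Nat.cast_add]
      gcongr
      refine Nat.cast_div_le.trans ?_
      rw [Nat.cast_mul a.lo]
      gcongr
      exacts [ha.1, hI.1]
    · rw [e, ← Nat.add_succ, Nat.cast_add]
      gcongr
      refine le_trans ?_ (div_lt_succ_div _ _).le
      rw [Nat.cast_mul a.hi]
      gcongr
      exacts [ha.2, hI.2]

theorem tailK_sound {p : Ival} (hx9 : x ≤ 9.2) (hp : p.Has (gaussDensity x)) (ha : a.Has x)
    (hb : b.Has (x ^ 2)) (hk : tailK p a b k = true) :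
    ∃ I : Ival, I.Has (gaussTail x) ∧ k I = true := by
  rw [tailK] at hk
  obtain ⟨R, hR, hk⟩ := hornerK_sound hb hornerLen has_one hk
  obtain ⟨S, hS, hk⟩ := mulK_sound ha hR hk
  obtain ⟨P, hP, hk⟩ := mulK_sound hp hS hk
  rw [ret_eq] at hk
  obtain ⟨h1, h2⟩ := gaussTail_series ha.nonneg hx9
  have hS := scale_pos
  have e1 : ((Nat.div scale 2 : ℕ) : ℝ) = 1 / 2 * scale := by
    rw [show Nat.div scale 2 = 730750818665451459101842416358141509827966271488 by decide +kernel]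
    unfold scale
    norm_num
  have e2 : 0.5e-24 * (scale : ℝ) ≤ ((Nat.div scale (Nat.pow 10 24) : ℕ) : ℝ) := by
    rw [show Nat.div scale (Nat.pow 10 24) = 1461501637330902918203684 by decide +kernel]
    unfold scale
    norm_num
  refine ⟨_, ⟨?_, ?_⟩, hk⟩
  · refine cast_sub_le_of_le (mul_nonneg (gaussTail_pos x).le hS.le) ?_
    rw [e1]
    simp only [Nat.add_eq, Nat.cast_add]
    have := mul_le_mul_of_nonneg_right h2 hS.le
    linarith [hP.2]
  · refine le_cast_sub ?_
    rw [e1]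
    have := mul_le_mul_of_nonneg_right h1 hS.le
    linarith [hP.1]

/-- What is required of the procedure `term`: from intervals for `r^(n²)`, `ρ^(n²)` and `t^n` it
computes an interval for `T n`. -/
def TermSound (r ρ t : ℝ) (T : ℕ → ℝ)
    (term : ℕ → Ival → Ival → Ival → (Ival → Bool) → Bool) : Prop :=
  ∀ (n : ℕ) (I J K : Ival) (k : Ival → Bool), 1 ≤ n → n ≤ 128 → I.Has (r ^ n ^ 2) →
    J.Has (ρ ^ n ^ 2) → K.Has (t ^ n) → term n I J K k = true → ∃ L : Ival, L.Has (T n) ∧ k L = true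

theorem sumLoop_sound {r ρ t : ℝ} {T : ℕ → ℝ}
    {term : ℕ → Ival → Ival → Ival → (Ival → Bool) → Bool} (hterm : TermSound r ρ t T term)
    {r2 ρ2 t1 : Ival} (hr2 : r2.Has (r ^ 2)) (hρ2 : ρ2.Has (ρ ^ 2)) (ht1 : t1.Has t)
    (m : ℕ) (n : ℕ) (w d v e u acc : Ival) (X : ℝ) (hn : 1 ≤ n) (hm : n + m ≤ 129)
    (hw : w.Has (r ^ n ^ 2)) (hd : d.Has (r ^ (2 * n + 1))) (hv : v.Has (ρ ^ n ^ 2))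
    (he : e.Has (ρ ^ (2 * n + 1))) (hu : u.Has (t ^ n)) (hacc : acc.Has X)
    (hk : sumLoop r2 ρ2 t1 term k m n w d v e u acc = true) :
    ∃ I : Ival, I.Has (X + ∑ j ∈ Finset.range m, T (n + j)) ∧ k I = true := by
  induction m generalizing n w d v e u acc X with
  | zero => exact ⟨acc, by simpa using hacc, hk⟩
  | succ m ih =>
    obtain ⟨I, hI, hk⟩ := hterm n w v u _ hn (by omega) hw hv hu hk
    obtain ⟨acc', hacc', hk⟩ := addK_sound hacc hI hk
    obtain ⟨w', hw', hk⟩ := mulK_sound hw hd hk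
    obtain ⟨d', hd', hk⟩ := mulK_sound hd hr2 hk
    obtain ⟨v', hv', hk⟩ := mulK_sound hv he hk
    obtain ⟨e', he', hk⟩ := mulK_sound he hρ2 hk
    obtain ⟨u', hu', hk⟩ := mulK_sound hu ht1 hk
    rw [force_eq] at hk
    have h := ih (n + 1) w' d' v' e' u' acc' (X + T n) (by omega) (by omega)
      (by convert hw' using 1; ring) (by convert hd' using 1; ring) (by convert hv' using 1; ring)
      (by convert he' using 1; ring) (by rw [pow_succ]; exact hu') hacc' hk
    obtain ⟨L, hL, hk⟩ := h
    refine ⟨L, ?_, hk⟩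
    convert hL using 1
    rw [Finset.sum_range_succ', add_zero, add_assoc, add_comm (T n)]
    congr 2
    refine Finset.sum_congr rfl fun j _ => ?_
    congr 1
    omega

theorem sumAll_sound {r ρ t : ℝ} {T : ℕ → ℝ}
    {term : ℕ → Ival → Ival → Ival → (Ival → Bool) → Bool} (hterm : TermSound r ρ t T term)
    {r1 ρ1 t1 : Ival} (hr : r1.Has r) (hρ : ρ1.Has ρ) (ht : t1.Has t)
    (hk : sumAll r1 ρ1 t1 term k = true) :
    ∃ I : Ival, I.Has (∑ j ∈ Finset.range 128, T (j + 1)) ∧ k I = true := by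
  obtain ⟨r2, hr2, hk⟩ := mulK_sound hr hr hk
  obtain ⟨ρ2, hρ2, hk⟩ := mulK_sound hρ hρ hk
  obtain ⟨r3, hr3, hk⟩ := mulK_sound hr hr2 hk
  obtain ⟨ρ3, hρ3, hk⟩ := mulK_sound hρ hρ2 hk
  have h0 : (⟨0, 0⟩ : Ival).Has 0 := by constructor <;> simp
  obtain ⟨I, hI, hk⟩ := sumLoop_sound hterm (by convert hr2 using 1; ring)
    (by convert hρ2 using 1; ring) ht 128 1 r1 r3 ρ1 ρ3 t1 ⟨0, 0⟩ 0 le_rfl (by norm_num)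
    (by simpa using hr) (by convert hr3 using 1; ring) (by simpa using hρ)
    (by convert hρ3 using 1; ring) (by simpa using ht) h0 hk
  refine ⟨I, ?_, hk⟩
  convert hI using 1
  rw [zero_add]
  exact Finset.sum_congr rfl fun j _ => by rw [add_comm]

theorem within_sound {l h : ℕ} (ha : a.Has x) (hk : within l h a = true) :
    (l : ℝ) ≤ x * scale ∧ x * scale ≤ h := by
  rw [within, Bool.and_eq_true] at hk
  have h1 : l ≤ a.lo := Nat.le_of_ble_eq_true hk.1
  have h2 : a.hi ≤ h := Nat.le_of_ble_eq_true hk.2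
  exact ⟨(Nat.cast_le.2 h1).trans ha.1, ha.2.trans (Nat.cast_le.2 h2)⟩

end FixedPoint

/-! ### Soundness of the summands -/

namespace FixedPoint

variable {s g : ℝ}

theorem gaussDensity_grid (g : ℝ) (n : ℕ) :
    gaussDensity 0 * Real.exp (-g ^ 2 / 512) ^ n ^ 2 = gaussDensity (g * (n / 16)) := by
  unfold gaussDensity
  rw [← Real.exp_nat_mul]
  simp only [ne_eq, OfNat.ofNat_ne_zero, not_false_eq_true, zero_pow, neg_zero, zero_div,
    Real.exp_zero]
  rw [one_div_mul_eq_div]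
  congr 2
  push_cast
  ring

theorem gaussDensity_grid_one (n : ℕ) :
    gaussDensity 0 * Real.exp (-1 / 512) ^ n ^ 2 = gaussDensity (n / 16) := by
  have := gaussDensity_grid 1 n
  rwa [one_pow, one_mul] at this

theorem exp_grid (s : ℝ) (n : ℕ) :
    Real.exp (-s / 8) ^ n = Real.exp (-(2 * (s * (n / 16)))) := by
  rw [← Real.exp_nat_mul]
  congr 1
  ring

theorem tanh_eq_exp (x : ℝ) :
    Real.tanh x = (1 - Real.exp (-(2 * x))) / (1 + Real.exp (-(2 * x))) := by
  rw [tanh_eq_logistic, logistic]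
  have := Real.exp_pos (-(2 * x))
  field_simp
  ring

theorem exp_neg_grid_le_one (hs : 0 ≤ s) (n : ℕ) : Real.exp (-(2 * (s * (n / 16)))) ≤ 1 := by
  rw [Real.exp_le_one_iff]
  have : 0 ≤ s * (n / 16) := by positivity
  linarith

theorem termP_sound {c : Ival} (hc : c.Has (gaussDensity 0)) (hs : 0 ≤ s) (ρ : ℝ) :
    TermSound (Real.exp (-1 / 512)) ρ (Real.exp (-s / 8))
      (fun n => Real.tanh (s * (n / 16)) ^ 2 * gaussDensity (n / 16)
        + Real.tanh (s * -(n / 16)) ^ 2 * gaussDensity (-(n / 16))) (termP c) := by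
  intro n w v t k _ _ hw _ ht hk
  rw [exp_grid] at ht
  obtain ⟨a, ha, hk⟩ := subK_sound has_one ht (exp_neg_grid_le_one hs n) hk
  obtain ⟨b, hb, hk⟩ := addK_sound has_one ht hk
  obtain ⟨q, hq, hk⟩ := divK_sound ha hb hk
  obtain ⟨q2, hq2, hk⟩ := mulK_sound hq hq hk
  obtain ⟨φ, hφ, hk⟩ := mulK_sound hc hw hk
  obtain ⟨u, hu, hk⟩ := mulK_sound hq2 hφ hk
  obtain ⟨L, hL, hk⟩ := addK_sound hu hu hk
  refine ⟨L, ?_, hk⟩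
  convert hL using 1
  beta_reduce
  rw [gaussDensity_grid_one, gaussDensity_neg, mul_neg, Real.tanh_neg, neg_sq, tanh_eq_exp]
  ring

theorem grid_le {n : ℕ} (hg : g ≤ 1.15) (hn : n ≤ 128) :
    g * ((n : ℝ) / 16) ≤ 9.2 := by
  have h1 : (n : ℝ) / 16 ≤ 8 := by
    have : (n : ℝ) ≤ 128 := by exact_mod_cast hn
    linarith
  calc g * ((n : ℝ) / 16) ≤ 1.15 * 8 := by gcongr
    _ ≤ 9.2 := by norm_num

theorem tailK_grid_sound {p a b : Ival} {k : Ival → Bool} {n : ℕ} (hg : g ≤ 1.15)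
    (hn : n ≤ 128)
    (ha : a.Has (g / 16)) (hb : b.Has (g ^ 2 / 256))
    (hp : p.Has (gaussDensity (g * (n / 16))))
    (hk : (smulK n a fun x => smulK (Nat.mul n n) b fun y => tailK p x y k) = true) :
    ∃ I : Ival, I.Has (gaussTail (g * (n / 16))) ∧ k I = true := by
  obtain ⟨x, hx, hk⟩ := smulK_sound n ha hk
  obtain ⟨y, hy, hk⟩ := smulK_sound _ hb hk
  refine tailK_sound (grid_le hg hn) hp (by convert hx using 1; ring) ?_ hk
  convert hy using 1
  simp only [Nat.mul_eq, Nat.cast_mul]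
  ring

theorem millsE_neg (x : ℝ) : millsE (-x) = gaussDensity x / (1 - gaussTail x) := by
  rw [millsE, gaussDensity_neg, gaussTail_neg]

theorem termA_sound {c a b : Ival} (hc : c.Has (gaussDensity 0)) (hg : g ≤ 1.15)
    (ha : a.Has (g / 16)) (hb : b.Has (g ^ 2 / 256)) (t : ℝ) :
    TermSound (Real.exp (-1 / 512)) (Real.exp (-g ^ 2 / 512)) t
      (fun n => millsE (g * (n / 16)) ^ 2 * gaussDensity (n / 16)
        + millsE (g * -(n / 16)) ^ 2 * gaussDensity (-(n / 16))) (termA c a b) := by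
  intro n w v t k _ hn hw hv _ hk
  obtain ⟨φ, hφ, hk⟩ := mulK_sound hc hw hk
  obtain ⟨ψ, hψ, hk⟩ := mulK_sound hc hv hk
  rw [gaussDensity_grid_one] at hφ
  rw [gaussDensity_grid] at hψ
  obtain ⟨T, hT, hk⟩ := tailK_grid_sound hg hn ha hb hψ hk
  obtain ⟨U, hU, hk⟩ := subK_sound has_one hT (gaussTail_lt_one _).le hk
  obtain ⟨e, he, hk⟩ := divK_sound hψ hT hk
  obtain ⟨f, hf, hk⟩ := divK_sound hψ hU hk
  obtain ⟨e2, he2, hk⟩ := mulK_sound he he hk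
  obtain ⟨f2, hf2, hk⟩ := mulK_sound hf hf hk
  obtain ⟨u, hu, hk⟩ := addK_sound he2 hf2 hk
  obtain ⟨L, hL, hk⟩ := mulK_sound hu hφ hk
  refine ⟨L, ?_, hk⟩
  convert hL using 1
  beta_reduce
  rw [gaussDensity_neg, mul_neg, millsE_neg, millsE]
  ring

theorem termL_sound {c a b z z2 : Ival} (hc : c.Has (gaussDensity 0))
    (hg : g ≤ 1.15) (ha : a.Has (g / 16)) (hb : b.Has (g ^ 2 / 256))
    (hz : z.Has (1 / 16)) (hz2 : z2.Has (1 / 256)) (t : ℝ) :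
    TermSound (Real.exp (-1 / 512)) (Real.exp (-g ^ 2 / 512)) t
      (fun n => millsE (g * (n / 16)) * gaussTail (n / 16)
        + millsE (g * -(n / 16)) * gaussTail (-(n / 16))) (termL c a b z z2) := by
  intro n w v t k _ hn hw hv _ hk
  obtain ⟨φ, hφ, hk⟩ := mulK_sound hc hw hk
  obtain ⟨ψ, hψ, hk⟩ := mulK_sound hc hv hk
  rw [gaussDensity_grid_one] at hφ
  rw [gaussDensity_grid] at hψ
  obtain ⟨T, hT, hk⟩ := tailK_grid_sound hg hn ha hb hψ hk
  obtain ⟨U, hU, hk⟩ := subK_sound has_one hT (gaussTail_lt_one _).le hk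
  obtain ⟨e, he, hk⟩ := divK_sound hψ hT hk
  obtain ⟨f, hf, hk⟩ := divK_sound hψ hU hk
  obtain ⟨T1, hT1, hk⟩ := tailK_grid_sound (g := 1) (by norm_num) hn
    (by simpa using hz) (by simpa using hz2) (by simpa using hφ) hk
  obtain ⟨U1, hU1, hk⟩ := subK_sound has_one hT1 (gaussTail_lt_one _).le hk
  obtain ⟨u1, hu1, hk⟩ := mulK_sound he hT1 hk
  obtain ⟨u2, hu2, hk⟩ := mulK_sound hf hU1 hk
  obtain ⟨L, hL, hk⟩ := addK_sound hu1 hu2 hk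
  refine ⟨L, ?_, hk⟩
  convert hL using 1
  beta_reduce
  rw [gaussTail_neg, mul_neg, millsE_neg, millsE, one_mul]

theorem termK_sound {c z z2 : Ival} (hc : c.Has (gaussDensity 0))
    (hz : z.Has (1 / 16)) (hz2 : z2.Has (1 / 256)) (ρ : ℝ) :
    TermSound (Real.exp (-1 / 512)) ρ (Real.exp (-s / 8))
      (fun n => logistic (s * (n / 16)) * gaussTail (n / 16)
        + logistic (s * -(n / 16)) * gaussTail (-(n / 16))) (termK c z z2) := by
  intro n w v t k _ hn hw _ ht hk
  rw [exp_grid] at ht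
  obtain ⟨φ, hφ, hk⟩ := mulK_sound hc hw hk
  rw [gaussDensity_grid_one] at hφ
  obtain ⟨T1, hT1, hk⟩ := tailK_grid_sound (g := 1) (by norm_num) hn
    (by simpa using hz) (by simpa using hz2) (by simpa using hφ) hk
  obtain ⟨U1, hU1, hk⟩ := subK_sound has_one hT1 (gaussTail_lt_one _).le hk
  obtain ⟨b, hb, hk⟩ := addK_sound has_one ht hk
  obtain ⟨u1, hu1, hk⟩ := mulK_sound hU1 ht hk
  obtain ⟨a, ha, hk⟩ := addK_sound hT1 hu1 hk
  obtain ⟨L, hL, hk⟩ := divK_sound ha hb hk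
  refine ⟨L, ?_, hk⟩
  convert hL using 1
  beta_reduce
  rw [gaussTail_neg, one_mul, logistic, logistic]
  have h1 : Real.exp (-(2 * (s * -(n / 16)))) = (Real.exp (-(2 * (s * (n / 16)))))⁻¹ := by
    rw [← Real.exp_neg]
    congr 1
    ring
  rw [h1]
  have := Real.exp_pos (-(2 * (s * ((n : ℝ) / 16))))
  field_simp
  ring

/-- Evaluation of a folded trapezoidal sum, except for the term at the origin. -/
theorem trapSum_bounds {r ρ t : ℝ} {F : ℝ → ℝ}
    {term : ℕ → Ival → Ival → Ival → (Ival → Bool) → Bool}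
    (hterm : TermSound r ρ t (fun n => F (n / 16) + F (-(n / 16))) term)
    {r1 ρ1 t1 : Ival} (hr : r1.Has r) (hρ : ρ1.Has ρ) (ht : t1.Has t) {l h : ℕ}
    (hk : sumAll r1 ρ1 t1 term (within l h) = true) :
    (l : ℝ) / scale ≤ trapSum F - F 0 ∧ trapSum F - F 0 ≤ h / scale := by
  obtain ⟨I, hI, hk⟩ := sumAll_sound hterm hr hρ ht hk
  have hw := within_sound hI hk
  rw [trapSum, add_sub_cancel_left, div_le_iff₀ scale_pos, le_div_iff₀ scale_pos]
  exact hw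

end FixedPoint

/-! ### Certified values at the ends of the window

The arguments `l` and `h` of `trapSum_bounds` are bounds of the sum in units of `1 / scale`. The bounds
of the integrals are wider than those of the sums because of the quadrature errors. -/

/-- Lower end of the range of `√(q / (1 - q))`, rounded downwards. -/
noncomputable def gLow : ℝ := 1.13723794589843

/-- Upper end of the range of `√(q / (1 - q))`, rounded upwards. -/
noncomputable def gHigh : ℝ := 1.1372379477713934

/-- Lower end of the range of `√(R(q, α))`, rounded downwards. -/
noncomputable def sLow : ℝ := 1.6051016510136037

/-- Upper end of the range of `√(R(q, α))`, rounded upwards. -/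
noncomputable def sHigh : ℝ := 1.6051016548213012

namespace FixedPoint

/-- Contains `φ(0)`. -/
def densityZero : Ival :=
  ⟨583054796007218040733509065449501560068583535846, 583054796007218040734437025978281414379706124637⟩

/-- Contains `exp(-1/512)`. -/
def expUnit : Ival :=
  ⟨1458649927724687330481170477144909170190776795136, 1458649927724687330481170477144909173489311678464⟩

/-- Contains `exp(-gLow² / 512)`. -/
def expGLow : Ival :=
  ⟨1457814548235760480111313415895582940841975480320, 1457814548235760480111313415895582944140510363648⟩

/-- Contains `exp(-gHigh² / 512)`. -/
def expGHigh : Ival :=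
  ⟨1457814548223630978736710682370545581625186451456, 1457814548223630978736710682370545584923721334784⟩

/-- Contains `exp(-sLow / 8)`. -/
def expSLow : Ival :=
  ⟨1195813515050650827255963736882452205874224037888, 1195813515050650827255963736882452209172758921216⟩

/-- Contains `exp(-sHigh / 8)`. -/
def expSHigh : Ival :=
  ⟨1195813514481488810925841595020961741771993251840, 1195813514481488810925841595020961745070528135168⟩

/-- Contains `1/16`. -/
def gridUnit : Ival :=
  ⟨91343852333181432387730302044767688728495783936, 91343852333181432387730302044767688728495783936⟩

/-- Contains `1/256`. -/
def gridUnitSq : Ival :=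
  ⟨5708990770823839524233143877797980545530986496, 5708990770823839524233143877797980545530986496⟩

/-- Contains `gLow / 16`. -/
def gridGLow : Ival :=
  ⟨103879694997836764732479046211729439598074842848, 103879694997836764732479046211729439598074842849⟩

/-- Contains `gLow² / 256`. -/
def gridGLowSq : Ival :=
  ⟨7383495684993456009169964362999273267032521290, 7383495684993456009169964362999273267032521291⟩

/-- Contains `gHigh / 16`. -/
def gridGHigh : Ival :=
  ⟨103879695168920456967532474633522904398869885339, 103879695168920456967532474633522904398869885340⟩

/-- Contains `gHigh² / 256`. -/
def gridGHighSq : Ival :=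
  ⟨7383495709313814370960975171112233149625940295, 7383495709313814370960975171112233149625940296⟩

/-- An enclosure of the exponential by its Taylor polynomial with `n` terms. -/
theorem has_exp {I : Ival} {x : ℝ} (n : ℕ) (hx : |x| ≤ 1) (hn : 0 < n)
    (hlo : (I.lo : ℝ) ≤ (∑ m ∈ Finset.range n, x ^ m / m.factorial
      - |x| ^ n * (n.succ / (n.factorial * n))) * scale)
    (hhi : (∑ m ∈ Finset.range n, x ^ m / m.factorial
      + |x| ^ n * (n.succ / (n.factorial * n))) * scale ≤ I.hi) : I.Has (Real.exp x) := by
  have h := abs_le.1 (Real.exp_bound hx hn)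
  have hS := scale_pos
  constructor
  · refine hlo.trans (mul_le_mul_of_nonneg_right ?_ hS.le)
    linarith [h.1]
  · refine le_trans (mul_le_mul_of_nonneg_right ?_ hS.le) hhi
    linarith [h.2]

theorem has_expUnit : expUnit.Has (Real.exp (-1 / 512)) := by
  refine has_exp 12 (by norm_num [abs_of_neg]) (by norm_num) ?_ ?_ <;>
  norm_num [Finset.sum_range_succ, Nat.factorial, expUnit, scale, abs_of_neg]

theorem has_expGLow : expGLow.Has (Real.exp (-gLow ^ 2 / 512)) := by
  refine has_exp 12 (by norm_num [gLow, abs_of_neg]) (by norm_num) ?_ ?_ <;>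
  norm_num [Finset.sum_range_succ, Nat.factorial, expGLow, gLow, scale, abs_of_neg]

theorem has_expGHigh : expGHigh.Has (Real.exp (-gHigh ^ 2 / 512)) := by
  refine has_exp 12 (by norm_num [gHigh, abs_of_neg]) (by norm_num) ?_ ?_ <;>
  norm_num [Finset.sum_range_succ, Nat.factorial, expGHigh, gHigh, scale, abs_of_neg]

theorem has_expSLow : expSLow.Has (Real.exp (-sLow / 8)) := by
  refine has_exp 23 (by norm_num [sLow, abs_of_neg]) (by norm_num) ?_ ?_ <;>
  norm_num [Finset.sum_range_succ, Nat.factorial, expSLow, sLow, scale, abs_of_neg]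

theorem has_expSHigh : expSHigh.Has (Real.exp (-sHigh / 8)) := by
  refine has_exp 23 (by norm_num [sHigh, abs_of_neg]) (by norm_num) ?_ ?_ <;>
  norm_num [Finset.sum_range_succ, Nat.factorial, expSHigh, sHigh, scale, abs_of_neg]

theorem has_gridUnit : gridUnit.Has (1 / 16) := by
  constructor <;> norm_num [gridUnit, scale]

theorem has_gridUnitSq : gridUnitSq.Has (1 / 256) := by
  constructor <;> norm_num [gridUnitSq, scale]

theorem has_gridGLow : gridGLow.Has (gLow / 16) := by
  constructor <;> norm_num [gridGLow, gLow, scale]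

theorem has_gridGLowSq : gridGLowSq.Has (gLow ^ 2 / 256) := by
  constructor <;> norm_num [gridGLowSq, gLow, scale]

theorem has_gridGHigh : gridGHigh.Has (gHigh / 16) := by
  constructor <;> norm_num [gridGHigh, gHigh, scale]

theorem has_gridGHighSq : gridGHighSq.Has (gHigh ^ 2 / 256) := by
  constructor <;> norm_num [gridGHighSq, gHigh, scale]

theorem has_densityZero : densityZero.Has (gaussDensity 0) := by
  have h1 := Real.pi_gt_d20
  have h2 := Real.pi_lt_d20
  have h0 : gaussDensity 0 ^ 2 * (2 * Real.pi) = 1 := by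
    have : √(2 * Real.pi) ^ 2 = 2 * Real.pi := Real.sq_sqrt (by positivity)
    have h3 : 0 < 2 * Real.pi := by positivity
    simp only [gaussDensity, ne_eq, OfNat.ofNat_ne_zero, not_false_eq_true, zero_pow, neg_zero,
      zero_div, Real.exp_zero, div_pow, this]
    field_simp
  have hp := gaussDensity_pos 0
  have hS := scale_pos
  constructor
  · by_contra! h
    rw [← lt_div_iff₀ hS] at h
    have h3 : gaussDensity 0 ^ 2 < (densityZero.lo / scale) ^ 2 := by gcongr
    have h4 : ((densityZero.lo : ℝ) / scale) ^ 2 * (2 * 3.14159265358979323847) ≤ 1 := by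
      norm_num [densityZero, scale]
    have h5 : gaussDensity 0 ^ 2 * (2 * Real.pi)
        < (densityZero.lo / scale) ^ 2 * (2 * 3.14159265358979323847) := by gcongr
    linarith
  · by_contra! h
    rw [← div_lt_iff₀ hS] at h
    have h3 : (densityZero.hi / scale : ℝ) ^ 2 < gaussDensity 0 ^ 2 := by gcongr
    have h4 : 1 ≤ ((densityZero.hi : ℝ) / scale) ^ 2 * (2 * 3.14159265358979323846) := by
      norm_num [densityZero, scale]
    have h5 : ((densityZero.hi : ℝ) / scale) ^ 2 * (2 * 3.14159265358979323846)
        < gaussDensity 0 ^ 2 * (2 * Real.pi) := by gcongr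
    linarith

theorem gaussDensity_zero_bounds :
    0.39894228040143267793 ≤ gaussDensity 0 ∧ gaussDensity 0 ≤ 0.39894228040143267795 := by
  obtain ⟨h1, h2⟩ := has_densityZero
  rw [← div_le_iff₀ scale_pos] at h1
  rw [← le_div_iff₀ scale_pos] at h2
  constructor
  · refine le_trans ?_ h1
    norm_num [densityZero, scale]
  · refine h2.trans ?_
    norm_num [densityZero, scale]

theorem trapSum_const_mul (c : ℝ) (F : ℝ → ℝ) : trapSum (fun z => c * F z) = c * trapSum F := by
  simp only [trapSum, mul_add, Finset.mul_sum]

end FixedPoint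

section

open FixedPoint

theorem avgTanhSq_sLow_bounds : 0.5639490794913718 ≤ avgTanhSq sLow ∧
    avgTanhSq sLow ≤ 0.5639490794916519 := by
  have h1 := abs_le.1 (abs_avgTanhSq_sub_trapSum_le (s := sLow) (by norm_num [sLow])
    (by norm_num [sLow]))
  obtain ⟨h2, h3⟩ := trapSum_bounds (F := fun z => Real.tanh (sLow * z) ^ 2 * gaussDensity z)
    (termP_sound has_densityZero (by norm_num [sLow]) _) has_expUnit has_expUnit has_expSLow
    (l := 13187400048769601953271106699457965516975236972544)
    (h := 13187400048769601953350334861972229854568780922880) (by decide +kernel)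
  simp only [mul_zero, Real.tanh_zero, ne_eq, OfNat.ofNat_ne_zero, not_false_eq_true, zero_pow,
    zero_mul, sub_zero] at h2 h3
  norm_num [scale] at h2 h3
  constructor <;> linarith [h1.1, h1.2]

theorem avgTanhSq_sHigh_bounds : 0.5639490802978085 ≤ avgTanhSq sHigh ∧
    avgTanhSq sHigh ≤ 0.5639490802980886 := by
  have h1 := abs_le.1 (abs_avgTanhSq_sub_trapSum_le (s := sHigh) (by norm_num [sHigh])
    (by norm_num [sHigh]))
  obtain ⟨h2, h3⟩ := trapSum_bounds (F := fun z => Real.tanh (sHigh * z) ^ 2 * gaussDensity z)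
    (termP_sound has_densityZero (by norm_num [sHigh]) _) has_expUnit has_expUnit has_expSHigh
    (l := 13187400067627337877207174665043455341546298146816)
    (h := 13187400067627337877286402827557719679139842097152) (by decide +kernel)
  simp only [mul_zero, Real.tanh_zero, ne_eq, OfNat.ofNat_ne_zero, not_false_eq_true, zero_pow,
    zero_mul, sub_zero] at h2 h3
  norm_num [scale] at h2 h3
  constructor <;> linarith [h1.1, h1.2]

theorem avgMillsSq_gLow_bounds : 1.3485166485718912 ≤ avgMillsSq gLow ∧
    avgMillsSq gLow ≤ 1.3485166485729974 := by
  have h1 := abs_le.1 (abs_avgMillsSq_sub_trapSum_le (g := gLow) (by norm_num [gLow])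
    (by norm_num [gLow]))
  obtain ⟨h2, h3⟩ := trapSum_bounds (F := fun z => millsE (gLow * z) ^ 2 * gaussDensity z)
    (termA_sound has_densityZero (by norm_num [gLow]) has_gridGLow has_gridGLowSq _)
    has_expUnit has_expGLow has_expUnit
    (l := 31162564426193732511097905094315621413088925843456)
    (h := 31162564426193875635901977325184576436706224373760) (by decide +kernel)
  obtain ⟨h4, h5⟩ := gaussDensity_zero_bounds
  have h6 : 0.39894228040143267793 ^ 3 ≤ gaussDensity 0 ^ 3 := by gcongr
  have h7 : gaussDensity 0 ^ 3 ≤ 0.39894228040143267795 ^ 3 := by gcongr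
  have h8 : millsE (gLow * 0) ^ 2 * gaussDensity 0 = 4 * gaussDensity 0 ^ 3 := by
    rw [mul_zero, millsE, gaussTail_zero]
    ring
  rw [h8] at h2 h3
  norm_num [scale] at h2 h3 h6 h7
  constructor <;> linarith [h1.1, h1.2]

theorem avgMillsSq_gHigh_bounds : 1.3485166508450199 ≤ avgMillsSq gHigh ∧
    avgMillsSq gHigh ≤ 1.3485166508461262 := by
  have h1 := abs_le.1 (abs_avgMillsSq_sub_trapSum_le (g := gHigh) (by norm_num [gHigh])
    (by norm_num [gHigh]))
  obtain ⟨h2, h3⟩ := trapSum_bounds (F := fun z => millsE (gHigh * z) ^ 2 * gaussDensity z)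
    (termA_sound has_densityZero (by norm_num [gHigh]) has_gridGHigh has_gridGHighSq _)
    has_expUnit has_expGHigh has_expUnit
    (l := 31162564479348635261430853811889676887185350983680)
    (h := 31162564479348778386314154205272896248396193464320) (by decide +kernel)
  obtain ⟨h4, h5⟩ := gaussDensity_zero_bounds
  have h6 : 0.39894228040143267793 ^ 3 ≤ gaussDensity 0 ^ 3 := by gcongr
  have h7 : gaussDensity 0 ^ 3 ≤ 0.39894228040143267795 ^ 3 := by gcongr
  have h8 : millsE (gHigh * 0) ^ 2 * gaussDensity 0 = 4 * gaussDensity 0 ^ 3 := by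
    rw [mul_zero, millsE, gaussTail_zero]
    ring
  rw [h8] at h2 h3
  norm_num [scale] at h2 h3 h6 h7
  constructor <;> linarith [h1.1, h1.2]

theorem avgLogCosh_sLow_bounds : 1.4670816903804419 ≤ avgLogCosh sLow ∧
    avgLogCosh sLow ≤ 1.4670816904014420 := by
  have h1 := abs_le.1 (abs_avgLogCosh_sub_trapSum_le (s := sLow) (by norm_num [sLow])
    (by norm_num [sLow]))
  obtain ⟨h2, h3⟩ := trapSum_bounds (F := fun z => logistic (sLow * z) * gaussTail z)
    (termK_sound has_densityZero has_gridUnit has_gridUnitSq _) has_expUnit has_expUnit has_expSLow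
    (l := 10321261371586656435270802538875871724305693802496)
    (h := 10321261371586656435508487026418664737086325653504) (by decide +kernel)
  have h4 : logistic (sLow * 0) * gaussTail 0 = 1 / 4 := by
    rw [mul_zero, logistic, gaussTail_zero]
    norm_num
  rw [h4] at h2 h3
  rw [trapSum_const_mul] at h1
  norm_num [scale, sLow] at h1 h2 h3 ⊢
  constructor <;> linarith [h1.1, h1.2]

theorem avgLogTail_gLow_bounds : -1.0867780189294987 ≤ avgLogTail gLow ∧
    avgLogTail gLow ≤ -1.0867780189283985 := by
  have h1 := abs_le.1 (abs_avgLogTail_sub_trapSum_le (g := gLow) (by norm_num [gLow])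
    (by norm_num [gLow]))
  obtain ⟨h2, h3⟩ := trapSum_bounds (F := fun z => millsE (gLow * z) * gaussTail z)
    (termL_sound has_densityZero (by norm_num [gLow]) has_gridGLow has_gridGLowSq has_gridUnit
      has_gridUnitSq _) has_expUnit has_expGLow has_expUnit
    (l := 21763408190858350598355478910250823771202640674816)
    (h := 21763408190858351659933628438878683187098031226880) (by decide +kernel)
  obtain ⟨h4, h5⟩ := gaussDensity_zero_bounds
  have h6 : millsE (gLow * 0) * gaussTail 0 = gaussDensity 0 := by
    rw [mul_zero, millsE_mul_gaussTail]
  rw [h6] at h2 h3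
  rw [trapSum_const_mul] at h1
  norm_num [scale, gLow] at h1 h2 h3 ⊢
  constructor <;> linarith [h1.1, h1.2]

end

/-! ### Derivatives on the window -/

theorem abs_sub_le_of_hasDerivAt {f f' : ℝ → ℝ} {a b C : ℝ}
    (hf : ∀ x ∈ Icc a b, HasDerivAt f (f' x) x) (hC : ∀ x ∈ Icc a b, |f' x| ≤ C) {x y : ℝ}
    (hx : x ∈ Icc a b) (hy : y ∈ Icc a b) : |f y - f x| ≤ C * |y - x| :=
  Convex.norm_image_sub_le_of_norm_hasDerivWithin_le
    (fun z hz => (hf z hz).hasDerivWithinAt) hC (convex_Icc a b) hx hy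

/-- A derivative with a Lipschitz constant `M` is controlled on an interval by the difference
quotient of the function over the interval. -/
theorem deriv_mem_of_slope {f f' : ℝ → ℝ} {a b M ε l u : ℝ} (hab : a < b)
    (hf : ∀ x ∈ Icc a b, HasDerivAt f (f' x) x)
    (hM : ∀ x ∈ Icc a b, ∀ y ∈ Icc a b, |f' x - f' y| ≤ M * |x - y|) (hM0 : 0 ≤ M)
    (hε : M * (b - a) ≤ ε) (hl : (l + ε) * (b - a) ≤ f b - f a)
    (hu : f b - f a ≤ (u - ε) * (b - a)) {x : ℝ} (hx : x ∈ Icc a b) :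
    f' x ∈ Icc l u := by
  obtain ⟨c, hc, hcs⟩ := exists_hasDerivAt_eq_slope f f' hab
    (fun z hz => (hf z hz).continuousAt.continuousWithinAt)
    (fun z hz => hf z (Ioo_subset_Icc_self hz))
  have hba : 0 < b - a := sub_pos.2 hab
  rw [← le_div_iff₀ hba, ← hcs] at hl
  rw [← div_le_iff₀ hba, ← hcs] at hu
  have h1 := hM x hx c (Ioo_subset_Icc_self hc)
  have h2 : |x - c| ≤ b - a := by
    rw [abs_le]
    constructor <;> linarith [hx.1, hx.2, hc.1, hc.2]
  have h3 := abs_le.1 (h1.trans ((mul_le_mul_of_nonneg_left h2 hM0).trans hε))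
  constructor <;> linarith [h3.1, h3.2]

theorem abs_le_of_mem_Icc {a b B x : ℝ} (ha : 0 ≤ a) (hb : b ≤ B) (hx : x ∈ Icc a b) : |x| ≤ B := by
  rw [abs_of_nonneg (ha.trans hx.1)]
  exact hx.2.trans hb

/-- The difference quotient over the window is about `0.2118`. -/
theorem avgTanhSq'_mem {s : ℝ} (hs : s ∈ Icc sLow sHigh) : avgTanhSq' s ∈ Icc 0.2 0.22 := by
  have h1 := avgTanhSq_sLow_bounds
  have h2 := avgTanhSq_sHigh_bounds
  have hB : ∀ x ∈ Icc sLow sHigh, |x| ≤ 7 / 4 := fun x =>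
    abs_le_of_mem_Icc (by norm_num [sLow]) (by norm_num [sHigh])
  refine deriv_mem_of_slope (M := 1e6) (ε := 0.004) (by norm_num [sLow, sHigh])
    (fun x _ => hasDerivAt_avgTanhSq x)
    (fun x hx y hy => abs_avgTanhSq'_sub_le (hB x hx) (hB y hy)) (by norm_num)
    (by norm_num [sLow, sHigh]) ?_ ?_ hs
  · have : (0.2 + 0.004) * (sHigh - sLow) ≤ 0.5639490802978085 - 0.5639490794916519 := by
      norm_num [sLow, sHigh]
    linarith
  · have : 0.5639490802980886 - 0.5639490794913718 ≤ (0.22 - 0.004) * (sHigh - sLow) := by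
      norm_num [sLow, sHigh]
    linarith

/-- The difference quotient over the window is about `1.2137`. -/
theorem avgMillsSq'_mem {g : ℝ} (hg : g ∈ Icc gLow gHigh) : avgMillsSq' g ∈ Icc 1.2 1.23 := by
  have h1 := avgMillsSq_gLow_bounds
  have h2 := avgMillsSq_gHigh_bounds
  have hB : ∀ x ∈ Icc gLow gHigh, |x| ≤ 5 / 4 := fun x =>
    abs_le_of_mem_Icc (by norm_num [gLow]) (by norm_num [gHigh])
  refine deriv_mem_of_slope (M := 2e6) (ε := 0.004) (by norm_num [gLow, gHigh])
    (fun x _ => hasDerivAt_avgMillsSq x)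
    (fun x hx y hy => abs_avgMillsSq'_sub_le (hB x hx) (hB y hy)) (by norm_num)
    (by norm_num [gLow, gHigh]) ?_ ?_ hg
  · have : (1.2 + 0.004) * (gHigh - gLow) ≤ 1.3485166508450199 - 1.3485166485729974 := by
      norm_num [gLow, gHigh]
    linarith
  · have : 1.3485166508461262 - 1.3485166485718912 ≤ (1.23 - 0.004) * (gHigh - gLow) := by
      norm_num [gLow, gHigh]
    linarith

theorem monotoneOn_avgTanhSq : MonotoneOn avgTanhSq (Icc sLow sHigh) :=
  monotoneOn_of_hasDerivWithinAt_nonneg (convex_Icc _ _)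
    (fun x _ => (hasDerivAt_avgTanhSq x).continuousAt.continuousWithinAt)
    (fun x _ => (hasDerivAt_avgTanhSq x).hasDerivWithinAt)
    (fun x hx => by linarith [(avgTanhSq'_mem (interior_subset hx)).1])

theorem monotoneOn_avgMillsSq : MonotoneOn avgMillsSq (Icc gLow gHigh) :=
  monotoneOn_of_hasDerivWithinAt_nonneg (convex_Icc _ _)
    (fun x _ => (hasDerivAt_avgMillsSq x).continuousAt.continuousWithinAt)
    (fun x _ => (hasDerivAt_avgMillsSq x).hasDerivWithinAt)
    (fun x hx => by linarith [(avgMillsSq'_mem (interior_subset hx)).1])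

theorem sLow_le_sHigh : sLow ≤ sHigh := by norm_num [sLow, sHigh]

theorem gLow_le_gHigh : gLow ≤ gHigh := by norm_num [gLow, gHigh]

/-- The window of `√(R(q, α))` is mapped strictly inside the window of `q`. -/
theorem avgTanhSq_mem {s : ℝ} (hs : s ∈ Icc sLow sHigh) : avgTanhSq s ∈ Ioo qLbd qUbd := by
  have h1 := monotoneOn_avgTanhSq (left_mem_Icc.2 sLow_le_sHigh) hs hs.1
  have h2 := monotoneOn_avgTanhSq hs (right_mem_Icc.2 sLow_le_sHigh) hs.2
  have h3 := avgTanhSq_sLow_bounds.1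
  have h4 := avgTanhSq_sHigh_bounds.2
  constructor
  · norm_num [qLbd] at h3 ⊢
    linarith
  · norm_num [qUbd] at h4 ⊢
    linarith

theorem avgMillsSq_mem {g : ℝ} (hg : g ∈ Icc gLow gHigh) :
    avgMillsSq g ∈ Icc 1.3485166485718912 1.3485166508461262 := by
  have h1 := monotoneOn_avgMillsSq (left_mem_Icc.2 gLow_le_gHigh) hg hg.1
  have h2 := monotoneOn_avgMillsSq hg (right_mem_Icc.2 gLow_le_gHigh) hg.2
  exact ⟨avgMillsSq_gLow_bounds.1.trans h1, h2.trans avgMillsSq_gHigh_bounds.2⟩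

/-! ### The recursion in terms of Gaussian averages -/

/-- `√(q / (1 - q))`, the factor of `z` in the arguments of `𝓔` and `Φ̄`. -/
noncomputable def oddsRoot (q : ℝ) : ℝ := √(q / (1 - q))

/-- `R(q, 1)`. -/
noncomputable def unitR (q : ℝ) : ℝ := avgMillsSq (oddsRoot q) / (1 - q)

theorem recP_eq (ψ : ℝ) : recP ψ = avgTanhSq √ψ := rfl

section

variable {q : ℝ}

theorem zero_sub_sqrt_mul_div (hq0 : 0 ≤ q) (z : ℝ) :
    (0 - √q * z) / √(1 - q) = oddsRoot q * -z := by
  rw [oddsRoot, Real.sqrt_div hq0]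
  ring

theorem funF_sq_mul_eq (hq0 : 0 ≤ q) (hq1 : q < 1) (z : ℝ) :
    funF 0 q (√q * z) ^ 2 * gaussDensity z
      = (1 - q)⁻¹ * (millsE (oddsRoot q * -z) ^ 2 * gaussDensity (-z)) := by
  rw [funF, zero_sub_sqrt_mul_div hq0, div_pow, Real.sq_sqrt (by linarith), gaussDensity_neg]
  ring

theorem integrable_funF_sq (hq0 : 0 ≤ q) (hq1 : q < 1) :
    Integrable fun z : ℝ => funF 0 q (√q * z) ^ 2 * gaussDensity z := by
  simp only [funF_sq_mul_eq hq0 hq1]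
  exact ((integrable_millsE_sq (oddsRoot q)).comp_neg).const_mul _

theorem recR_eq (hq0 : 0 ≤ q) (hq1 : q < 1) (α : ℝ) : recR 0 q α = α * unitR q := by
  simp only [recR, funF_sq_mul_eq hq0 hq1]
  rw [integral_const_mul,
    integral_neg_eq_self (fun z => millsE (oddsRoot q * z) ^ 2 * gaussDensity z)]
  rw [unitR, avgMillsSq]
  ring

theorem log_gaussTail_mul_eq (hq0 : 0 ≤ q) (z : ℝ) :
    Real.log (gaussTail ((0 - √q * z) / √(1 - q))) * gaussDensity z
      = Real.log (gaussTail (oddsRoot q * -z)) * gaussDensity (-z) := by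
  rw [zero_sub_sqrt_mul_div hq0, gaussDensity_neg]

theorem integrable_log_gaussTail_oddsRoot (hq0 : 0 ≤ q) :
    Integrable fun z : ℝ =>
      Real.log (gaussTail ((0 - √q * z) / √(1 - q))) * gaussDensity z := by
  simp only [log_gaussTail_mul_eq hq0]
  exact (integrable_log_gaussTail (oddsRoot q)).comp_neg

theorem funG_eq (hq0 : 0 ≤ q) (α ψ : ℝ) : funG 0 α q ψ
    = -(ψ * (1 - q)) / 2 + avgLogCosh √ψ + α * avgLogTail (oddsRoot q) := by
  simp only [funG, log_gaussTail_mul_eq hq0]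
  rw [integral_neg_eq_self (fun z => Real.log (gaussTail (oddsRoot q * z)) * gaussDensity z)]
  rfl

theorem hasDerivAt_oddsRoot (hq0 : 0 < q) (hq1 : q < 1) :
    HasDerivAt oddsRoot (1 / (2 * oddsRoot q * (1 - q) ^ 2)) q := by
  have h1 : 0 < 1 - q := by linarith
  have h := ((hasDerivAt_id q).div ((hasDerivAt_id q).const_sub 1) h1.ne').sqrt
    (div_pos hq0 h1).ne'
  refine h.congr_deriv ?_
  simp only [Pi.div_apply, id]
  rw [← oddsRoot]
  have h2 : 0 < oddsRoot q := Real.sqrt_pos.2 (div_pos hq0 h1)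
  field_simp
  ring

theorem hasDerivAt_unitR (hq0 : 0 < q) (hq1 : q < 1) :
    HasDerivAt unitR (avgMillsSq' (oddsRoot q) / (2 * oddsRoot q * (1 - q) ^ 3)
      + avgMillsSq (oddsRoot q) / (1 - q) ^ 2) q := by
  have h1 : 0 < 1 - q := by linarith
  have h := (((hasDerivAt_avgMillsSq (oddsRoot q)).comp q (hasDerivAt_oddsRoot hq0 hq1))).div
    ((hasDerivAt_id q).const_sub 1) h1.ne'
  refine h.congr_deriv ?_
  have h2 : 0 < oddsRoot q := Real.sqrt_pos.2 (div_pos hq0 h1)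
  simp only [id, Function.comp]
  field_simp
  ring

theorem oddsRoot_sq (hq0 : 0 ≤ q) (hq1 : q < 1) : oddsRoot q ^ 2 = q / (1 - q) :=
  Real.sq_sqrt (div_nonneg hq0 (by linarith))

theorem hasDerivAt_avgLogTail_oddsRoot (hq0 : 0 < q) (hq1 : q < 1) :
    HasDerivAt (fun q => avgLogTail (oddsRoot q)) (-unitR q / 2) q := by
  have h1 : 0 < 1 - q := by linarith
  have h2 : 0 < oddsRoot q := Real.sqrt_pos.2 (div_pos hq0 h1)
  refine ((hasDerivAt_avgLogTail (oddsRoot q)).comp q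
    (hasDerivAt_oddsRoot hq0 hq1)).congr_deriv ?_
  have h3 : 1 + oddsRoot q ^ 2 = (1 - q)⁻¹ := by
    rw [oddsRoot_sq hq0.le hq1]
    field_simp
    ring
  rw [h3, unitR]
  field_simp

theorem hasDerivAt_avgLogCosh_sqrt {ψ : ℝ} (hψ : 0 < ψ) :
    HasDerivAt (fun ψ => avgLogCosh √ψ) ((1 - avgTanhSq √ψ) / 2) ψ := by
  refine ((hasDerivAt_avgLogCosh √ψ).comp ψ (Real.hasDerivAt_sqrt hψ.ne')).congr_deriv ?_
  have := Real.sqrt_pos.2 hψ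
  field_simp

end

/-! ### The windows of the parameters -/

section

variable {q α : ℝ}

theorem pos_of_mem_window (hq : q ∈ Icc qLbd qUbd) : 0 < q := by
  have h := hq.1
  norm_num [qLbd] at h
  linarith

theorem lt_one_of_mem_window (hq : q ∈ Icc qLbd qUbd) : q < 1 := by
  have h := hq.2
  norm_num [qUbd] at h
  linarith

theorem oddsRoot_mem (hq : q ∈ Icc qLbd qUbd) : oddsRoot q ∈ Icc gLow gHigh := by
  have hq1 := lt_one_of_mem_window hq
  have h1 : 0 < 1 - q := by linarith
  have hl := hq.1
  have hu := hq.2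
  norm_num [qLbd] at hl
  norm_num [qUbd] at hu
  constructor
  · refine Real.le_sqrt_of_sq_le ?_
    rw [le_div_iff₀ h1]
    norm_num [gLow]
    linarith
  · refine (Real.sqrt_le_left (by norm_num [gHigh])).2 ?_
    rw [div_le_iff₀ h1]
    norm_num [gHigh]
    linarith

theorem unitR_mem (hq : q ∈ Icc qLbd qUbd) :
    unitR q ∈ Icc (1.3485166485718912 / (1 - qLbd)) (1.3485166508461262 / (1 - qUbd)) := by
  obtain ⟨h1, h2⟩ := avgMillsSq_mem (oddsRoot_mem hq)
  have h3 := lt_one_of_mem_window hq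
  have h4 : 0 < 1 - qUbd := by norm_num [qUbd]
  have h5 := hq.1
  have h6 := hq.2
  constructor
  · refine div_le_div₀ (by linarith) h1 (by linarith) (by linarith)
  · refine div_le_div₀ (by norm_num) h2 h4 (by linarith)

/-- `sLow` and `sHigh` are chosen so that this holds. -/
theorem alpha_mul_unitR_mem (hα : α ∈ Icc alphaLbd alphaUbd) (hq : q ∈ Icc qLbd qUbd) :
    α * unitR q ∈ Icc (sLow ^ 2) (sHigh ^ 2) := by
  obtain ⟨h1, h2⟩ := unitR_mem hq
  obtain ⟨h3, h4⟩ := hα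
  have h5 : sLow ^ 2 ≤ alphaLbd * (1.3485166485718912 / (1 - qLbd)) := by
    norm_num [sLow, alphaLbd, qLbd]
  have h6 : alphaUbd * (1.3485166508461262 / (1 - qUbd)) ≤ sHigh ^ 2 := by
    norm_num [sHigh, alphaUbd, qUbd]
  have h7 : 0 ≤ alphaLbd := by norm_num [alphaLbd]
  have h8 : 0 ≤ 1.3485166485718912 / (1 - qLbd) := by norm_num [qLbd]
  constructor
  · exact h5.trans (mul_le_mul h3 h1 h8 (h7.trans h3))
  · exact (mul_le_mul h4 h2 (h8.trans h1) (h7.trans (h3.trans h4))).trans h6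

theorem sqrt_mem_window {ψ : ℝ} (hψ : ψ ∈ Icc (sLow ^ 2) (sHigh ^ 2)) : √ψ ∈ Icc sLow sHigh :=
  ⟨Real.le_sqrt_of_sq_le hψ.1, (Real.sqrt_le_left (by norm_num [sHigh])).2 hψ.2⟩

theorem pos_of_mem_window_sq {ψ : ℝ} (hψ : ψ ∈ Icc (sLow ^ 2) (sHigh ^ 2)) : 0 < ψ :=
  lt_of_lt_of_le (by norm_num [sLow]) hψ.1

/-- The derivative of `unitR`. -/
noncomputable def unitR' (q : ℝ) : ℝ :=
  avgMillsSq' (oddsRoot q) / (2 * oddsRoot q * (1 - q) ^ 3)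
    + avgMillsSq (oddsRoot q) / (1 - q) ^ 2

theorem unitR'_mem (hq : q ∈ Icc qLbd qUbd) : unitR' q ∈ Icc 0 14 := by
  obtain ⟨h1, h2⟩ := avgMillsSq_mem (oddsRoot_mem hq)
  obtain ⟨h3, h4⟩ := avgMillsSq'_mem (oddsRoot_mem hq)
  obtain ⟨h5, h6⟩ := oddsRoot_mem hq
  have h7 : gLow = 1.13723794589843 := rfl
  have h8 : 0.436 ≤ 1 - q := by
    have := hq.2
    norm_num [qUbd] at this
    linarith
  rw [h7] at h5
  have h9 : 0 < 1 - q := by linarith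
  have h10 : 0 < oddsRoot q := by linarith
  have h11 : 0 < avgMillsSq (oddsRoot q) := by linarith
  have h12 : 0 < avgMillsSq' (oddsRoot q) := by linarith
  constructor
  · unfold unitR'
    positivity
  · calc unitR' q ≤ 1.23 / (2 * 1.13723794589843 * 0.436 ^ 3) + 1.3485166508461262 / 0.436 ^ 2 := by
          unfold unitR'
          gcongr
      _ ≤ 14 := by norm_num

/-- The derivative of `q ↦ P(R(q, α))`. -/
noncomputable def composite' (α q : ℝ) : ℝ :=
  avgTanhSq' √(α * unitR q) * (α * unitR' q / (2 * √(α * unitR q)))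

theorem hasDerivAt_composite (hα : α ∈ Icc alphaLbd alphaUbd) (hq : q ∈ Icc qLbd qUbd) :
    HasDerivAt (fun q => recP (recR 0 q α)) (composite' α q) q := by
  have hq0 := pos_of_mem_window hq
  have hq1 := lt_one_of_mem_window hq
  have h := (hasDerivAt_avgTanhSq √(α * unitR q)).comp q
    ((((hasDerivAt_unitR hq0 hq1).const_mul α)).sqrt
      (pos_of_mem_window_sq (alpha_mul_unitR_mem hα hq)).ne')
  refine h.congr_of_eventuallyEq ?_
  filter_upwards [isOpen_Ioo.mem_nhds (show q ∈ Ioo 0 1 from ⟨hq0, hq1⟩)] with x hx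
  rw [recP_eq, recR_eq hx.1.le hx.2]
  rfl

theorem composite'_mem (hα : α ∈ Icc alphaLbd alphaUbd) (hq : q ∈ Icc qLbd qUbd) :
    composite' α q ∈ Icc 0 0.8 := by
  have hs := sqrt_mem_window (alpha_mul_unitR_mem hα hq)
  obtain ⟨h1, h2⟩ := avgTanhSq'_mem hs
  obtain ⟨h3, h4⟩ := unitR'_mem hq
  have h5 := hα.1
  have h6 := hα.2
  norm_num [alphaLbd] at h5
  norm_num [alphaUbd] at h6
  have h7 : 1.605 ≤ √(α * unitR q) := by
    refine le_trans ?_ hs.1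
    norm_num [sLow]
  have h8 : 0 < √(α * unitR q) := by linarith
  have h9 : 0 < α := by linarith
  have h10 : 0 ≤ avgTanhSq' √(α * unitR q) := by linarith
  have h11 : α ≤ 0.8331 := by linarith
  constructor
  · unfold composite'
    positivity
  · calc composite' α q ≤ 0.22 * (0.8331 * 14 / (2 * 1.605)) := by
          unfold composite'
          gcongr
      _ ≤ 0.8 := by norm_num

end

/-! ### The fixed point -/

section

variable {q α : ℝ}

theorem recP_recR_mem (hα : α ∈ Icc alphaLbd alphaUbd) (hq : q ∈ Icc qLbd qUbd) :
    recP (recR 0 q α) ∈ Ioo qLbd qUbd := by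
  rw [recP_eq, recR_eq (pos_of_mem_window hq).le (lt_one_of_mem_window hq)]
  exact avgTanhSq_mem (sqrt_mem_window (alpha_mul_unitR_mem hα hq))

theorem abs_recP_recR_sub_le (hα : α ∈ Icc alphaLbd alphaUbd) {p : ℝ}
    (hp : p ∈ Icc qLbd qUbd) (hq : q ∈ Icc qLbd qUbd) :
    |recP (recR 0 q α) - recP (recR 0 p α)| ≤ 0.8 * |q - p| :=
  abs_sub_le_of_hasDerivAt (fun _ hx => hasDerivAt_composite hα hx)
    (fun _ hx => abs_le_of_mem_Icc le_rfl le_rfl (composite'_mem hα hx)) hp hq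

theorem exists_fixedPoint (hα : α ∈ Icc alphaLbd alphaUbd) :
    ∃ q ∈ Ioo qLbd qUbd, q = recP (recR 0 q α) := by
  have hle : qLbd ≤ qUbd := by norm_num [qLbd, qUbd]
  have hl := recP_recR_mem hα (left_mem_Icc.2 hle)
  have hu := recP_recR_mem hα (right_mem_Icc.2 hle)
  have hc : ContinuousOn (fun q => recP (recR 0 q α) - q) (Icc qLbd qUbd) := fun q hq =>
    ((hasDerivAt_composite hα hq).continuousAt.sub continuousAt_id).continuousWithinAt
  obtain ⟨q, hq, h0⟩ := intermediate_value_Icc' hle hc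
    (show (0 : ℝ) ∈ Icc _ _ from ⟨by linarith [hu.2], by linarith [hl.1]⟩)
  have hfix : q = recP (recR 0 q α) := by
    simp only at h0
    linarith
  exact ⟨q, hfix ▸ recP_recR_mem hα hq, hfix⟩

theorem fixedPoint_unique (hα : α ∈ Icc alphaLbd alphaUbd) {p : ℝ} (hp : p ∈ Icc qLbd qUbd)
    (hq : q ∈ Icc qLbd qUbd) (hpf : p = recP (recR 0 p α)) (hqf : q = recP (recR 0 q α)) :
    q = p := by
  have h := abs_recP_recR_sub_le hα hp hq
  rw [← hpf, ← hqf] at h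
  have h1 : |q - p| = 0 := le_antisymm (by linarith [abs_nonneg (q - p)]) (abs_nonneg _)
  exact sub_eq_zero.1 (abs_eq_zero.1 h1)

/-! ### The functional `𝓖` on the window -/

/-- On the window, `𝓖` is almost stationary in `(q, ψ)`: its partial derivatives are
`(ψ - α R(q, 1)) / 2` and `(q - P(ψ)) / 2`, which are bounded by the sizes of the windows. -/
theorem abs_funG_sub_le (hα : α ∈ Icc alphaLbd alphaUbd) {p ψ χ : ℝ}
    (hp : p ∈ Icc qLbd qUbd) (hq : q ∈ Icc qLbd qUbd)
    (hψ : ψ ∈ Icc (sLow ^ 2) (sHigh ^ 2)) (hχ : χ ∈ Icc (sLow ^ 2) (sHigh ^ 2)) :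
    |funG 0 α q χ - funG 0 α p ψ| ≤ 1e-9 * |χ - ψ| + 1e-8 * |q - p| := by
  have hψd : ∀ x ∈ Icc (sLow ^ 2) (sHigh ^ 2),
      HasDerivAt (fun x => avgLogCosh √x - x * (1 - p) / 2)
        ((1 - avgTanhSq √x) / 2 - 1 * (1 - p) / 2) x := fun x hx =>
    (hasDerivAt_avgLogCosh_sqrt (pos_of_mem_window_sq hx)).sub
      (((hasDerivAt_id x).mul_const (1 - p)).div_const 2)
  have hqd : ∀ x ∈ Icc qLbd qUbd, HasDerivAt (fun x => α * avgLogTail (oddsRoot x) + χ * x / 2)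
      (α * (-unitR x / 2) + χ * 1 / 2) x := fun x hx =>
    ((hasDerivAt_avgLogTail_oddsRoot (pos_of_mem_window hx) (lt_one_of_mem_window hx)).const_mul
      α).add (((hasDerivAt_id x).const_mul χ).div_const 2)
  have hqw : qUbd - qLbd ≤ 1e-9 := by norm_num [qUbd, qLbd]
  have hsw : sHigh ^ 2 - sLow ^ 2 ≤ 2e-8 := by norm_num [sHigh, sLow]
  have h1 := abs_sub_le_of_hasDerivAt (C := 1e-9) hψd (fun x hx => by
    have h := avgTanhSq_mem (sqrt_mem_window hx)
    rw [abs_le]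
    constructor <;> linarith [h.1, h.2, hp.1, hp.2]) hψ hχ
  have h2 := abs_sub_le_of_hasDerivAt (C := 1e-8) hqd (fun x hx => by
    have h := alpha_mul_unitR_mem hα hx
    rw [abs_le]
    constructor <;> linarith [h.1, h.2, hχ.1, hχ.2]) hp hq
  have h3 : funG 0 α q χ - funG 0 α p ψ
      = ((avgLogCosh √χ - χ * (1 - p) / 2) - (avgLogCosh √ψ - ψ * (1 - p) / 2))
        + ((α * avgLogTail (oddsRoot q) + χ * q / 2)
          - (α * avgLogTail (oddsRoot p) + χ * p / 2)) := by
    rw [funG_eq (pos_of_mem_window hp).le, funG_eq (pos_of_mem_window hq).le]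
    ring
  rw [h3]
  exact (abs_add_le _ _).trans (add_le_add h1 h2)

theorem funG_sub_funG (hq : q ∈ Icc qLbd qUbd) (β ψ : ℝ) :
    funG 0 β q ψ - funG 0 α q ψ = (β - α) * avgLogTail (oddsRoot q) := by
  have h := (pos_of_mem_window hq).le
  rw [funG_eq h, funG_eq h]
  ring

theorem avgLogTail_oddsRoot_qLbd_mem :
    avgLogTail (oddsRoot qLbd) ∈ Icc (-1.08677801893) (-1.08677801892) := by
  have hle : qLbd ≤ qUbd := by norm_num [qLbd, qUbd]
  have hg := oddsRoot_mem (left_mem_Icc.2 hle)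
  have hgw : oddsRoot qLbd - gLow ≤ 2e-14 := by
    have : oddsRoot qLbd ≤ gLow + 2e-14 := by
      refine (Real.sqrt_le_left (by norm_num [gLow])).2 ?_
      norm_num [gLow, qLbd]
    linarith
  have h1 := abs_sub_le_of_hasDerivAt (f := avgLogTail) (C := 1.35)
    (fun x _ => hasDerivAt_avgLogTail x) (fun x hx => by
      obtain ⟨h2, h3⟩ := avgMillsSq_mem hx
      have h4 : 0 < x := lt_of_lt_of_le (by norm_num [gLow]) hx.1
      have h5 : x / (1 + x ^ 2) ≤ 1 := by
        rw [div_le_one (by positivity)]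
        nlinarith [sq_nonneg (x - 1)]
      have h6 : 0 ≤ avgMillsSq x := by linarith
      rw [abs_neg, abs_of_nonneg (by positivity)]
      calc x / (1 + x ^ 2) * avgMillsSq x ≤ 1 * 1.3485166508461262 := by gcongr
        _ ≤ 1.35 := by norm_num) (left_mem_Icc.2 gLow_le_gHigh) hg
  rw [abs_of_nonneg (sub_nonneg.2 hg.1)] at h1
  obtain ⟨h2, h3⟩ := abs_le.1 h1
  obtain ⟨h4, h5⟩ := avgLogTail_gLow_bounds
  constructor <;> linarith

theorem avgLogTail_oddsRoot_mem (hq : q ∈ Icc qLbd qUbd) :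
    avgLogTail (oddsRoot q) ∈ Icc (-1.087) (-1.086) := by
  have hle : qLbd ≤ qUbd := by norm_num [qLbd, qUbd]
  have h1 := abs_sub_le_of_hasDerivAt (C := 2)
    (fun x hx => hasDerivAt_avgLogTail_oddsRoot (pos_of_mem_window hx) (lt_one_of_mem_window hx))
    (fun x hx => by
      obtain ⟨h2, h3⟩ := unitR_mem hx
      norm_num [qLbd] at h2
      norm_num [qUbd] at h3
      rw [abs_le]
      constructor <;> linarith) (left_mem_Icc.2 hle) hq
  have h2 : qUbd - qLbd ≤ 1e-9 := by norm_num [qUbd, qLbd]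
  rw [abs_of_nonneg (sub_nonneg.2 hq.1)] at h1
  obtain ⟨h3, h4⟩ := abs_le.1 h1
  obtain ⟨h5, h6⟩ := avgLogTail_oddsRoot_qLbd_mem
  constructor <;> linarith [hq.2]

/-- The value of `𝓖` at the lower corner of the window. -/
theorem funG_corner_mem : funG 0 alphaLbd qLbd (sLow ^ 2) ∈ Icc 7.7e-10 8.2e-10 := by
  obtain ⟨h1, h2⟩ := avgLogCosh_sLow_bounds
  obtain ⟨h3, h4⟩ := avgLogTail_oddsRoot_qLbd_mem
  rw [funG_eq (by norm_num [qLbd]), Real.sqrt_sq (by norm_num [sLow])]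
  norm_num [sLow, qLbd, alphaLbd] at h1 h2 h3 h4 ⊢
  constructor <;> linarith

/-! ### Dependence of the fixed point on `α` -/

theorem hasDerivAt_recP {ψ : ℝ} (hψ : 0 < ψ) :
    HasDerivAt recP (avgTanhSq' √ψ * (1 / (2 * √ψ))) ψ :=
  (hasDerivAt_avgTanhSq √ψ).comp ψ (Real.hasDerivAt_sqrt hψ.ne')

theorem abs_recP_sub_le {ψ χ : ℝ} (hψ : ψ ∈ Icc (sLow ^ 2) (sHigh ^ 2))
    (hχ : χ ∈ Icc (sLow ^ 2) (sHigh ^ 2)) : |recP χ - recP ψ| ≤ 0.07 * |χ - ψ| :=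
  abs_sub_le_of_hasDerivAt (fun _ hx => hasDerivAt_recP (pos_of_mem_window_sq hx)) (fun x hx => by
    have hs := sqrt_mem_window hx
    obtain ⟨h1, h2⟩ := avgTanhSq'_mem hs
    have h3 : 1.605 ≤ √x := le_trans (by norm_num [sLow]) hs.1
    have h4 : 0 < √x := by linarith
    have h5 : 0 ≤ avgTanhSq' √x := by linarith
    rw [abs_of_nonneg (by positivity)]
    calc avgTanhSq' √x * (1 / (2 * √x)) ≤ 0.22 * (1 / (2 * 1.605)) := by gcongr
      _ ≤ 0.07 := by norm_num) hψ hχ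

theorem unitR_mem_Icc (hq : q ∈ Icc qLbd qUbd) : unitR q ∈ Icc 0 3.2 := by
  obtain ⟨h1, h2⟩ := unitR_mem hq
  norm_num [qLbd] at h1
  norm_num [qUbd] at h2
  constructor <;> linarith

/-- The contraction property in `q` makes the fixed point a Lipschitz function of `α`. -/
theorem abs_fixedPoint_sub_le {β p : ℝ} (hα : α ∈ Icc alphaLbd alphaUbd)
    (hβ : β ∈ Icc alphaLbd alphaUbd) (hp : p ∈ Icc qLbd qUbd) (hq : q ∈ Icc qLbd qUbd)
    (hpf : p = recP (recR 0 p α)) (hqf : q = recP (recR 0 q β)) : |q - p| ≤ 2 * |β - α| := by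
  have h1 := abs_recP_recR_sub_le hβ hp hq
  have h2 : |recP (recR 0 p β) - recP (recR 0 p α)| ≤ 0.07 * |(β - α) * unitR p| := by
    have h := abs_recP_sub_le (alpha_mul_unitR_mem hα hp) (alpha_mul_unitR_mem hβ hp)
    rw [← sub_mul] at h
    simp only [recR_eq (pos_of_mem_window hp).le (lt_one_of_mem_window hp)]
    exact h
  obtain ⟨h3, h4⟩ := unitR_mem_Icc hp
  rw [abs_mul, abs_of_nonneg h3] at h2
  have h5 : |β - α| * unitR p ≤ |β - α| * 3.2 := by gcongr
  rw [← hqf] at h1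
  rw [← hpf] at h2
  have h6 := abs_sub_le q (recP (recR 0 p β)) p
  linarith [abs_nonneg (β - α), abs_nonneg (q - p)]

theorem abs_recR_fixedPoint_sub_le {β p : ℝ} (hα : α ∈ Icc alphaLbd alphaUbd)
    (hβ : β ∈ Icc alphaLbd alphaUbd) (hp : p ∈ Icc qLbd qUbd) (hq : q ∈ Icc qLbd qUbd)
    (hpf : p = recP (recR 0 p α)) (hqf : q = recP (recR 0 q β)) :
    |recR 0 q β - recR 0 p α| ≤ 30 * |β - α| := by
  have h1 := abs_fixedPoint_sub_le hα hβ hp hq hpf hqf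
  have h2 : |unitR q - unitR p| ≤ 14 * |q - p| :=
    abs_sub_le_of_hasDerivAt
      (fun _ hx => hasDerivAt_unitR (pos_of_mem_window hx) (lt_one_of_mem_window hx))
      (fun _ hx => abs_le_of_mem_Icc le_rfl le_rfl (unitR'_mem hx)) hp hq
  obtain ⟨h3, h4⟩ := unitR_mem_Icc hp
  have h5 : 0 ≤ β := le_trans (by norm_num [alphaLbd]) hβ.1
  have h6 : β ≤ 0.84 := hβ.2.trans (by norm_num [alphaUbd])
  rw [recR_eq (pos_of_mem_window hp).le (lt_one_of_mem_window hp),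
    recR_eq (pos_of_mem_window hq).le (lt_one_of_mem_window hq)]
  have h7 : β * unitR q - α * unitR p = β * (unitR q - unitR p) + (β - α) * unitR p := by ring
  rw [h7]
  calc |β * (unitR q - unitR p) + (β - α) * unitR p|
      ≤ |β * (unitR q - unitR p)| + |(β - α) * unitR p| := abs_add_le _ _
    _ = β * |unitR q - unitR p| + |β - α| * unitR p := by
      rw [abs_mul, abs_mul, abs_of_nonneg h5, abs_of_nonneg h3]
    _ ≤ 0.84 * (14 * (2 * |β - α|)) + |β - α| * 3.2 := by
      gcongr
      linarith
    _ ≤ 30 * |β - α| := by linarith [abs_nonneg (β - α)]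

theorem recR_mem (hα : α ∈ Icc alphaLbd alphaUbd) (hq : q ∈ Icc qLbd qUbd) :
    recR 0 q α ∈ Icc (sLow ^ 2) (sHigh ^ 2) := by
  rw [recR_eq (pos_of_mem_window hq).le (lt_one_of_mem_window hq)]
  exact alpha_mul_unitR_mem hα hq

/-- Along the curve of fixed points, the derivative of `𝓖` is `∫ log Φ̄(-√(q / (1 - q)) z) φ(z) dz`
up to a small error. -/
theorem funG_fixedPoint_sub_mem {β p : ℝ} (hα : α ∈ Icc alphaLbd alphaUbd)
    (hβ : β ∈ Icc alphaLbd alphaUbd) (hp : p ∈ Icc qLbd qUbd) (hq : q ∈ Icc qLbd qUbd)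
    (hpf : p = recP (recR 0 p α)) (hqf : q = recP (recR 0 q β)) (hαβ : α ≤ β) :
    funG 0 β q (recR 0 q β) - funG 0 α p (recR 0 p α) ∈ Icc (-2 * (β - α)) (-1 * (β - α)) := by
  have h0 : 0 ≤ β - α := sub_nonneg.2 hαβ
  have h1 := abs_fixedPoint_sub_le hα hβ hp hq hpf hqf
  have h2 := abs_recR_fixedPoint_sub_le hα hβ hp hq hpf hqf
  rw [abs_of_nonneg h0] at h1 h2
  obtain ⟨h3, h4⟩ := abs_le.1 (abs_funG_sub_le hβ hp hq (recR_mem hα hp) (recR_mem hβ hq))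
  have h5 := funG_sub_funG (α := α) hp β (recR 0 p α)
  obtain ⟨h6, h7⟩ := avgLogTail_oddsRoot_mem hp
  have h8 : (β - α) * -1.087 ≤ (β - α) * avgLogTail (oddsRoot p) := by gcongr
  have h9 : (β - α) * avgLogTail (oddsRoot p) ≤ (β - α) * -1.086 := by gcongr
  constructor <;> linarith

/-- Comparison with the lower corner of the window. -/
theorem funG_recR_mem (hα : α ∈ Icc alphaLbd alphaUbd) (hq : q ∈ Icc qLbd qUbd) :
    funG 0 α q (recR 0 q α) ∈ Icc (7.6e-10 - 1.087 * (α - alphaLbd))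
      (8.3e-10 - 1.086 * (α - alphaLbd)) := by
  have h0 : 0 ≤ α - alphaLbd := sub_nonneg.2 hα.1
  have hlq : qLbd ∈ Icc qLbd qUbd := left_mem_Icc.2 (by norm_num [qLbd, qUbd])
  have hls : sLow ^ 2 ∈ Icc (sLow ^ 2) (sHigh ^ 2) :=
    left_mem_Icc.2 (by norm_num [sLow, sHigh])
  have hr := recR_mem hα hq
  have h1 : |q - qLbd| ≤ 1e-9 := by
    have : qUbd - qLbd ≤ 1e-9 := by norm_num [qUbd, qLbd]
    rw [abs_of_nonneg (sub_nonneg.2 hq.1)]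
    linarith [hq.2]
  have h2 : |recR 0 q α - sLow ^ 2| ≤ 2e-8 := by
    have : sHigh ^ 2 - sLow ^ 2 ≤ 2e-8 := by norm_num [sHigh, sLow]
    rw [abs_of_nonneg (sub_nonneg.2 hr.1)]
    linarith [hr.2]
  obtain ⟨h3, h4⟩ := abs_le.1 (abs_funG_sub_le hα hlq hq hls hr)
  have h5 := funG_sub_funG (α := alphaLbd) hlq α (sLow ^ 2)
  obtain ⟨h6, h7⟩ := avgLogTail_oddsRoot_mem hlq
  obtain ⟨h10, h11⟩ := funG_corner_mem
  have h8 : (α - alphaLbd) * -1.087 ≤ (α - alphaLbd) * avgLogTail (oddsRoot qLbd) := by gcongr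
  have h9 : (α - alphaLbd) * avgLogTail (oddsRoot qLbd) ≤ (α - alphaLbd) * -1.086 := by gcongr
  constructor <;> linarith

end

theorem proposition1 :
    ∃ qStar : ℝ → ℝ,
      (∀ α ∈ Ioo alphaLbd alphaUbd,
        -- the integrals defining `R(q,α)` and `P(R(q,α))` converge, and
        -- `q ↦ P(R(q,α))` is differentiable with `sup dP(R(q,α))/dq < 1`
        (∀ q ∈ Ioo qLbd qUbd,
          Integrable (fun z : ℝ => funF 0 q (√q * z) ^ 2 * gaussDensity z) ∧
          Integrable (fun z : ℝ => Real.tanh (√(recR 0 q α) * z) ^ 2 * gaussDensity z) ∧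
          DifferentiableAt ℝ (fun q' : ℝ => recP (recR 0 q' α)) q) ∧
        (∃ s : ℝ, IsLUB ((fun q : ℝ => deriv (fun q' : ℝ => recP (recR 0 q' α)) q) ''
            Ioo qLbd qUbd) s ∧ s < 1) ∧
        -- `qStar α` is the unique fixed point in the interval
        (qStar α ∈ Ioo qLbd qUbd ∧ qStar α = recP (recR 0 (qStar α) α) ∧
          ∀ q ∈ Ioo qLbd qUbd, q = recP (recR 0 q α) → q = qStar α) ∧
        -- the integrals defining `𝓖(α, qStar α, R(qStar α, α))` converge
        Integrable (fun z : ℝ =>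
          Real.log (2 * Real.cosh (√(recR 0 (qStar α) α) * z)) * gaussDensity z) ∧
        Integrable (fun z : ℝ =>
          Real.log (gaussTail ((0 - √(qStar α) * z) / √(1 - qStar α))) * gaussDensity z)) ∧
      StrictAntiOn (fun α : ℝ => funG 0 α (qStar α) (recR 0 (qStar α) α))
        (Ioo alphaLbd alphaUbd) ∧
      ∃! αStar : ℝ, αStar ∈ Ioo alphaLbd alphaUbd ∧
        funG 0 αStar (qStar αStar) (recR 0 (qStar αStar) αStar) = 0 := by
  have hwin : Ioo alphaLbd alphaUbd ⊆ Icc alphaLbd alphaUbd := Ioo_subset_Icc_self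
  have hex : ∀ α, α ∈ Ioo alphaLbd alphaUbd → ∃ q ∈ Ioo qLbd qUbd, q = recP (recR 0 q α) :=
    fun α hα => exists_fixedPoint (hwin hα)
  choose! qStar hmem hfix using hex
  have hstep : ∀ α ∈ Ioo alphaLbd alphaUbd, ∀ β ∈ Ioo alphaLbd alphaUbd, α ≤ β →
      funG 0 β (qStar β) (recR 0 (qStar β) β) - funG 0 α (qStar α) (recR 0 (qStar α) α)
        ∈ Icc (-2 * (β - α)) (-1 * (β - α)) := fun α hα β hβ =>
    funG_fixedPoint_sub_mem (hwin hα) (hwin hβ) (Ioo_subset_Icc_self (hmem α hα))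
      (Ioo_subset_Icc_self (hmem β hβ)) (hfix α hα) (hfix β hβ)
  have hanti : StrictAntiOn (fun α : ℝ => funG 0 α (qStar α) (recR 0 (qStar α) α))
      (Ioo alphaLbd alphaUbd) := fun α hα β hβ hαβ => by
    have := (hstep α hα β hβ hαβ.le).2
    simp only
    linarith
  refine ⟨qStar, fun α hα => ⟨fun q hq => ?_, ?_, ⟨hmem α hα, hfix α hα, fun q hq hqf => ?_⟩,
    integrable_log_cosh _, ?_⟩, hanti, ?_⟩
  · have hq' := Ioo_subset_Icc_self hq
    exact ⟨integrable_funF_sq (pos_of_mem_window hq').le (lt_one_of_mem_window hq'),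
      integrable_tanh_sq _, (hasDerivAt_composite (hwin hα) hq').differentiableAt⟩
  · have hub : (0.8 : ℝ) ∈ upperBounds ((fun q : ℝ =>
        deriv (fun q' : ℝ => recP (recR 0 q' α)) q) '' Ioo qLbd qUbd) := by
      rintro _ ⟨q, hq, rfl⟩
      have hq' := Ioo_subset_Icc_self hq
      simp only [(hasDerivAt_composite (hwin hα) hq').deriv]
      exact (composite'_mem (hwin hα) hq').2
    have hlub := isLUB_csSup ((nonempty_Ioo.2 (by norm_num [qLbd, qUbd])).image _) ⟨_, hub⟩
    exact ⟨_, hlub, (hlub.2 hub).trans_lt (by norm_num)⟩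
  · exact fixedPoint_unique (hwin hα) (Ioo_subset_Icc_self (hmem α hα)) (Ioo_subset_Icc_self hq)
      (hfix α hα) hqf
  · exact integrable_log_gaussTail_oddsRoot
      (pos_of_mem_window (Ioo_subset_Icc_self (hmem α hα))).le
  -- the sign changes inside `[alphaLbd + 1e-10, alphaLbd + 9e-10]`, where
  -- `7.6e-10 - 1.087e-10 > 0` and `8.3e-10 - 1.086 * 9e-10 < 0`
  · have hsub : Icc (alphaLbd + 1e-10) (alphaLbd + 9e-10) ⊆ Ioo alphaLbd alphaUbd := by
      rintro x ⟨h1, h2⟩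
      have h3 : alphaUbd = alphaLbd + 1e-9 := by norm_num [alphaUbd, alphaLbd]
      constructor <;> linarith
    have hle : alphaLbd + 1e-10 ≤ alphaLbd + 9e-10 := by linarith
    have hcont : ContinuousOn (fun α : ℝ => funG 0 α (qStar α) (recR 0 (qStar α) α))
        (Icc (alphaLbd + 1e-10) (alphaLbd + 9e-10)) := by
      refine LipschitzOnWith.continuousOn (K := 2) (LipschitzOnWith.of_dist_le_mul ?_)
      intro α hα β hβ
      rw [Real.dist_eq, Real.dist_eq, NNReal.coe_ofNat]
      rcases le_total α β with h | h
      · obtain ⟨h1, h2⟩ := hstep α (hsub hα) β (hsub hβ) h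
        rw [abs_sub_comm, abs_sub_comm α, abs_of_nonneg (sub_nonneg.2 h), abs_le]
        constructor <;> linarith
      · obtain ⟨h1, h2⟩ := hstep β (hsub hβ) α (hsub hα) h
        rw [abs_of_nonneg (sub_nonneg.2 h), abs_le]
        constructor <;> linarith
    have hl := hsub (left_mem_Icc.2 hle)
    have hu := hsub (right_mem_Icc.2 hle)
    have hgl := (funG_recR_mem (hwin hl) (Ioo_subset_Icc_self (hmem _ hl))).1
    have hgu := (funG_recR_mem (hwin hu) (Ioo_subset_Icc_self (hmem _ hu))).2
    obtain ⟨αStar, hα, h0⟩ := intermediate_value_Icc' hle hcont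
      (show (0 : ℝ) ∈ Icc _ _ from ⟨by linarith, by linarith⟩)
    exact ⟨αStar, ⟨hsub hα, h0⟩, fun β hβ => hanti.injOn hβ.1 (hsub hα) (hβ.2.trans h0.symm)⟩
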